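/- Let $\ell^2(\mathbb{N})$ be the space of real square-summable sequences $A=(A_n)_{n\ge 0}$, and let $S_{njki}=\min\{n,j,k,i\}+1$. For $\omega\in\mathbb{R}$ and $A\in\ell^2(\mathbb{N})$ call $(\omega,A)$ a stationary state (with $\lambda=1$) if $$(n+1)(1-n\omega)A_n=\sum_{j=0}^{\infty}\sum_{k=0}^{n+j}S_{njk,n+j-k}\,A_jA_kA_{n+j-k},\qquad n\in\mathbb{N},$$ as an identity in $\ell^2(\mathbb{N})$, i.e. the outer series converges unconditionally for every $n$ and the sequence $\big((n+1)(1-n\omega)A_n\big)_{n}$ is square-summable. For every $\omega$ the lowest eigenmode $A=\delta_{n0}$ is a stationary state. If $(\omega, A)$ is a stationary state, so is its reflection $(\omega,((-1)^nA_n)_n)$. **Theorem.** Let $\omega_*=1/6$, the double bifurcation point $\omega_2=\omega_3$ of $\omega_m=\frac{m-1}{m(m+1)}$. Exactly three branches of nontrivial stationary states bifurcate from the lowest eigenmode at $\omega_*$. Precisely, there are $\delta>0$, $C>0$, maps $\Phi_1,\Phi_2,\Phi_3$, $\Phi_i=(\omega^{(i)},A^{(i)})$, from the square $\{(\epsilon,\mu)\in\mathbb{R}^2: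 |\epsilon|<\delta,\ |\mu|<\delta\}$ to $\mathbb{R}\times\ell^2(\mathbb{N})$, of class $C^\infty$, and a $C^\infty$ function $m:(-\delta,0)\to(0,\delta)$ such that: * for each $i$ and all $(\epsilon,\mu)$ in the square, $A^{(i)}_2(\epsilon,\mu)=\epsilon$, $A^{(i)}_3(\epsilon,\mu)=\mu$ and $$|\omega^{(i)}(\epsilon,\mu)-\omega_*|+\sup_{n\in\mathbb{N}}\left|A^{(i)}_n(\epsilon,\mu)-\delta_{n0}-\epsilon\delta_{n2}-\mu\delta_{n3}\right|\le C(\epsilon^2+\mu^2);$$ * (i) $\Phi_1(\epsilon,\mu)$ is a stationary state whenever $\epsilon=0$, $0<|\mu|<\delta$; * (ii) $\Phi_2(\epsilon,\mu)$ is a stationary state whenever $0<|\epsilon|<\delta$, $\mu=0$; * (iii) $\Phi_3(\epsilon,\mu)$ is a stationary state whenever $-\delta<\epsilon<0$, $\mu=m(\epsilon)$, where $\big|m(\epsilon)-2|\epsilon|^{3/2}\big|\le C\epsilon^2$ on $(-\delta,0)$; the reflection of $\Phi_3(\epsilon,m(\epsilon))$ is then also a stationary state (with $\mu=-m(\epsilon)$);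 * there is $\eta>0$ such that every stationary state $(\omega,A)$ with $|\omega-\omega_*|<\eta$ and $\|A-\delta_{n0}\|_{\ell^2}<\eta$ is either trivial, $A=\delta_{n0}$, or equal to one of the states in (i), (ii), (iii), or to the reflection of a state in (iii). -/

import Mathlib

noncomputable section

/-- The real Hilbert space of square-summable sequences indexed by the nonnegative integers. -/
abbrev RealEll2 : Type := lp (fun _ : ℕ => ℝ) 2

/-- The interaction coefficient `min (n, j, k, i) + 1`. -/
def interactionCoeff (n j k i : ℕ) : ℕ := min (min n j) (min k i) + 1

/-- For fixed `n` and `j`, the (finite) inner sum over `0 ≤ k ≤ n + j` of the cubic nonlinearity. -/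
def cubicTerm (A : ℕ → ℝ) (n j : ℕ) : ℝ :=
  ∑ k ∈ Finset.range (n + j + 1),
    (interactionCoeff n j k (n + j - k) : ℝ) * A j * A k * A (n + j - k)

/-- `A ∈ ℓ²` is a real stationary state of the cubic conformal flow with parameters `lam`, `ω`:
`(n + 1) (lam - n ω) A_n = ∑_j ∑_{k ≤ n + j} S_{n,j,k,n+j-k} A_j A_k A_{n+j-k}`, `n ∈ ℕ`,
as an identity between elements of `ℓ²`, the outer series on the right being convergent. -/
structure IsRealStationaryState (lam ω : ℝ) (A : RealEll2) : Prop where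
  square_summable : Memℓp (fun n : ℕ => ((n : ℝ) + 1) * (lam - n * ω) * A n) 2
  equation : ∀ n : ℕ, HasSum (fun j : ℕ => cubicTerm A n j) (((n : ℝ) + 1) * (lam - n * ω) * A n)

/-- The single-mode sequence `n ↦ δ_{n k}`. -/
def mode (k : ℕ) : RealEll2 := lp.single 2 k (1 : ℝ)

/-- The reflection `A_n ↦ (-1)^n A_n`. -/
def reflection (A : RealEll2) : RealEll2 :=
  ⟨fun n => (-1 : ℝ) ^ n * A n, by
    have h : Memℓp (fun n : ℕ => A n) 2 := lp.memℓp A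
    refine h.mono' fun n => ?_
    simp⟩

/-- The pairs `(ε, μ)` with `|ε|, |μ| < δ`. -/
def parameterSquare (δ : ℝ) : Set (ℝ × ℝ) := {p | |p.1| < δ ∧ |p.2| < δ}

/-- `Φ = (ω, A)` is smooth in the small parameters `(ε, μ)`, the parameters being the components
`ε = A_2` and `μ = A_3`; it satisfies
`|ω - 1/6| + sup_n |A_n - δ_{n0} - ε δ_{n2} - μ δ_{n3}| ≤ C (ε² + μ²)`;
and its values at the parameters in `Γ` are stationary states with `lam = 1`. -/
structure IsSmoothBranch (δ C : ℝ) (Γ : Set (ℝ × ℝ)) (Φ : ℝ × ℝ → ℝ × RealEll2) : Prop where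
  smooth : ContDiffOn ℝ (⊤ : ℕ∞) Φ (parameterSquare δ)
  parameters : ∀ ε μ : ℝ, (ε, μ) ∈ parameterSquare δ →
    (Φ (ε, μ)).2 2 = ε ∧ (Φ (ε, μ)).2 3 = μ
  bound : ∀ ε μ : ℝ, (ε, μ) ∈ parameterSquare δ →
    |(Φ (ε, μ)).1 - 1 / 6| +
      (⨆ n : ℕ, |(Φ (ε, μ)).2 n - mode 0 n - ε * mode 2 n - μ * mode 3 n|) ≤ C * (ε ^ 2 + μ ^ 2)
  stationary : ∀ p ∈ Γ ∩ parameterSquare δ, IsRealStationaryState 1 (Φ p).1 (Φ p).2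

end

noncomputable section

open scoped ENNReal ContDiff Topology
open Filter Asymptotics MeasureTheory


theorem ENNReal.sq_tsum_mul_le {ι : Type*} (κ a b : ι → ℝ≥0∞) :
    (∑' x, κ x * a x * b x) ^ 2 ≤ (∑' x, κ x * a x ^ 2) * ∑' x, κ x * b x ^ 2 := by
  let _ : MeasurableSpace ι := ⊤
  have h := ENNReal.lintegral_mul_le_Lp_mul_Lq (μ := Measure.count) (p := 2) (q := 2)
    Real.HolderConjugate.two_two (f := fun x => κ x ^ (1/2 : ℝ) * a x)
    (g := fun x => κ x ^ (1/2 : ℝ) * b x) (measurable_from_top.aemeasurable)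
    (measurable_from_top.aemeasurable)
  simp only [lintegral_count' measurable_from_top, Pi.mul_apply] at h
  have hk : ∀ x, κ x ^ (1/2 : ℝ) * κ x ^ (1/2 : ℝ) = κ x := fun x => by
    rw [← ENNReal.rpow_add_of_nonneg _ _ (by norm_num) (by norm_num)]; norm_num
  have e1 : ∀ x, κ x ^ (1/2 : ℝ) * a x * (κ x ^ (1/2 : ℝ) * b x) = κ x * a x * b x := fun x => by
    rw [mul_mul_mul_comm, hk, mul_assoc]
  have e2 : ∀ c : ι → ℝ≥0∞, ∀ x, (κ x ^ (1/2 : ℝ) * c x) ^ (2:ℝ) = κ x * c x ^ 2 := fun c x => by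
    rw [show (2:ℝ) = ((2:ℕ):ℝ) by norm_num, ENNReal.rpow_natCast, mul_pow, sq (κ x ^ _)]
    norm_num at hk ⊢; rw [hk]
  simp only [e1, e2] at h
  calc _ ≤ _ := pow_le_pow_left' h 2
    _ = _ := by
      rw [mul_pow]
      simp only [← ENNReal.rpow_natCast, ← ENNReal.rpow_mul]
      norm_num

theorem sum_range_max_le (j N : ℕ) :
    ∑ i ∈ Finset.range N, ((j : ℝ) + 1) / ((max i j : ℕ) + 1 : ℝ) ^ 2 ≤ 2 := by
  have hj : (0 : ℝ) < (j : ℝ) + 1 := by positivity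
  have key : ∀ N : ℕ, (N ≤ j + 1 → ∑ i ∈ Finset.range N,
      ((j : ℝ) + 1) / ((max i j : ℕ) + 1 : ℝ) ^ 2 ≤ (N : ℝ) / (j + 1)) ∧ (j + 1 ≤ N →
      ∑ i ∈ Finset.range N, ((j : ℝ) + 1) / ((max i j : ℕ) + 1 : ℝ) ^ 2 ≤ 2 - ((j : ℝ) + 1) / N) := by
    intro N
    induction N with
    | zero => simp
    | succ N ih =>
      rw [Finset.sum_range_succ]
      have h1 : N + 1 ≤ j + 1 → ∑ i ∈ Finset.range N, ((j : ℝ) + 1) / ((max i j : ℕ) + 1 : ℝ) ^ 2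
          + ((j : ℝ) + 1) / ((max N j : ℕ) + 1 : ℝ) ^ 2 ≤ ((N + 1 : ℕ) : ℝ) / (j + 1) := by
        intro h
        have := ih.1 (by omega)
        rw [max_eq_right (by omega : N ≤ j)]
        have e : ((j : ℝ) + 1) / (j + 1) ^ 2 = 1 / (j + 1) := by field_simp
        rw [e]; push_cast at this ⊢; rw [add_div]; linarith
      refine ⟨h1, fun h => ?_⟩
      rcases h.eq_or_lt with h | h
      · have hN : N = j := by omega
        refine (h1 (by omega)).trans ?_
        rw [← h]; push_cast; rw [div_self hj.ne']; norm_num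
      · have := ih.2 (by omega)
        rw [max_eq_left (by omega : j ≤ N)]
        have hN : (0 : ℝ) < N := by exact_mod_cast (by omega : 0 < N)
        have e : ((j : ℝ) + 1) / (N + 1) ^ 2 ≤ (j + 1) / N - (j + 1) / (N + 1) := by
          rw [div_sub_div _ _ hN.ne' (by positivity), div_le_div_iff₀ (by positivity) (by positivity)]
          have : 0 ≤ ((j : ℝ) + 1) * (N + 1) := by positivity
          nlinarith
        push_cast at this ⊢; linarith
  rcases le_total N (j + 1) with h | h
  · refine ((key N).1 h).trans ?_
    rw [div_le_iff₀ hj]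
    have : (N : ℝ) ≤ j + 1 := by exact_mod_cast h
    linarith
  · refine ((key N).2 h).trans ?_
    have : (0 : ℝ) ≤ ((j : ℝ) + 1) / N := by positivity
    linarith

theorem tsum_max_le (j : ℕ) :
    ∑' i : ℕ, ENNReal.ofReal (((j : ℝ) + 1) / ((max i j : ℕ) + 1 : ℝ) ^ 2) ≤ 2 := by
  refine ENNReal.tsum_le_of_sum_range_le fun N => ?_
  rw [← ENNReal.ofReal_sum_of_nonneg fun i _ => by positivity]
  exact (ENNReal.ofReal_le_ofReal (sum_range_max_le j N)).trans (by norm_num)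

theorem ENNReal.tsum_ite_le {ι : Type*} (P : ι → Prop) [DecidablePred P]
    (hP : ∀ a b, P a → P b → a = b) (c : ℝ≥0∞) : ∑' a, (if P a then c else 0) ≤ c := by
  by_cases h : ∃ a, P a
  · obtain ⟨a, ha⟩ := h
    rw [tsum_eq_single a fun b hb => if_neg fun hb' => hb (hP b a hb' ha), if_pos ha]
  · push Not at h
    simp [h]

/-- The interaction coefficient on the resonant set, divided by the square of the largest index. -/
def resonantWeight (n : ℕ) (p : ℕ × ℕ × ℕ) : ℝ≥0∞ :=
  if n + p.1 = p.2.1 + p.2.2 then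
    ENNReal.ofReal ((interactionCoeff n p.1 p.2.1 p.2.2 : ℝ) /
      ((max p.1 (max p.2.1 p.2.2) : ℕ) + 1 : ℝ) ^ 2) else 0

theorem resonantWeight_le_right (n j k i : ℕ) : resonantWeight n (j, k, i) ≤
    if n + j = k + i then
      ENNReal.ofReal (((i : ℝ) + 1) / ((max j i : ℕ) + 1 : ℝ) ^ 2) else 0 := by
  unfold resonantWeight
  split_ifs with h
  · refine ENNReal.ofReal_le_ofReal ?_
    have h1 : (interactionCoeff n j k i : ℝ) ≤ (i : ℝ) + 1 := by
      exact_mod_cast (by simp [interactionCoeff] : interactionCoeff n j k i ≤ i + 1)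
    have h2 : max j i ≤ max j (max k i) := by omega
    dsimp only
    gcongr
  · exact le_rfl

theorem resonantWeight_le_left (n j k i : ℕ) : resonantWeight n (j, k, i) ≤
    if n + j = k + i then
      ENNReal.ofReal (((j : ℝ) + 1) / ((max i j : ℕ) + 1 : ℝ) ^ 2) else 0 := by
  unfold resonantWeight
  split_ifs with h
  · refine ENNReal.ofReal_le_ofReal ?_
    have h1 : (interactionCoeff n j k i : ℝ) ≤ (j : ℝ) + 1 := by
      exact_mod_cast (by simp [interactionCoeff] : interactionCoeff n j k i ≤ j + 1)
    have h2 : max i j ≤ max j (max k i) := by omega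
    dsimp only
    gcongr
  · exact le_rfl

theorem tsum_resonantWeight_mul_sq_le (n : ℕ) (h : ℕ → ℝ≥0∞) :
    ∑' p : ℕ × ℕ × ℕ, resonantWeight n p * h p.2.2 ^ 2 ≤ 2 * ∑' i, h i ^ 2 := by
  calc ∑' p : ℕ × ℕ × ℕ, resonantWeight n p * h p.2.2 ^ 2
      = ∑' i : ℕ, ∑' j : ℕ, ∑' k : ℕ, resonantWeight n (j, k, i) * h i ^ 2 := by
        simp only [ENNReal.tsum_prod']
        rw [ENNReal.tsum_comm (f := fun i j => ∑' k : ℕ, resonantWeight n (j, k, i) * h i ^ 2)]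
        exact tsum_congr fun j => ENNReal.tsum_comm
    _ ≤ ∑' i : ℕ, 2 * h i ^ 2 := by
        refine ENNReal.tsum_le_tsum fun i => ?_
        simp_rw [ENNReal.tsum_mul_right]
        gcongr
        refine le_trans (ENNReal.tsum_le_tsum fun j => ?_) (tsum_max_le i)
        refine (ENNReal.tsum_le_tsum fun k => resonantWeight_le_right n j k i).trans ?_
        exact ENNReal.tsum_ite_le _ (fun a b ha hb => by omega) _
    _ = _ := ENNReal.tsum_mul_left

theorem tsum_tsum_resonantWeight_mul_sq_le (f g : ℕ → ℝ≥0∞) :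
    ∑' n, ∑' p : ℕ × ℕ × ℕ, resonantWeight n p * (f p.1 * g p.2.1) ^ 2 ≤
      2 * ((∑' j, f j ^ 2) * ∑' k, g k ^ 2) := by
  rw [ENNReal.tsum_comm]
  simp_rw [ENNReal.tsum_mul_right, ENNReal.tsum_prod', ENNReal.tsum_mul_right]
  calc _ ≤ ∑' j : ℕ, ∑' k : ℕ, 2 * (f j * g k) ^ 2 := by
        refine ENNReal.tsum_le_tsum fun j => ENNReal.tsum_le_tsum fun k => ?_
        gcongr
        refine le_trans (ENNReal.tsum_le_tsum fun i => ?_) (tsum_max_le j)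
        refine (ENNReal.tsum_le_tsum fun n => resonantWeight_le_left n j k i).trans ?_
        exact ENNReal.tsum_ite_le _ (fun a b ha hb => by omega) _
    _ = _ := by
        simp_rw [mul_pow, ENNReal.tsum_mul_left, ENNReal.tsum_mul_right]

theorem tsum_sq_tsum_resonantWeight_le (f g h : ℕ → ℝ≥0∞) :
    ∑' n, (∑' p : ℕ × ℕ × ℕ, resonantWeight n p * (f p.1 * g p.2.1) * h p.2.2) ^ 2 ≤
      4 * ((∑' j, f j ^ 2) * (∑' k, g k ^ 2) * ∑' i, h i ^ 2) := by
  calc _ ≤ ∑' n, (∑' p : ℕ × ℕ × ℕ, resonantWeight n p * (f p.1 * g p.2.1) ^ 2) *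
        (2 * ∑' i, h i ^ 2) := by
        refine ENNReal.tsum_le_tsum fun n => (ENNReal.sq_tsum_mul_le _ _ _).trans ?_
        gcongr
        exact tsum_resonantWeight_mul_sq_le n h
    _ ≤ (2 * ((∑' j, f j ^ 2) * ∑' k, g k ^ 2)) * (2 * ∑' i, h i ^ 2) := by
        rw [ENNReal.tsum_mul_right]
        gcongr
        exact tsum_tsum_resonantWeight_mul_sq_le f g
    _ = _ := by ring

/-- The trilinear sum with nonnegative terms. -/
def resonantSum (f g h : ℕ → ℝ≥0∞) (n : ℕ) : ℝ≥0∞ :=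
  ∑' p : ℕ × ℕ × ℕ, if n + p.1 = p.2.1 + p.2.2 then
    (interactionCoeff n p.1 p.2.1 p.2.2 : ℝ≥0∞) * (f p.1 * g p.2.1) * h p.2.2 else 0

/-- The quadratic weight `(n + 1)²`. -/
def wt (n : ℕ) : ℝ := ((n : ℝ) + 1) ^ 2

theorem wt_pos (n : ℕ) : 0 < wt n := by unfold wt; positivity

theorem one_le_wt (n : ℕ) : 1 ≤ wt n := by
  unfold wt
  exact one_le_pow₀ (by linarith [(Nat.cast_nonneg n : (0 : ℝ) ≤ n)])

theorem resonantSum_le (f g h : ℕ → ℝ≥0∞) (n : ℕ) :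
    resonantSum f g h n ≤
      (∑' p : ℕ × ℕ × ℕ, resonantWeight n p * ((ENNReal.ofReal (wt p.1) * f p.1) * g p.2.1) *
        h p.2.2) +
      (∑' p : ℕ × ℕ × ℕ, resonantWeight n p * (f p.1 * (ENNReal.ofReal (wt p.2.1) * g p.2.1)) *
        h p.2.2) +
      ∑' p : ℕ × ℕ × ℕ, resonantWeight n p * (f p.1 * g p.2.1) *
        (ENNReal.ofReal (wt p.2.2) * h p.2.2) := by
  rw [← ENNReal.tsum_add, ← ENNReal.tsum_add]
  refine ENNReal.tsum_le_tsum fun ⟨j, k, i⟩ => ?_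
  dsimp only
  split_ifs with hn
  swap
  · exact zero_le
  have hw : (interactionCoeff n j k i : ℝ≥0∞) ≤ resonantWeight n (j, k, i) *
      (ENNReal.ofReal (wt j) + ENNReal.ofReal (wt k) + ENNReal.ofReal (wt i)) := by
    have e : (interactionCoeff n j k i : ℝ≥0∞) = resonantWeight n (j, k, i) *
        ENNReal.ofReal (wt (max j (max k i))) := by
      simp only [resonantWeight, if_pos hn]
      rw [← ENNReal.ofReal_mul (by positivity), wt, div_mul_cancel₀ _ (by positivity),
        ENNReal.ofReal_natCast]
    rw [e]
    gcongr
    rcases max_choice j (max k i) with h | h <;> rw [h]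
    · exact le_self_add.trans le_self_add
    · rcases max_choice k i with h | h <;> rw [h]
      · exact le_add_self.trans le_self_add
      · exact le_add_self
  calc _ ≤ (resonantWeight n (j, k, i) *
      (ENNReal.ofReal (wt j) + ENNReal.ofReal (wt k) + ENNReal.ofReal (wt i))) * (f j * g k) *
        h i := by gcongr
    _ = _ := by ring

theorem ENNReal.add_add_sq_le (a b c : ℝ≥0∞) :
    (a + b + c) ^ 2 ≤ 3 * (a ^ 2 + b ^ 2 + c ^ 2) := by
  by_cases h : a = ⊤ ∨ b = ⊤ ∨ c = ⊤
  · rcases h with h | h | h <;> simp [h]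
  · push Not at h
    lift a to NNReal using h.1
    lift b to NNReal using h.2.1
    lift c to NNReal using h.2.2
    norm_cast
    rw [← NNReal.coe_le_coe]
    push_cast
    nlinarith [sq_nonneg ((a : ℝ) - b), sq_nonneg ((a : ℝ) - c), sq_nonneg ((b : ℝ) - c)]

theorem tsum_resonantSum_sq_le (f g h : ℕ → ℝ≥0∞) :
    ∑' n, resonantSum f g h n ^ 2 ≤
      12 * ((∑' j, (ENNReal.ofReal (wt j) * f j) ^ 2) * (∑' k, g k ^ 2) * (∑' i, h i ^ 2) +
        (∑' j, f j ^ 2) * (∑' k, (ENNReal.ofReal (wt k) * g k) ^ 2) * (∑' i, h i ^ 2) +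
        (∑' j, f j ^ 2) * (∑' k, g k ^ 2) * ∑' i, (ENNReal.ofReal (wt i) * h i) ^ 2) := by
  refine (ENNReal.tsum_le_tsum fun n => (pow_le_pow_left' (resonantSum_le f g h n) 2).trans
    (ENNReal.add_add_sq_le _ _ _)).trans ?_
  rw [ENNReal.tsum_mul_left, ENNReal.tsum_add, ENNReal.tsum_add]
  calc _ ≤ 3 * (4 * ((∑' j, (ENNReal.ofReal (wt j) * f j) ^ 2) * (∑' k, g k ^ 2) *
        (∑' i, h i ^ 2)) + 4 * ((∑' j, f j ^ 2) * (∑' k, (ENNReal.ofReal (wt k) * g k) ^ 2) *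
        (∑' i, h i ^ 2)) + 4 * ((∑' j, f j ^ 2) * (∑' k, g k ^ 2) *
        ∑' i, (ENNReal.ofReal (wt i) * h i) ^ 2)) := by
        gcongr
        · exact tsum_sq_tsum_resonantWeight_le (fun j => ENNReal.ofReal (wt j) * f j) g h
        · exact tsum_sq_tsum_resonantWeight_le f (fun j => ENNReal.ofReal (wt j) * g j) h
        · exact tsum_sq_tsum_resonantWeight_le f g (fun j => ENNReal.ofReal (wt j) * h j)
    _ = _ := by ring


theorem RealEll2.tsum_enorm_sq (x : RealEll2) :
    ∑' n, ‖x n‖ₑ ^ 2 = ENNReal.ofReal (‖x‖ ^ 2) := by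
  have h := lp.hasSum_norm (p := 2) (by norm_num) x
  simp only [ENNReal.toReal_ofNat, Real.rpow_ofNat] at h
  rw [← h.tsum_eq, ENNReal.ofReal_tsum_of_nonneg (fun n => by positivity) h.summable]
  refine tsum_congr fun n => ?_
  rw [ENNReal.ofReal_pow (norm_nonneg _), ofReal_norm]

theorem memℓp_of_tsum_enorm_sq {f : ℕ → ℝ} {C : ℝ}
    (h : ∑' n, ‖f n‖ₑ ^ 2 ≤ ENNReal.ofReal C) : Memℓp f 2 := by
  refine memℓp_gen ?_
  simp only [ENNReal.toReal_ofNat, Real.rpow_ofNat]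
  have e : ∀ n, ‖f n‖ₑ ^ 2 = ENNReal.ofReal (‖f n‖ ^ 2) := fun n => by
    rw [ENNReal.ofReal_pow (norm_nonneg _), ofReal_norm]
  simp only [e] at h
  have := ENNReal.summable_toReal (h.trans_lt ENNReal.ofReal_lt_top).ne
  refine this.congr fun n => ?_
  rw [ENNReal.toReal_ofReal (by positivity)]

theorem RealEll2.norm_sq_le {x : RealEll2} {C : ℝ} (hC : 0 ≤ C)
    (h : ∑' n, ‖x n‖ₑ ^ 2 ≤ ENNReal.ofReal C) : ‖x‖ ^ 2 ≤ C := by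
  rw [RealEll2.tsum_enorm_sq] at h
  exact (ENNReal.ofReal_le_ofReal_iff hC).1 h

/-- Multiplication by a bounded sequence. -/
def diagOp (c : ℕ → ℝ) (K : ℝ) (h : ∀ n, |c n| ≤ K) : RealEll2 →L[ℝ] RealEll2 :=
  LinearMap.mkContinuous
    { toFun := fun x => ⟨fun n => c n * x n, ((lp.memℓp x).const_mul K).mono' fun n => by
        rw [norm_mul, norm_mul]
        gcongr
        exact (h n).trans (le_abs_self K)⟩
      map_add' := fun x y => by ext n; exact mul_add _ _ _
      map_smul' := fun r x => by ext n; exact mul_left_comm _ _ _ } K fun x => by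
    have hK : 0 ≤ K := (abs_nonneg _).trans (h 0)
    refine (lp.norm_mono (p := 2) (by norm_num) (y := K • x) fun n => ?_).trans ?_
    · simp only [LinearMap.coe_mk, AddHom.coe_mk, lp.coeFn_smul, Pi.smul_apply, smul_eq_mul,
        norm_mul]
      gcongr
      exact (h n).trans (le_abs_self K)
    · rw [norm_smul, Real.norm_of_nonneg hK]

@[simp] theorem diagOp_apply (c : ℕ → ℝ) (K : ℝ) (h : ∀ n, |c n| ≤ K) (x : RealEll2) (n : ℕ) :
    diagOp c K h x n = c n * x n := rfl

theorem norm_diagOp_le (c : ℕ → ℝ) (K : ℝ) (h : ∀ n, |c n| ≤ K) (x : RealEll2) :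
    ‖diagOp c K h x‖ ≤ K * ‖x‖ :=
  ContinuousLinearMap.le_of_opNorm_le _
    (LinearMap.mkContinuous_norm_le _ ((abs_nonneg _).trans (h 0)) _) x

/-- Division by the quadratic weight. -/
def unweight : RealEll2 →L[ℝ] RealEll2 :=
  diagOp (fun n => (wt n)⁻¹) 1 fun n => by
    rw [abs_of_pos (inv_pos.2 (wt_pos n))]; exact inv_le_one_of_one_le₀ (one_le_wt n)

@[simp] theorem unweight_apply (x : RealEll2) (n : ℕ) : unweight x n = (wt n)⁻¹ * x n := rfl

theorem norm_unweight_le (x : RealEll2) : ‖unweight x‖ ≤ ‖x‖ := by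
  simpa only [one_mul, unweight] using norm_diagOp_le (fun n => (wt n)⁻¹) 1 _ x

/-- A term of the trilinear sum with the kernel restricted to the set `χ`. -/
def triTerm (χ : ℕ → ℕ → ℕ → Bool) (a b c : ℕ → ℝ) (n : ℕ) (p : ℕ × ℕ) : ℝ :=
  if p.2 ≤ n + p.1 ∧ χ n p.1 p.2 = true then
    (interactionCoeff n p.1 p.2 (n + p.1 - p.2) : ℝ) * a p.1 * b p.2 * c (n + p.1 - p.2) else 0

theorem tsum_enorm_triTerm_le (χ : ℕ → ℕ → ℕ → Bool) (a b c : ℕ → ℝ) (n : ℕ) :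
    ∑' p, ‖triTerm χ a b c n p‖ₑ ≤
      resonantSum (fun j => ‖a j‖ₑ) (fun j => ‖b j‖ₑ) (fun j => ‖c j‖ₑ) n := by
  unfold resonantSum
  simp only [ENNReal.tsum_prod']
  refine ENNReal.tsum_le_tsum fun j => ENNReal.tsum_le_tsum fun k => ?_
  refine le_trans ?_ (ENNReal.le_tsum (n + j - k))
  unfold triTerm
  dsimp only
  split_ifs with h1 h2 h2
  · rw [enorm_mul, enorm_mul, enorm_mul, Real.enorm_natCast]
    exact le_of_eq (by ring)
  · omega
  · simp
  · simp

theorem tsum_resonantSum_unweight_le (x y z : RealEll2) :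
    ∑' n, resonantSum (fun j => ‖unweight x j‖ₑ) (fun j => ‖unweight y j‖ₑ)
      (fun j => ‖unweight z j‖ₑ) n ^ 2 ≤
      ENNReal.ofReal (12 * (‖x‖ ^ 2 * ‖unweight y‖ ^ 2 * ‖unweight z‖ ^ 2 +
        ‖unweight x‖ ^ 2 * ‖y‖ ^ 2 * ‖unweight z‖ ^ 2 +
        ‖unweight x‖ ^ 2 * ‖unweight y‖ ^ 2 * ‖z‖ ^ 2)) := by
  refine (tsum_resonantSum_sq_le _ _ _).trans (le_of_eq ?_)
  have e : ∀ (x : RealEll2) (j : ℕ), ENNReal.ofReal (wt j) * ‖unweight x j‖ₑ = ‖x j‖ₑ := by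
    intro x j
    rw [unweight_apply, enorm_mul, ← mul_assoc, ← Real.enorm_of_nonneg (wt_pos j).le, ← enorm_mul,
      mul_inv_cancel₀ (wt_pos j).ne', enorm_one, one_mul]
  simp only [e, RealEll2.tsum_enorm_sq]
  rw [ENNReal.ofReal_mul (by norm_num), ENNReal.ofReal_add (by positivity) (by positivity),
    ENNReal.ofReal_add (by positivity) (by positivity)]
  simp only [ENNReal.ofReal_mul (mul_nonneg (sq_nonneg _) (sq_nonneg _)),
    ENNReal.ofReal_mul (sq_nonneg _)]
  norm_num

theorem summable_triTerm (χ : ℕ → ℕ → ℕ → Bool) (x y z : RealEll2) (n : ℕ) :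
    Summable (triTerm χ (unweight x) (unweight y) (unweight z) n) := by
  refine Summable.of_enorm ?_
  have h := (ENNReal.le_tsum n).trans (tsum_resonantSum_unweight_le x y z)
  have h2 := h.trans_lt ENNReal.ofReal_lt_top
  rw [ENNReal.pow_lt_top_iff] at h2
  exact ((tsum_enorm_triTerm_le _ _ _ _ _).trans_lt (h2.resolve_right (by norm_num))).ne

theorem tsum_enorm_tsum_triTerm_le (χ : ℕ → ℕ → ℕ → Bool) (x y z : RealEll2) :
    ∑' n, ‖∑' p, triTerm χ (unweight x) (unweight y) (unweight z) n p‖ₑ ^ 2 ≤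
      ENNReal.ofReal (12 * (‖x‖ ^ 2 * ‖unweight y‖ ^ 2 * ‖unweight z‖ ^ 2 +
        ‖unweight x‖ ^ 2 * ‖y‖ ^ 2 * ‖unweight z‖ ^ 2 +
        ‖unweight x‖ ^ 2 * ‖unweight y‖ ^ 2 * ‖z‖ ^ 2)) := by
  refine le_trans (ENNReal.tsum_le_tsum fun n => ?_) (tsum_resonantSum_unweight_le x y z)
  gcongr
  exact (enorm_tsum_le_tsum_enorm ).trans (tsum_enorm_triTerm_le _ _ _ _ _)

/-- The trilinear operator on weighted sequences. -/
def triFun (χ : ℕ → ℕ → ℕ → Bool) (x y z : RealEll2) : RealEll2 :=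
  ⟨fun n => ∑' p, triTerm χ (unweight x) (unweight y) (unweight z) n p,
    memℓp_of_tsum_enorm_sq (tsum_enorm_tsum_triTerm_le χ x y z)⟩

theorem triFun_apply (χ : ℕ → ℕ → ℕ → Bool) (x y z : RealEll2) (n : ℕ) :
    triFun χ x y z n = ∑' p, triTerm χ (unweight x) (unweight y) (unweight z) n p := rfl

theorem norm_triFun_le (χ : ℕ → ℕ → ℕ → Bool) (x y z : RealEll2) :
    ‖triFun χ x y z‖ ≤ 4 * (‖x‖ * ‖unweight y‖ * ‖unweight z‖ +
      ‖unweight x‖ * ‖y‖ * ‖unweight z‖ + ‖unweight x‖ * ‖unweight y‖ * ‖z‖) := by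
  have h : ‖triFun χ x y z‖ ^ 2 ≤ _ :=
    RealEll2.norm_sq_le (by positivity) (tsum_enorm_tsum_triTerm_le χ x y z)
  have h1 : 0 ≤ ‖x‖ * ‖unweight y‖ * ‖unweight z‖ := by positivity
  have h2 : 0 ≤ ‖unweight x‖ * ‖y‖ * ‖unweight z‖ := by positivity
  have h3 : 0 ≤ ‖unweight x‖ * ‖unweight y‖ * ‖z‖ := by positivity
  refine (sq_le_sq₀ (norm_nonneg _) (by linarith)).1 (h.trans ?_)
  simp only [← mul_pow]
  nlinarith [mul_nonneg h1 h2, mul_nonneg h1 h3, mul_nonneg h2 h3]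

theorem triFun_add_left (χ) (x x' y z : RealEll2) :
    triFun χ (x + x') y z = triFun χ x y z + triFun χ x' y z := by
  ext n
  rw [lp.coeFn_add, Pi.add_apply]
  simp only [triFun_apply]
  rw [← (summable_triTerm χ x y z n).tsum_add (summable_triTerm χ x' y z n)]
  refine tsum_congr fun p => ?_
  unfold triTerm
  split_ifs <;> simp; ring

theorem triFun_add_mid (χ) (x y y' z : RealEll2) :
    triFun χ x (y + y') z = triFun χ x y z + triFun χ x y' z := by
  ext n
  rw [lp.coeFn_add, Pi.add_apply]
  simp only [triFun_apply]
  rw [← (summable_triTerm χ x y z n).tsum_add (summable_triTerm χ x y' z n)]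
  refine tsum_congr fun p => ?_
  unfold triTerm
  split_ifs <;> simp; ring

theorem triFun_add_right (χ) (x y z z' : RealEll2) :
    triFun χ x y (z + z') = triFun χ x y z + triFun χ x y z' := by
  ext n
  rw [lp.coeFn_add, Pi.add_apply]
  simp only [triFun_apply]
  rw [← (summable_triTerm χ x y z n).tsum_add (summable_triTerm χ x y z' n)]
  refine tsum_congr fun p => ?_
  unfold triTerm
  split_ifs <;> simp; ring

theorem triFun_smul_left (χ) (r : ℝ) (x y z : RealEll2) :
    triFun χ (r • x) y z = r • triFun χ x y z := by
  ext n
  rw [lp.coeFn_smul, Pi.smul_apply]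
  simp only [triFun_apply, smul_eq_mul, ← tsum_mul_left]
  refine tsum_congr fun p => ?_
  unfold triTerm
  split_ifs <;> simp; ring

theorem triFun_smul_mid (χ) (r : ℝ) (x y z : RealEll2) :
    triFun χ x (r • y) z = r • triFun χ x y z := by
  ext n
  rw [lp.coeFn_smul, Pi.smul_apply]
  simp only [triFun_apply, smul_eq_mul, ← tsum_mul_left]
  refine tsum_congr fun p => ?_
  unfold triTerm
  split_ifs <;> simp; ring

theorem triFun_smul_right (χ) (r : ℝ) (x y z : RealEll2) :
    triFun χ x y (r • z) = r • triFun χ x y z := by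
  ext n
  rw [lp.coeFn_smul, Pi.smul_apply]
  simp only [triFun_apply, smul_eq_mul, ← tsum_mul_left]
  refine tsum_congr fun p => ?_
  unfold triTerm
  split_ifs <;> simp; ring

theorem norm_triFun_le_mul (χ : ℕ → ℕ → ℕ → Bool) (x y z : RealEll2) :
    ‖triFun χ x y z‖ ≤ 12 * ‖x‖ * ‖y‖ * ‖z‖ := by
  refine (norm_triFun_le χ x y z).trans ?_
  calc _ ≤ 4 * (‖x‖ * ‖y‖ * ‖z‖ + ‖x‖ * ‖y‖ * ‖z‖ + ‖x‖ * ‖y‖ * ‖z‖) := by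
        gcongr <;> exact norm_unweight_le _
    _ = _ := by ring

/-- The trilinear operator on weighted sequences, as a continuous trilinear map. -/
def triOp (χ : ℕ → ℕ → ℕ → Bool) : RealEll2 →L[ℝ] RealEll2 →L[ℝ] RealEll2 →L[ℝ] RealEll2 :=
  LinearMap.mkContinuous
    { toFun := fun x => LinearMap.mkContinuous₂
        (LinearMap.mk₂ ℝ (triFun χ x) (triFun_add_mid χ x) (fun r y z => triFun_smul_mid χ r x y z)
          (triFun_add_right χ x) (fun r y z => triFun_smul_right χ r x y z)) (12 * ‖x‖)
        (fun y z => norm_triFun_le_mul χ x y z)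
      map_add' := fun x x' => by ext1 y; ext1 z; exact triFun_add_left χ x x' y z
      map_smul' := fun r x => by ext1 y; ext1 z; exact triFun_smul_left χ r x y z } 12 fun x =>
    LinearMap.mkContinuous₂_norm_le _ (by positivity) (norm_triFun_le_mul χ x)

theorem triOp_apply (χ : ℕ → ℕ → ℕ → Bool) (x y z : RealEll2) :
    triOp χ x y z = triFun χ x y z := rfl

/-- The kernel set of the full nonlinearity. -/
def fullSet : ℕ → ℕ → ℕ → Bool := fun _ _ _ => true

theorem hasSum_cubicTerm_unweight (y : RealEll2) (n : ℕ) :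
    HasSum (fun j => cubicTerm (unweight y) n j) (triOp fullSet y y y n) := by
  refine (summable_triTerm fullSet y y y n).hasSum.prod_fiberwise fun j => ?_
  have h : cubicTerm (unweight y) n j = ∑ k ∈ Finset.range (n + j + 1),
      triTerm fullSet (unweight y) (unweight y) (unweight y) n (j, k) := by
    refine Finset.sum_congr rfl fun k hk => ?_
    rw [triTerm, if_pos ⟨by simpa [Nat.lt_succ_iff] using hk, rfl⟩]
  rw [h]
  refine hasSum_sum_of_ne_finset_zero fun k hk => ?_
  rw [triTerm, if_neg]
  rintro ⟨h, -⟩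
  exact hk (by simpa [Nat.lt_succ_iff] using h)

theorem abs_one_sub_div_six_le (n : ℕ) : |((n : ℝ) + 1) * (1 - n / 6) / wt n| ≤ 1 := by
  have hn : (0 : ℝ) ≤ n := n.cast_nonneg
  rw [abs_div, abs_of_pos (wt_pos n), div_le_one (wt_pos n), wt, abs_le]
  constructor <;> nlinarith

/-- The diagonal part of the equation at frequency `1 / 6`. -/
def lamOp : RealEll2 →L[ℝ] RealEll2 :=
  diagOp (fun n => ((n : ℝ) + 1) * (1 - n / 6) / wt n) 1 abs_one_sub_div_six_le

theorem abs_mul_succ_div_wt_le (n : ℕ) : |(n : ℝ) * (n + 1) / wt n| ≤ 1 := by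
  have hn : (0 : ℝ) ≤ n := n.cast_nonneg
  rw [abs_div, abs_of_pos (wt_pos n), div_le_one (wt_pos n), wt, abs_le]
  constructor <;> nlinarith

/-- The coefficient operator of the frequency. -/
def modeOp : RealEll2 →L[ℝ] RealEll2 :=
  diagOp (fun n => (n : ℝ) * (n + 1) / wt n) 1 abs_mul_succ_div_wt_le

/-- The polynomial family of cubic nonlinearities given by kernel sets. -/
def cubicFamily (Θ : ℕ → ℕ → ℕ → ℕ → ℕ → Bool) (ε s : ℝ) (y : RealEll2) : RealEll2 :=
  ∑ p ∈ Finset.range 4, ∑ q ∈ Finset.range 2, (ε ^ p * s ^ q) • triOp (Θ p q) y y y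

/-- The residual of the stationary equation with parameters `(ε, s, Ω)`. -/
def eqResidual (Θ : ℕ → ℕ → ℕ → ℕ → ℕ → Bool) (q : ℝ × ℝ × ℝ) (y : RealEll2) : RealEll2 :=
  cubicFamily Θ q.1 q.2.1 y - lamOp y + q.2.2 • modeOp y

theorem cubicFamily_zero (Θ : ℕ → ℕ → ℕ → ℕ → ℕ → Bool) (y : RealEll2) :
    cubicFamily Θ 0 0 y = triOp (Θ 0 0) y y y := by
  simp [cubicFamily, Finset.sum_range_succ]

/-- The residual of the unscaled stationary equation. -/
def fullResidual (Ω : ℝ) (y : RealEll2) : RealEll2 :=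
  eqResidual (fun _ _ => fullSet) (0, 0, Ω) y

theorem fullResidual_eq (Ω : ℝ) (y : RealEll2) :
    fullResidual Ω y = triOp fullSet y y y - lamOp y + Ω • modeOp y := by
  rw [fullResidual, eqResidual, cubicFamily_zero]

theorem linear_part_apply (Ω : ℝ) (y : RealEll2) (n : ℕ) :
    ((n : ℝ) + 1) * (1 - n * (1 / 6 + Ω)) * unweight y n = (lamOp y - Ω • modeOp y) n := by
  simp only [lp.coeFn_sub, Pi.sub_apply, lp.coeFn_smul, Pi.smul_apply, lamOp, modeOp,
    diagOp_apply, unweight_apply, smul_eq_mul]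
  field_simp [(wt_pos n).ne']
  ring

theorem fullResidual_apply (Ω : ℝ) (y : RealEll2) (n : ℕ) :
    fullResidual Ω y n = triOp fullSet y y y n -
      ((n : ℝ) + 1) * (1 - n * (1 / 6 + Ω)) * unweight y n := by
  rw [linear_part_apply, fullResidual_eq]
  simp only [lp.coeFn_sub, lp.coeFn_add, Pi.add_apply, Pi.sub_apply]
  ring

theorem isRealStationaryState_unweight_iff (Ω : ℝ) (y : RealEll2) :
    IsRealStationaryState 1 (1 / 6 + Ω) (unweight y) ↔ ∀ n, fullResidual Ω y n = 0 := by
  have h := hasSum_cubicTerm_unweight y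
  constructor
  · intro hs n
    rw [fullResidual_apply, sub_eq_zero]
    exact (h n).unique (hs.equation n)
  · intro hr
    refine ⟨?_, fun n => ?_⟩
    · have := lp.memℓp (lamOp y - Ω • modeOp y)
      simpa only [linear_part_apply] using this
    · have := hr n
      rw [fullResidual_apply, sub_eq_zero] at this
      rw [← this]
      exact h n

/-- The linearized eigenvalues at the lowest mode and frequency `1 / 6`. -/
def linCoeff (n : ℕ) : ℝ := if n = 0 then 2 else ((n : ℝ) - 2) * (n - 3) / 6

/-- The coefficients of the pseudo-inverse of the linearized operator. -/
def pseudoInvCoeff (n : ℕ) : ℝ := if n = 2 ∨ n = 3 then 0 else wt n / linCoeff n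

theorem linCoeff_ne_zero {n : ℕ} (h2 : n ≠ 2) (h3 : n ≠ 3) : linCoeff n ≠ 0 := by
  unfold linCoeff
  split_ifs
  · norm_num
  · have h2' : (n : ℝ) - 2 ≠ 0 := sub_ne_zero.2 (by exact_mod_cast h2)
    have h3' : (n : ℝ) - 3 ≠ 0 := sub_ne_zero.2 (by exact_mod_cast h3)
    positivity

theorem abs_pseudoInvCoeff_le (n : ℕ) : |pseudoInvCoeff n| ≤ 75 := by
  unfold pseudoInvCoeff linCoeff wt
  match n with
  | 0 => norm_num
  | 1 => norm_num
  | 2 => norm_num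
  | 3 => norm_num
  | m + 4 =>
    have hm : (0 : ℝ) ≤ m := m.cast_nonneg
    rw [if_neg (by omega), if_neg (by omega)]
    push_cast
    have h : (0 : ℝ) < (m + 4 - 2) * (m + 4 - 3) / 6 := by
      have : (0 : ℝ) < (m + 2) * (m + 1) / 6 := by positivity
      convert this using 2; ring
    rw [abs_of_nonneg (by positivity), div_le_iff₀ h]
    nlinarith

/-- The pseudo-inverse of the linearized operator. -/
def pseudoInv : RealEll2 →L[ℝ] RealEll2 := diagOp pseudoInvCoeff 75 abs_pseudoInvCoeff_le

/-- The projection on the modes `2` and `3`. -/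
def kernelProj : RealEll2 →L[ℝ] RealEll2 :=
  diagOp (fun n => if n = 2 ∨ n = 3 then 1 else 0) 1 fun n => by split_ifs <;> simp

/-- The projected equation near `δ₀ + κ (δ₂ + δ₃)`. -/
def projectedEq (Θ : ℕ → ℕ → ℕ → ℕ → ℕ → Bool) (v : (ℝ × ℝ × ℝ × ℝ) × RealEll2) : RealEll2 :=
  pseudoInv (eqResidual Θ v.1.2 (lp.single 2 0 (1 : ℝ) +
    v.1.1 • (lp.single 2 2 (9 : ℝ) + lp.single 2 3 (16 : ℝ)) + v.2)) + kernelProj v.2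

theorem contDiff_eqResidual (Θ : ℕ → ℕ → ℕ → ℕ → ℕ → Bool) :
    ContDiff ℝ ω fun v : (ℝ × ℝ × ℝ) × RealEll2 => eqResidual Θ v.1 v.2 := by
  unfold eqResidual cubicFamily
  fun_prop

theorem contDiff_projectedEq (Θ : ℕ → ℕ → ℕ → ℕ → ℕ → Bool) : ContDiff ℝ ω (projectedEq Θ) := by
  unfold projectedEq eqResidual cubicFamily
  fun_prop

/-- The kernel set contains the resonances with two zero indices. -/
def ContainsTrivial (χ : ℕ → ℕ → ℕ → Bool) : Prop :=
  ∀ n, χ n 0 0 = true ∧ χ n 0 n = true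

theorem unweight_single_zero_apply (n : ℕ) :
    unweight (lp.single 2 0 (1 : ℝ)) n = if n = 0 then 1 else 0 := by
  rw [unweight_apply, lp.single_apply]
  split_ifs with h <;> simp [h, wt]

theorem triOp_zero_zero_right {χ : ℕ → ℕ → ℕ → Bool} (hχ : ContainsTrivial χ) (x : RealEll2) (n : ℕ) :
    triOp χ x (lp.single 2 0 (1 : ℝ)) (lp.single 2 0 (1 : ℝ)) n =
      if n = 0 then unweight x 0 else 0 := by
  rw [triOp_apply, triFun_apply, tsum_eq_single (0, 0)]
  · unfold triTerm
    simp only [unweight_single_zero_apply]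
    split_ifs with h h1 h2 <;> simp_all [interactionCoeff, ContainsTrivial]
  · rintro ⟨j, k⟩ h
    unfold triTerm
    simp only [unweight_single_zero_apply]
    split_ifs with h1 h2 h3 <;> simp
    exfalso; apply h
    simp only [Prod.mk.injEq]
    omega

theorem triOp_zero_mid_zero {χ : ℕ → ℕ → ℕ → Bool} (hχ : ContainsTrivial χ) (x : RealEll2) (n : ℕ) :
    triOp χ (lp.single 2 0 (1 : ℝ)) x (lp.single 2 0 (1 : ℝ)) n = unweight x n := by
  rw [triOp_apply, triFun_apply, tsum_eq_single (0, n)]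
  · unfold triTerm
    simp [(hχ n).2, interactionCoeff, wt]
  · rintro ⟨j, k⟩ h
    unfold triTerm
    simp only [unweight_single_zero_apply]
    split_ifs with h1 h2 h3 <;> simp
    exfalso; apply h
    simp only [Prod.mk.injEq]
    omega

theorem triOp_zero_zero_left {χ : ℕ → ℕ → ℕ → Bool} (hχ : ContainsTrivial χ) (x : RealEll2) (n : ℕ) :
    triOp χ (lp.single 2 0 (1 : ℝ)) (lp.single 2 0 (1 : ℝ)) x n = unweight x n := by
  rw [triOp_apply, triFun_apply, tsum_eq_single (0, 0)]
  · unfold triTerm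
    simp [(hχ n).1, interactionCoeff, wt]
  · rintro ⟨j, k⟩ h
    unfold triTerm
    simp only [unweight_single_zero_apply]
    split_ifs with h1 h2 h3 <;> simp
    exfalso; apply h
    simp only [Prod.mk.injEq]
    omega

theorem pseudoInv_linear_part {χ : ℕ → ℕ → ℕ → Bool} (hχ : ContainsTrivial χ) (b : RealEll2) :
    pseudoInv (triOp χ b (lp.single 2 0 (1 : ℝ)) (lp.single 2 0 (1 : ℝ)) +
      triOp χ (lp.single 2 0 (1 : ℝ)) b (lp.single 2 0 (1 : ℝ)) +
      triOp χ (lp.single 2 0 (1 : ℝ)) (lp.single 2 0 (1 : ℝ)) b - lamOp b) + kernelProj b = b := by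
  ext n
  simp only [lp.coeFn_add, lp.coeFn_sub, Pi.add_apply, Pi.sub_apply, pseudoInv, kernelProj, lamOp,
    diagOp_apply, triOp_zero_zero_right hχ, triOp_zero_mid_zero hχ, triOp_zero_zero_left hχ,
    unweight_apply]
  by_cases h : n = 2 ∨ n = 3
  · simp [pseudoInvCoeff, h]
  · have hl := linCoeff_ne_zero (fun h' => h (Or.inl h')) (fun h' => h (Or.inr h'))
    rw [pseudoInvCoeff, if_neg h, if_neg h]
    have hw := (wt_pos n).ne'
    rw [zero_mul, add_zero, div_mul_eq_mul_div, div_eq_iff hl]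
    unfold linCoeff
    split_ifs with h0
    · subst h0; simp [wt]; ring
    · field_simp
      ring

theorem triOp_single_zero {χ : ℕ → ℕ → ℕ → Bool} (hχ : ContainsTrivial χ) :
    triOp χ (lp.single 2 0 (1 : ℝ)) (lp.single 2 0 (1 : ℝ)) (lp.single 2 0 (1 : ℝ)) =
      lamOp (lp.single 2 0 (1 : ℝ)) := by
  ext n
  rw [triOp_zero_zero_left hχ, lamOp, diagOp_apply, unweight_apply, lp.single_apply]
  by_cases h : n = 0
  · subst h; simp [wt]
  · simp [h]

theorem projectedEq_zero_left {Θ : ℕ → ℕ → ℕ → ℕ → ℕ → Bool} (hΘ : ContainsTrivial (Θ 0 0))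
    (b : RealEll2) : projectedEq Θ (0, b) = b + pseudoInv (
      triOp (Θ 0 0) b b (lp.single 2 0 (1 : ℝ)) + triOp (Θ 0 0) b (lp.single 2 0 (1 : ℝ)) b +
      triOp (Θ 0 0) (lp.single 2 0 (1 : ℝ)) b b + triOp (Θ 0 0) b b b) := by
  have hl := pseudoInv_linear_part hΘ b
  have h := triOp_single_zero hΘ
  have h1 : projectedEq Θ (0, b) = pseudoInv (triOp (Θ 0 0) (lp.single 2 0 (1 : ℝ) + b)
      (lp.single 2 0 (1 : ℝ) + b) (lp.single 2 0 (1 : ℝ) + b) -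
      lamOp (lp.single 2 0 (1 : ℝ) + b)) + kernelProj b := by
    simp [projectedEq, eqResidual, cubicFamily_zero]
  rw [h1]
  simp only [map_add, map_sub, add_apply, h] at hl ⊢
  refine Eq.trans ?_ (congrArg (· + _) hl)
  abel

theorem ContDiff.hasStrictFDerivAt_fderiv {E F : Type*} [NormedAddCommGroup E] [NormedSpace ℝ E]
    [NormedAddCommGroup F] [NormedSpace ℝ F] {f : E → F} (hf : ContDiff ℝ ω f) (x : E) :
    HasStrictFDerivAt f (fderiv ℝ f x) x :=
  hf.contDiffAt.hasStrictFDerivAt (by simp)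

theorem fderiv_projectedEq_inr {Θ : ℕ → ℕ → ℕ → ℕ → ℕ → Bool} (hΘ : ContainsTrivial (Θ 0 0))
    (b : RealEll2) : fderiv ℝ (projectedEq Θ) 0 (0, b) = b := by
  have h1 : HasDerivAt (fun t : ℝ => projectedEq Θ ((0 : (ℝ × ℝ × ℝ × ℝ) × RealEll2) +
      t • ((0 : ℝ × ℝ × ℝ × ℝ), b))) (fderiv ℝ (projectedEq Θ) 0 (0, b)) 0 := by
    have h := ((contDiff_projectedEq Θ).hasStrictFDerivAt_fderiv 0).hasFDerivAt
    exact (h.hasLineDerivAt (0, b))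
  set B := pseudoInv (triOp (Θ 0 0) b b (lp.single 2 0 (1 : ℝ)) +
    triOp (Θ 0 0) b (lp.single 2 0 (1 : ℝ)) b + triOp (Θ 0 0) (lp.single 2 0 (1 : ℝ)) b b) with hB
  set C := pseudoInv (triOp (Θ 0 0) b b b) with hC
  have h2 : ∀ t : ℝ, projectedEq Θ ((0 : (ℝ × ℝ × ℝ × ℝ) × RealEll2) +
      t • ((0 : ℝ × ℝ × ℝ × ℝ), b)) = t • b + t ^ 2 • B + t ^ 3 • C := by
    intro t
    rw [zero_add, Prod.smul_mk, smul_zero, projectedEq_zero_left hΘ, hB, hC]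
    simp only [map_smul, map_add, smul_apply]
    module
  have h3 : HasDerivAt (fun t : ℝ => t • b + t ^ 2 • B + t ^ 3 • C) b 0 := by
    have := (((hasDerivAt_id' (0 : ℝ)).smul_const b).fun_add
      ((hasDerivAt_pow 2 (0 : ℝ)).smul_const B)).fun_add ((hasDerivAt_pow 3 (0 : ℝ)).smul_const C)
    simpa using this
  refine h1.unique (h3.congr_of_eventuallyEq (Eventually.of_forall h2))

theorem fderiv_projectedEq_comp_inr {Θ : ℕ → ℕ → ℕ → ℕ → ℕ → Bool}
    (hΘ : ContainsTrivial (Θ 0 0)) :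
    fderiv ℝ (projectedEq Θ) 0 ∘L .inr ℝ (ℝ × ℝ × ℝ × ℝ) RealEll2 = .id ℝ RealEll2 := by
  ext1 b
  exact fderiv_projectedEq_inr hΘ b

theorem eventually_norm_sub_le_projectedEq {Θ : ℕ → ℕ → ℕ → ℕ → ℕ → Bool}
    (hΘ : ContainsTrivial (Θ 0 0)) :
    ∃ r > (0 : ℝ), ∀ (p : ℝ × ℝ × ℝ × ℝ) (b b' : RealEll2), ‖p‖ < r → ‖b‖ < r → ‖b'‖ < r →
      ‖b - b'‖ ≤ 2 * ‖projectedEq Θ (p, b) - projectedEq Θ (p, b')‖ := by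
  have h := ((contDiff_projectedEq Θ).hasStrictFDerivAt_fderiv 0).isLittleO.def
    (c := 1 / 2) (by norm_num)
  obtain ⟨r, hr, hb⟩ := Metric.eventually_nhds_iff.1 h
  refine ⟨r, hr, fun p b b' hp h1 h2 => ?_⟩
  have := @hb ((p, b), (p, b')) (by
    simp [Prod.dist_eq, hp, h1, h2])
  dsimp only at this
  rw [Prod.mk_sub_mk, sub_self, fderiv_projectedEq_inr hΘ, Prod.norm_mk, norm_zero,
    max_eq_right (norm_nonneg _)] at this
  have h3 := norm_sub_norm_le (b - b') (projectedEq Θ (p, b) - projectedEq Θ (p, b'))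
  rw [norm_sub_rev (b - b')] at h3
  linarith

theorem exists_projectedEq_solution {Θ : ℕ → ℕ → ℕ → ℕ → ℕ → Bool}
    (hΘ : ContainsTrivial (Θ 0 0)) :
    ∃ φ : ℝ × ℝ × ℝ × ℝ → RealEll2, ContDiffAt ℝ ω φ 0 ∧ φ 0 = 0 ∧
      ∀ᶠ p in 𝓝 0, projectedEq Θ (p, φ p) = 0 := by
  have hc : ContDiffAt ℝ ω (projectedEq Θ) (0, 0) := (contDiff_projectedEq Θ).contDiffAt
  have hi : (fderiv ℝ (projectedEq Θ) (0, 0) ∘L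
      .inr ℝ (ℝ × ℝ × ℝ × ℝ) RealEll2).IsInvertible := by
    rw [Prod.mk_zero_zero, fderiv_projectedEq_comp_inr hΘ]
    exact ⟨ContinuousLinearEquiv.refl ℝ _, rfl⟩
  have h0 : projectedEq Θ (0, 0) = 0 := by simp [projectedEq_zero_left hΘ]
  refine ⟨hc.implicitFunction (by simp) hi, hc.contDiffAt_implicitFunction (by simp) hi,
    hc.implicitFunction_apply_self (by simp) hi, ?_⟩
  have := hc.eventually_apply_implicitFunction (by simp) hi
  rwa [h0] at this

/-- Two small solutions of the projected equations with the same modes `2` and `3` agree. -/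
theorem eq_of_fullResidual_eq_zero : ∃ r > (0 : ℝ), ∀ (Ω : ℝ) (y y' : RealEll2), |Ω| < r →
    ‖y - lp.single 2 0 (1 : ℝ)‖ < r → ‖y' - lp.single 2 0 (1 : ℝ)‖ < r →
    y 2 = y' 2 → y 3 = y' 3 →
    (∀ n, n ≠ 2 → n ≠ 3 → fullResidual Ω y n = 0) →
    (∀ n, n ≠ 2 → n ≠ 3 → fullResidual Ω y' n = 0) → y = y' := by
  obtain ⟨r, hr, h⟩ := eventually_norm_sub_le_projectedEq (Θ := fun _ _ => fullSet)
    (fun n => ⟨rfl, rfl⟩)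
  refine ⟨r, hr, fun Ω y y' hΩ hy hy' e2 e3 hn hn' => ?_⟩
  have key : ∀ y : RealEll2, (∀ n, n ≠ 2 → n ≠ 3 → fullResidual Ω y n = 0) →
      projectedEq (fun _ _ => fullSet) ((0, 0, 0, Ω), y - lp.single 2 0 (1 : ℝ)) =
        kernelProj (y - lp.single 2 0 (1 : ℝ)) := by
    intro y hy
    have : pseudoInv (fullResidual Ω y) = 0 := by
      ext n
      by_cases hn : n = 2 ∨ n = 3
      · simp [pseudoInv, pseudoInvCoeff, hn]
      · push Not at hn
        simp [pseudoInv, hy n hn.1 hn.2]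
    rw [fullResidual] at this
    simp [projectedEq, this]
  have h1 := h (0, 0, 0, Ω) _ _ (by simpa [Prod.norm_def] using hΩ) hy hy'
  rw [key y hn, key y' hn', ← map_sub, sub_sub_sub_cancel_right] at h1
  have h2 : kernelProj (y - y') = 0 := by
    ext n
    simp only [kernelProj, diagOp_apply, lp.coeFn_sub, Pi.sub_apply]
    split_ifs with h
    · rcases h with rfl | rfl <;> simp [e2, e3]
    · simp
  rw [h2, norm_zero, mul_zero] at h1
  exact sub_eq_zero.1 (norm_le_zero_iff.1 h1)

/-- The order in `A₂` of the mode `n`. -/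
def degTwo (n : ℕ) : ℕ := if n % 3 = 0 then 0 else 1

/-- The order in `A₃` of the mode `n`. -/
def degThree (n : ℕ) : ℕ := n % 2

/-- The resonances gaining the factor `A₂ ^ p * A₃ ^ (2 * q)`. -/
def gradedSet (p q n j k : ℕ) : Bool :=
  decide (degTwo j + degTwo k + degTwo (n + j - k) = degTwo n + p ∧
    degThree j + degThree k + degThree (n + j - k) = degThree n + 2 * q)

theorem degTwo_le_one (n : ℕ) : degTwo n ≤ 1 := by unfold degTwo; split_ifs <;> omega

theorem degThree_le_one (n : ℕ) : degThree n ≤ 1 := by unfold degThree; omega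

theorem exists_graded {n j k : ℕ} (h : k ≤ n + j) : ∃ p < 4, ∃ q < 2,
    degTwo j + degTwo k + degTwo (n + j - k) = degTwo n + p ∧
    degThree j + degThree k + degThree (n + j - k) = degThree n + 2 * q := by
  refine ⟨degTwo j + degTwo k + degTwo (n + j - k) - degTwo n, ?_,
    (degThree j + degThree k + degThree (n + j - k) - degThree n) / 2, ?_, ?_, ?_⟩
  · have := degTwo_le_one j; have := degTwo_le_one k; have := degTwo_le_one (n + j - k)
    omega
  · have := degThree_le_one j; have := degThree_le_one k; have := degThree_le_one (n + j - k)
    omega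
  · unfold degTwo; split_ifs <;> omega
  · unfold degThree; omega

theorem containsTrivial_gradedSet : ContainsTrivial (gradedSet 0 0) := by
  intro n
  simp [gradedSet, degTwo, degThree]

/-- The scaling `A_n ↦ ε ^ degTwo n * μ ^ degThree n * A_n`. -/
def scaleOp (ε μ : ℝ) : RealEll2 →L[ℝ] RealEll2 :=
  ∑ a ∈ Finset.range 2, ∑ b ∈ Finset.range 2, (ε ^ a * μ ^ b) •
    diagOp (fun n => if degTwo n = a ∧ degThree n = b then 1 else 0) 1
      (fun n => by split_ifs <;> simp)

@[simp] theorem scaleOp_apply (ε μ : ℝ) (x : RealEll2) (n : ℕ) :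
    scaleOp ε μ x n = ε ^ degTwo n * μ ^ degThree n * x n := by
  simp only [scaleOp, Finset.sum_range_succ, Finset.sum_range_zero, zero_add, add_apply,
    smul_apply, lp.coeFn_add, Pi.add_apply, lp.coeFn_smul, Pi.smul_apply, diagOp_apply, smul_eq_mul]
  have h2 := degTwo_le_one n
  have h3 := degThree_le_one n
  interval_cases degTwo n <;> interval_cases degThree n <;> simp

theorem contDiff_scaleOp : ContDiff ℝ ω fun v : ℝ × ℝ => scaleOp v.1 v.2 := by
  unfold scaleOp
  fun_prop

theorem triOp_gradedSet_scaleOp (p q : ℕ) (ε μ : ℝ) (x y z : RealEll2) :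
    triOp (gradedSet p q) (scaleOp ε μ x) (scaleOp ε μ y) (scaleOp ε μ z) =
      (ε ^ p * μ ^ (2 * q)) • scaleOp ε μ (triOp (gradedSet p q) x y z) := by
  ext n
  rw [lp.coeFn_smul, Pi.smul_apply, scaleOp_apply]
  simp only [triOp_apply, triFun_apply, smul_eq_mul, ← tsum_mul_left]
  refine tsum_congr fun ⟨j, k⟩ => ?_
  unfold triTerm
  dsimp only
  split_ifs with h
  · obtain ⟨h2, h3⟩ := of_decide_eq_true h.2
    simp only [unweight_apply, scaleOp_apply]
    have e2 : ε ^ p * ε ^ degTwo n = ε ^ degTwo j * ε ^ degTwo k * ε ^ degTwo (n + j - k) := by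
      rw [← pow_add, ← pow_add, ← pow_add, h2, add_comm]
    have e3 : μ ^ (2 * q) * μ ^ degThree n =
        μ ^ degThree j * μ ^ degThree k * μ ^ degThree (n + j - k) := by
      rw [← pow_add, ← pow_add, ← pow_add, h3, add_comm]
    linear_combination (-(interactionCoeff n j k (n + j - k) : ℝ) * ((wt j)⁻¹ * x j) *
      ((wt k)⁻¹ * y k) * ((wt (n + j - k))⁻¹ * z (n + j - k))) *
      (e2 * (μ ^ (2 * q) * μ ^ degThree n) +
        e3 * (ε ^ degTwo j * ε ^ degTwo k * ε ^ degTwo (n + j - k)))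
  · simp

theorem triOp_fullSet_eq (x y z : RealEll2) : triOp fullSet x y z =
    ∑ p ∈ Finset.range 4, ∑ q ∈ Finset.range 2, triOp (gradedSet p q) x y z := by
  ext n
  simp only [lp.coeFn_sum, Finset.sum_apply]
  simp only [triOp_apply, triFun_apply]
  simp only [← Summable.tsum_finsetSum fun q (_ : q ∈ Finset.range 2) =>
    summable_triTerm (gradedSet _ q) x y z n]
  rw [← Summable.tsum_finsetSum fun p (_ : p ∈ Finset.range 4) =>
    summable_sum fun q (_ : q ∈ Finset.range 2) => summable_triTerm (gradedSet p q) x y z n]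
  refine tsum_congr fun ⟨j, k⟩ => ?_
  by_cases hk : k ≤ n + j
  · obtain ⟨p, hp, q, hq, h2, h3⟩ := exists_graded hk
    have hχ : ∀ p' q', gradedSet p' q' n j k = true ↔ p' = p ∧ q' = q := by
      intro p' q'
      unfold gradedSet
      rw [decide_eq_true_iff]
      omega
    unfold triTerm
    simp only [hχ, hk, true_and, fullSet]
    rw [Finset.sum_eq_single p, Finset.sum_eq_single q]
    · simp
    · intro q' _ h; simp [h]
    · intro h; exact absurd (Finset.mem_range.2 hq) h
    · intro p' _ h; simp [h]
    · intro h; exact absurd (Finset.mem_range.2 hp) h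
  · simp [triTerm, hk]

theorem scaleOp_comm_lamOp (ε μ : ℝ) (y : RealEll2) :
    lamOp (scaleOp ε μ y) = scaleOp ε μ (lamOp y) := by
  ext n; simp [lamOp]; ring

theorem scaleOp_comm_modeOp (ε μ : ℝ) (y : RealEll2) :
    modeOp (scaleOp ε μ y) = scaleOp ε μ (modeOp y) := by
  ext n; simp [modeOp]; ring

/-- The residual of the rescaled equation. -/
def scaledResidual (q : ℝ × ℝ × ℝ) (y : RealEll2) : RealEll2 := eqResidual gradedSet q y

theorem fullResidual_scaleOp (ε μ Ω : ℝ) (y : RealEll2) :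
    fullResidual Ω (scaleOp ε μ y) = scaleOp ε μ (scaledResidual (ε, μ ^ 2, Ω) y) := by
  rw [fullResidual_eq, triOp_fullSet_eq, scaledResidual, eqResidual, cubicFamily,
    scaleOp_comm_lamOp, scaleOp_comm_modeOp]
  simp only [triOp_gradedSet_scaleOp, map_add, map_sub, map_sum, map_smul, pow_mul]

theorem eqResidual_scaleOp_self (κ e s Ω : ℝ) (y : RealEll2) :
    eqResidual gradedSet (e, s, Ω) (scaleOp κ κ y) =
      scaleOp κ κ (scaledResidual (κ * e, κ ^ 2 * s, Ω) y) := by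
  rw [scaledResidual, eqResidual, eqResidual, cubicFamily, cubicFamily,
    scaleOp_comm_lamOp, scaleOp_comm_modeOp]
  simp only [triOp_gradedSet_scaleOp, map_add, map_sub, map_sum, map_smul, smul_smul]
  congr 2
  refine Finset.sum_congr rfl fun p _ => Finset.sum_congr rfl fun q _ => ?_
  congr 1
  ring

/-- The weighted sequence with integer entries `a n`, `n < 16`, in the unweighted coordinates. -/
def intVec (a : ℕ → ℤ) : RealEll2 :=
  ∑ m ∈ Finset.range 16, lp.single 2 m (wt m * a m)

/-- Restriction of an integer sequence to the first sixteen entries. -/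
def trunc (a : ℕ → ℤ) (n : ℕ) : ℤ := if n < 16 then a n else 0

theorem intVec_apply (a : ℕ → ℤ) (n : ℕ) : intVec a n = wt n * (trunc a n : ℤ) := by
  simp only [intVec, lp.coeFn_sum, Finset.sum_apply, lp.single_apply, trunc]
  rw [Finset.sum_pi_single]
  simp only [Finset.mem_range]
  split_ifs <;> simp

theorem unweight_intVec (a : ℕ → ℤ) (n : ℕ) : unweight (intVec a) n = (trunc a n : ℤ) := by
  rw [unweight_apply, intVec_apply, inv_mul_cancel_left₀ (wt_pos n).ne']

/-- The integer trilinear sum. -/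
def triInt (χ : ℕ → ℕ → ℕ → Bool) (a b c : ℕ → ℤ) (n : ℕ) : ℤ :=
  ∑ j ∈ Finset.range 16, if a j = 0 then 0 else ∑ k ∈ Finset.range 16, if b k = 0 then 0 else
    if trunc c (n + j - k) = 0 then 0 else if k ≤ n + j ∧ χ n j k = true then
      (interactionCoeff n j k (n + j - k) : ℤ) * a j * b k * trunc c (n + j - k) else 0

theorem triInt_eq_sum (χ : ℕ → ℕ → ℕ → Bool) (a b c : ℕ → ℤ) (n : ℕ) : triInt χ a b c n =
    ∑ j ∈ Finset.range 16, ∑ k ∈ Finset.range 16, if k ≤ n + j ∧ χ n j k = true then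
      (interactionCoeff n j k (n + j - k) : ℤ) * a j * b k * trunc c (n + j - k) else 0 := by
  refine Finset.sum_congr rfl fun j _ => ?_
  split_ifs with hj
  · simp [hj]
  · refine Finset.sum_congr rfl fun k _ => ?_
    split_ifs with hk <;> simp_all

theorem triOp_intVec (χ : ℕ → ℕ → ℕ → Bool) (a b c : ℕ → ℤ) (n : ℕ) :
    triOp χ (intVec a) (intVec b) (intVec c) n = (triInt χ a b c n : ℤ) := by
  rw [triOp_apply, triFun_apply, tsum_eq_sum (s := Finset.range 16 ×ˢ Finset.range 16),
    Finset.sum_product, triInt_eq_sum]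
  · push_cast
    refine Finset.sum_congr rfl fun j hj => Finset.sum_congr rfl fun k hk => ?_
    unfold triTerm
    simp only [unweight_intVec, trunc, Finset.mem_range.1 hj, Finset.mem_range.1 hk, if_true]
  · rintro ⟨j, k⟩ h
    unfold triTerm
    simp only [Finset.mem_product, Finset.mem_range, not_and_or] at h
    simp only [unweight_intVec, trunc]
    rcases h with h | h <;> simp [h]

theorem triInt_eq_zero (χ : ℕ → ℕ → ℕ → Bool) (a b c : ℕ → ℤ) {n : ℕ} (hn : 31 ≤ n) :
    triInt χ a b c n = 0 := by
  rw [triInt_eq_sum]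
  refine Finset.sum_eq_zero fun j hj => Finset.sum_eq_zero fun k hk => ?_
  have h := Finset.mem_range.1 hk
  have h' : ¬ n + j - k < 16 := by omega
  simp [trunc, h']

/-- Constant coefficients of the expansion in `A₂`. -/
def baseSeq (n : ℕ) : ℤ :=
  match n with
  | 0 => 1 | 1 => -6 | 2 => 1 | 3 => 1 | 5 => -2 | _ => 0

/-- Linear coefficients of the expansion in `A₂`. -/
def firstSeq (n : ℕ) : ℤ :=
  match n with
  | 1 => 48 | 4 => -3 | 7 => 3 | _ => 0

/-- The first order approximation of the rescaled solution. -/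
def approxSol (ε : ℝ) : RealEll2 := intVec baseSeq + ε • intVec firstSeq

/-- The complementary projection to the modes `2` and `3`. -/
def rangeProj : RealEll2 →L[ℝ] RealEll2 := .id ℝ RealEll2 - kernelProj

theorem rangeProj_apply (x : RealEll2) (n : ℕ) :
    rangeProj x n = if n = 2 ∨ n = 3 then 0 else x n := by
  simp only [rangeProj, sub_apply, ContinuousLinearMap.id_apply, lp.coeFn_sub, Pi.sub_apply,
    kernelProj, diagOp_apply]
  split_ifs <;> simp

theorem lamOp_intVec (a : ℕ → ℤ) (n : ℕ) :
    lamOp (intVec a) n = (((n : ℤ) + 1) * (6 - n) * trunc a n : ℤ) / 6 := by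
  rw [lamOp, diagOp_apply, intVec_apply]
  have := (wt_pos n).ne'
  push_cast
  field_simp

theorem baseSeq_equation : ∀ n < 31, n ≠ 2 → n ≠ 3 →
    6 * triInt (gradedSet 0 0) baseSeq baseSeq baseSeq n =
      ((n : ℤ) + 1) * (6 - n) * trunc baseSeq n := by
  decide +kernel

theorem firstSeq_equation : ∀ n < 31, n ≠ 2 → n ≠ 3 →
    6 * (triInt (gradedSet 0 0) firstSeq baseSeq baseSeq n +
      triInt (gradedSet 0 0) baseSeq firstSeq baseSeq n +
      triInt (gradedSet 0 0) baseSeq baseSeq firstSeq n +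
      triInt (gradedSet 1 0) baseSeq baseSeq baseSeq n) =
      ((n : ℤ) + 1) * (6 - n) * trunc firstSeq n := by
  decide +kernel

theorem rangeProj_baseSeq : rangeProj (triOp (gradedSet 0 0) (intVec baseSeq) (intVec baseSeq)
    (intVec baseSeq) - lamOp (intVec baseSeq)) = 0 := by
  ext n
  rw [rangeProj_apply]
  split_ifs with h
  · rfl
  · push Not at h
    rw [lp.coeFn_sub, Pi.sub_apply, triOp_intVec, lamOp_intVec, lp.coeFn_zero, Pi.zero_apply]
    rcases lt_or_ge n 31 with hn | hn
    · rw [← baseSeq_equation n hn h.1 h.2]; push_cast; ring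
    · rw [triInt_eq_zero _ _ _ _ hn, trunc, if_neg (by omega)]; simp

theorem rangeProj_firstSeq : rangeProj (triOp (gradedSet 0 0) (intVec firstSeq) (intVec baseSeq)
    (intVec baseSeq) + triOp (gradedSet 0 0) (intVec baseSeq) (intVec firstSeq) (intVec baseSeq) +
    triOp (gradedSet 0 0) (intVec baseSeq) (intVec baseSeq) (intVec firstSeq) +
    triOp (gradedSet 1 0) (intVec baseSeq) (intVec baseSeq) (intVec baseSeq) -
    lamOp (intVec firstSeq)) = 0 := by
  ext n
  rw [rangeProj_apply]
  split_ifs with h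
  · rfl
  · push Not at h
    simp only [lp.coeFn_sub, lp.coeFn_add, Pi.add_apply, Pi.sub_apply, triOp_intVec, lamOp_intVec,
      lp.coeFn_zero, Pi.zero_apply]
    rcases lt_or_ge n 31 with hn | hn
    · rw [← firstSeq_equation n hn h.1 h.2]; push_cast; ring
    · simp only [triInt_eq_zero _ _ _ _ hn]; rw [trunc, if_neg (by omega)]; simp

theorem trilinear_add_smul (T : RealEll2 →L[ℝ] RealEll2 →L[ℝ] RealEll2 →L[ℝ] RealEll2)
    (t : ℝ) (b f : RealEll2) : T (b + t • f) (b + t • f) (b + t • f) =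
      T b b b + t • (T f b b + T b f b + T b b f) +
        t ^ 2 • (T f f b + T f b f + T b f f + t • T f f f) := by
  simp only [map_add, map_smul, add_apply, smul_apply]
  module

/-- The quadratic remainder size. -/
def remSize (q : ℝ × ℝ × ℝ) : ℝ := q.1 ^ 2 + |q.2.1| + |q.2.2|

theorem remSize_nonneg (q : ℝ × ℝ × ℝ) : 0 ≤ remSize q := by unfold remSize; positivity

theorem ContinuousAt.isBigO_smul {E F : Type*} [TopologicalSpace F] [NormedAddCommGroup E]
    [NormedSpace ℝ E] {G : F → E} {x : F} (hG : ContinuousAt G x) (c d : F → ℝ)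
    (hc : c =O[𝓝 x] d) : (fun q => c q • G q) =O[𝓝 x] d := by
  simpa using hc.smul (hG.isBigO_one ℝ)

theorem sq_isBigO_remSize : (fun q : ℝ × ℝ × ℝ => q.1 ^ 2) =O[𝓝 0] remSize :=
  IsBigO.of_bound' (Eventually.of_forall fun q => by
    rw [Real.norm_of_nonneg (sq_nonneg _), Real.norm_of_nonneg (remSize_nonneg q), remSize]
    linarith [abs_nonneg q.2.1, abs_nonneg q.2.2])

theorem snd_isBigO_remSize : (fun q : ℝ × ℝ × ℝ => q.2.1) =O[𝓝 0] remSize :=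
  IsBigO.of_bound' (Eventually.of_forall fun q => by
    rw [Real.norm_eq_abs, Real.norm_of_nonneg (remSize_nonneg q), remSize]
    linarith [sq_nonneg q.1, abs_nonneg q.2.2])

theorem thd_isBigO_remSize : (fun q : ℝ × ℝ × ℝ => q.2.2) =O[𝓝 0] remSize :=
  IsBigO.of_bound' (Eventually.of_forall fun q => by
    rw [Real.norm_eq_abs, Real.norm_of_nonneg (remSize_nonneg q), remSize]
    linarith [sq_nonneg q.1, abs_nonneg q.2.1])

theorem continuous_approxSol : Continuous approxSol := by unfold approxSol; fun_prop

theorem rangeProj_scaledResidual_approxSol_isBigO :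
    (fun q : ℝ × ℝ × ℝ => rangeProj (scaledResidual q (approxSol q.1))) =O[𝓝 0] remSize := by
  set b := intVec baseSeq with hb
  set f := intVec firstSeq with hf
  set T := triOp (gradedSet 0 0)
  set U := triOp (gradedSet 1 0)
  let G₁ : ℝ → RealEll2 := fun ε => T f f b + T f b f + T b f f + ε • T f f f +
    (U f b b + U b f b + U b b f + ε • (U f f b + U f b f + U b f f + ε • U f f f)) +
    triOp (gradedSet 2 0) (b + ε • f) (b + ε • f) (b + ε • f) +
    ε • triOp (gradedSet 3 0) (b + ε • f) (b + ε • f) (b + ε • f)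
  let G₂ : ℝ → RealEll2 := fun ε => triOp (gradedSet 0 1) (b + ε • f) (b + ε • f) (b + ε • f) +
    ε • triOp (gradedSet 1 1) (b + ε • f) (b + ε • f) (b + ε • f) +
    ε ^ 2 • triOp (gradedSet 2 1) (b + ε • f) (b + ε • f) (b + ε • f) +
    ε ^ 3 • triOp (gradedSet 3 1) (b + ε • f) (b + ε • f) (b + ε • f)
  have h : ∀ q : ℝ × ℝ × ℝ, rangeProj (scaledResidual q (approxSol q.1)) =
      q.1 ^ 2 • rangeProj (G₁ q.1) + q.2.1 • rangeProj (G₂ q.1) +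
        q.2.2 • rangeProj (modeOp (approxSol q.1)) := by
    rintro ⟨ε, s, Ω⟩
    have h0 := rangeProj_baseSeq
    have h1 := rangeProj_firstSeq
    have e : scaledResidual (ε, s, Ω) (approxSol ε) = (T b b b - lamOp b) +
        ε • (T f b b + T b f b + T b b f + U b b b - lamOp f) + (ε ^ 2 • G₁ ε + s • G₂ ε +
        Ω • modeOp (approxSol ε)) := by
      simp only [scaledResidual, eqResidual, cubicFamily, Finset.sum_range_succ,
        Finset.sum_range_zero, approxSol, ← hb, ← hf, G₁, G₂]
      rw [trilinear_add_smul T, trilinear_add_smul U, map_add lamOp, map_smul lamOp]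
      module
    rw [e, map_add, map_add, map_smul, h0, h1, smul_zero, zero_add, zero_add]
    simp only [map_add, map_smul]
  simp only [h]
  have hA := continuous_approxSol
  refine ((ContinuousAt.isBigO_smul ?_ _ _ sq_isBigO_remSize).add
    (ContinuousAt.isBigO_smul ?_ _ _ snd_isBigO_remSize)).add
    (ContinuousAt.isBigO_smul ?_ _ _ thd_isBigO_remSize)
  · fun_prop
  · fun_prop
  · fun_prop

theorem scaleOp_zero_approxSol : scaleOp 0 0 (approxSol 0) = lp.single 2 0 (1 : ℝ) := by
  ext n
  rw [scaleOp_apply, approxSol, zero_smul, add_zero, intVec_apply, lp.single_apply]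
  rcases lt_or_ge n 16 with hn | hn
  · interval_cases n <;> simp [degTwo, degThree, trunc, baseSeq, wt]
  · rw [trunc, if_neg (by omega), Pi.single_eq_of_ne (by omega)]; simp

theorem scaleOp_inv_scaleOp {κ : ℝ} (hκ : κ ≠ 0) (x : RealEll2) :
    scaleOp κ⁻¹ κ⁻¹ (scaleOp κ κ x) = x := by
  ext n; simp only [scaleOp_apply, inv_pow]; field_simp

theorem scaleOp_scaleOp_inv {κ : ℝ} (hκ : κ ≠ 0) (x : RealEll2) :
    scaleOp κ κ (scaleOp κ⁻¹ κ⁻¹ x) = x := by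
  ext n; simp only [scaleOp_apply, inv_pow]; field_simp

theorem projectedEq_eq_zero_iff {Θ : ℕ → ℕ → ℕ → ℕ → ℕ → Bool} {κ : ℝ} {q : ℝ × ℝ × ℝ}
    {b : RealEll2} (h : projectedEq Θ ((κ, q), b) = 0) :
    b 2 = 0 ∧ b 3 = 0 ∧ ∀ n, n ≠ 2 → n ≠ 3 → eqResidual Θ q (lp.single 2 0 (1 : ℝ) +
      κ • (lp.single 2 2 (9 : ℝ) + lp.single 2 3 (16 : ℝ)) + b) n = 0 := by
  have hn : ∀ n, projectedEq Θ ((κ, q), b) n = 0 := fun n => by rw [h]; rfl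
  simp only [projectedEq, lp.coeFn_add, Pi.add_apply, pseudoInv, kernelProj, diagOp_apply] at hn
  refine ⟨?_, ?_, fun n h2 h3 => ?_⟩
  · simpa [pseudoInvCoeff] using hn 2
  · simpa [pseudoInvCoeff] using hn 3
  · have := hn n
    simp only [h2, h3, or_self, if_false, zero_mul, add_zero, pseudoInvCoeff, mul_eq_zero,
      div_eq_zero_iff, (wt_pos n).ne', linCoeff_ne_zero h2 h3, false_or] at this
    exact this

theorem ell2_add_apply (x y : RealEll2) (n : ℕ) : (x + y) n = x n + y n := rfl

theorem ell2_sub_apply (x y : RealEll2) (n : ℕ) : (x - y) n = x n - y n := rfl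

theorem ell2_smul_apply (r : ℝ) (x : RealEll2) (n : ℕ) : (r • x) n = r * x n := rfl

theorem Continuous.sub_add_fst_smul {E : Type*} [NormedAddCommGroup E] [NormedSpace ℝ E]
    {f : ℝ × ℝ → E} (hf : Continuous f) (u w : E) :
    Continuous fun v : ℝ × ℝ => f v - (u + v.1 • w) := by fun_prop

/-- The approximate solution in the variables centred at `δ₀ + κ (δ₂ + δ₃)`. -/
def approxShift (κ ε : ℝ) : RealEll2 := scaleOp κ κ (approxSol ε) - (lp.single 2 0 (1 : ℝ) +
  κ • (lp.single 2 2 (9 : ℝ) + lp.single 2 3 (16 : ℝ)))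

theorem continuous_scaleOp_approxSol :
    Continuous fun v : ℝ × ℝ => scaleOp v.1 v.1 (approxSol v.2) := by
  have h1 := contDiff_scaleOp.continuous
  have h2 := continuous_approxSol
  have h3 : Continuous fun v : (RealEll2 →L[ℝ] RealEll2) × RealEll2 => v.1 v.2 :=
    isBoundedBilinearMap_apply.continuous
  exact h3.comp ((h1.comp (continuous_fst.prodMk continuous_fst)).prodMk (h2.comp continuous_snd))

theorem continuous_approxShift : Continuous fun v : ℝ × ℝ => approxShift v.1 v.2 :=
  continuous_scaleOp_approxSol.sub_add_fst_smul _ _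

theorem kernelProj_approxShift (κ ε : ℝ) : kernelProj (approxShift κ ε) = 0 := by
  ext n
  simp only [kernelProj, diagOp_apply]
  split_ifs with h
  · rcases h with rfl | rfl <;>
    simp only [approxShift, approxSol, ell2_sub_apply, ell2_add_apply, ell2_smul_apply,
      scaleOp_apply, intVec_apply, lp.single_apply] <;>
    norm_num [trunc, baseSeq, firstSeq, degTwo, degThree, wt, Pi.single_apply]
  · simp

theorem pseudoInv_rangeProj (x : RealEll2) : pseudoInv (rangeProj x) = pseudoInv x := by
  ext n
  simp only [pseudoInv, diagOp_apply, rangeProj_apply, pseudoInvCoeff]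
  split_ifs <;> simp

theorem rangeProj_comm_scaleOp (ε μ : ℝ) (x : RealEll2) :
    rangeProj (scaleOp ε μ x) = scaleOp ε μ (rangeProj x) := by
  ext n
  simp only [scaleOp_apply, rangeProj_apply]
  split_ifs <;> simp

theorem exists_scaled_solution : ∃ c : ℝ × ℝ × ℝ → RealEll2, ContDiffAt ℝ ω c 0 ∧
    (∀ᶠ q in 𝓝 0, c q 2 = 9 ∧ c q 3 = 16 ∧
      ∀ n, n ≠ 2 → n ≠ 3 → scaledResidual q (c q) n = 0) ∧
    (fun q => c q - approxSol q.1) =O[𝓝 0] remSize := by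
  obtain ⟨φ, hφ, hφ0, hsol⟩ := exists_projectedEq_solution containsTrivial_gradedSet
  obtain ⟨r, hr, hlip⟩ := eventually_norm_sub_le_projectedEq containsTrivial_gradedSet
  have hι : Continuous fun κ : ℝ => (κ, (0 : ℝ × ℝ × ℝ)) := by fun_prop
  have hι0 : Tendsto (fun κ : ℝ => (κ, (0 : ℝ × ℝ × ℝ))) (𝓝 0) (𝓝 0) := hι.tendsto' _ _ rfl
  have hev : ∀ᶠ κ : ℝ in 𝓝[>] 0, 0 < κ ∧ ContDiffAt ℝ ω φ (κ, 0) ∧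
      (∀ᶠ p in 𝓝 (κ, (0 : ℝ × ℝ × ℝ)), projectedEq gradedSet (p, φ p) = 0) ∧
      ‖(κ, (0 : ℝ × ℝ × ℝ))‖ < r ∧ ‖φ (κ, 0)‖ < r ∧ ‖approxShift κ 0‖ < r := by
    refine eventually_mem_nhdsWithin.and (nhdsWithin_le_nhds ?_)
    refine (hι0.eventually (hφ.eventually (by simp))).and
      ((hι0.eventually hsol.eventually_nhds).and (((hι.norm.tendsto' 0 0 (by simp)).eventually_lt_const
        hr).and (Eventually.and ?_ ?_)))
    · have : Tendsto (fun κ : ℝ => ‖φ (κ, 0)‖) (𝓝 0) (𝓝 0) := by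
        simpa [hφ0] using (hφ.continuousAt.tendsto.comp hι0).norm
      exact this.eventually_lt_const hr
    · have : Continuous fun κ : ℝ => ‖approxShift κ 0‖ :=
        (continuous_approxShift.comp (by fun_prop : Continuous fun κ : ℝ => (κ, (0 : ℝ)))).norm
      refine (this.tendsto' 0 0 ?_).eventually_lt_const hr
      simp [approxShift, scaleOp_zero_approxSol]
  obtain ⟨κ, hκ, hφκ, hsolκ, hn1, hn2, hn3⟩ := hev.exists
  have hκ' : κ ≠ 0 := hκ.ne'
  let L : ℝ × ℝ × ℝ → ℝ × ℝ × ℝ × ℝ := fun q => (κ, κ⁻¹ * q.1, κ⁻¹ ^ 2 * q.2.1, q.2.2)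
  have hL : ContDiff ℝ ω L := by fun_prop
  have hL0 : L 0 = (κ, 0) := by simp [L]
  have hLt : Tendsto L (𝓝 0) (𝓝 (κ, 0)) := hL.continuous.tendsto' _ _ hL0
  let base : RealEll2 := lp.single 2 0 (1 : ℝ) +
    κ • (lp.single 2 2 (9 : ℝ) + lp.single 2 3 (16 : ℝ))
  let c : ℝ × ℝ × ℝ → RealEll2 := fun q => scaleOp κ⁻¹ κ⁻¹ (base + φ (L q))
  refine ⟨c, ?_, ?_, ?_⟩
  · have h1 : ContDiffAt ℝ ω (fun q => φ (L q)) 0 :=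
      ContDiffAt.comp 0 (by rw [hL0]; exact hφκ) hL.contDiffAt
    exact (scaleOp κ⁻¹ κ⁻¹).contDiff.contDiffAt.comp 0 (contDiffAt_const.add h1)
  · filter_upwards [hLt.eventually hsolκ] with ⟨ε, s, Ω⟩ hq
    obtain ⟨h2, h3, hn⟩ := projectedEq_eq_zero_iff hq
    refine ⟨?_, ?_, fun n hn2 hn3 => ?_⟩
    · simp only [c, base, ell2_add_apply, ell2_smul_apply, scaleOp_apply, lp.single_apply, h2]
      simp [degTwo, degThree, hκ']
    · simp only [c, base, ell2_add_apply, ell2_smul_apply, scaleOp_apply, lp.single_apply, h3]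
      simp [degTwo, degThree, hκ']
    · have h := hn n hn2 hn3
      have e : eqResidual gradedSet (κ⁻¹ * ε, κ⁻¹ ^ 2 * s, Ω) (base + φ (L (ε, s, Ω))) =
          scaleOp κ κ (scaledResidual (ε, s, Ω) (c (ε, s, Ω))) := by
        have := eqResidual_scaleOp_self κ (κ⁻¹ * ε) (κ⁻¹ ^ 2 * s) Ω (c (ε, s, Ω))
        rw [scaleOp_scaleOp_inv hκ'] at this
        rw [this]
        congr 3
        · field_simp
        · field_simp
      change eqResidual gradedSet (κ⁻¹ * ε, κ⁻¹ ^ 2 * s, Ω) (base + φ (L (ε, s, Ω))) n = 0 at h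
      rw [e, scaleOp_apply] at h
      simpa [hκ'] using h
  · have hbound : ∀ᶠ q in 𝓝 (0 : ℝ × ℝ × ℝ), ‖c q - approxSol q.1‖ ≤
        (‖scaleOp κ⁻¹ κ⁻¹‖ * (2 * (75 * ‖scaleOp κ κ‖))) *
          ‖rangeProj (scaledResidual q (approxSol q.1))‖ := by
      have e1 : ∀ᶠ q in 𝓝 (0 : ℝ × ℝ × ℝ), ‖L q‖ < r :=
        (hLt.norm).eventually_lt_const hn1
      have e2 : ∀ᶠ q in 𝓝 (0 : ℝ × ℝ × ℝ), ‖φ (L q)‖ < r :=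
        ((hφκ.continuousAt.tendsto.comp hLt).norm).eventually_lt_const hn2
      have e3 : ∀ᶠ q in 𝓝 (0 : ℝ × ℝ × ℝ), ‖approxShift κ q.1‖ < r := by
        have : Continuous fun q : ℝ × ℝ × ℝ => ‖approxShift κ q.1‖ :=
          (continuous_approxShift.comp (by fun_prop : Continuous fun q : ℝ × ℝ × ℝ => (κ, q.1))).norm
        exact (this.tendsto 0).eventually_lt_const hn3
      filter_upwards [hLt.eventually hsolκ, e1, e2, e3] with ⟨ε, s, Ω⟩ hq h1 h2 h3
      have hd : c (ε, s, Ω) - approxSol ε =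
          scaleOp κ⁻¹ κ⁻¹ (φ (L (ε, s, Ω)) - approxShift κ ε) := by
        rw [approxShift, map_sub, map_sub, scaleOp_inv_scaleOp hκ']
        simp only [c, base, map_add]
        abel
      have h4 := hlip _ _ _ h1 h2 h3
      have h5 : projectedEq gradedSet (L (ε, s, Ω), approxShift κ ε) =
          pseudoInv (scaleOp κ κ (rangeProj (scaledResidual (ε, s, Ω) (approxSol ε)))) := by
        rw [← rangeProj_comm_scaleOp, pseudoInv_rangeProj]
        simp only [projectedEq, kernelProj_approxShift, add_zero, L]
        rw [approxShift, add_sub_cancel, eqResidual_scaleOp_self]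
        congr 4
        · field_simp
        · field_simp
      rw [hq, zero_sub, norm_neg, h5] at h4
      have h6 := norm_diagOp_le _ _ abs_pseudoInvCoeff_le
        (scaleOp κ κ (rangeProj (scaledResidual (ε, s, Ω) (approxSol ε))))
      have h7 := (scaleOp κ κ).le_opNorm (rangeProj (scaledResidual (ε, s, Ω) (approxSol ε)))
      rw [hd]
      calc _ ≤ ‖scaleOp κ⁻¹ κ⁻¹‖ * ‖φ (L (ε, s, Ω)) - approxShift κ ε‖ :=
            (scaleOp κ⁻¹ κ⁻¹).le_opNorm _
        _ ≤ ‖scaleOp κ⁻¹ κ⁻¹‖ * (2 * (75 * (‖scaleOp κ κ‖ *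
            ‖rangeProj (scaledResidual (ε, s, Ω) (approxSol ε))‖))) := by
            gcongr
            refine h4.trans ?_
            gcongr
            exact h6.trans (by gcongr)
        _ = _ := by ring
    exact (IsBigO.of_bound _ hbound).trans rangeProj_scaledResidual_approxSol_isBigO

section Trilinear

variable {E : Type*} [NormedAddCommGroup E] [NormedSpace ℝ E]

/-- The first variation of a cubic form. -/
def cubicVar (T : E →L[ℝ] E →L[ℝ] E →L[ℝ] E) (b h : E) : E := T h b b + T b h b + T b b h

/-- The quadratic part of a cubic form. -/
def cubicQuad (T : E →L[ℝ] E →L[ℝ] E →L[ℝ] E) (b h : E) : E := T h h b + T h b h + T b h h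

/-- The full polarization of a cubic form. -/
def cubicPolar (T : E →L[ℝ] E →L[ℝ] E →L[ℝ] E) (b h k : E) : E :=
  T h k b + T h b k + T k h b + T k b h + T b h k + T b k h

theorem cubic_add (T : E →L[ℝ] E →L[ℝ] E →L[ℝ] E) (b h : E) : T (b + h) (b + h) (b + h) =
    T b b b + cubicVar T b h + cubicQuad T b h + T h h h := by
  simp only [cubicVar, cubicQuad, map_add, add_apply]; abel

theorem cubicVar_add_smul (T : E →L[ℝ] E →L[ℝ] E →L[ℝ] E) (b f r : E) (t : ℝ) :
    cubicVar T b (t • f + r) = t • cubicVar T b f + cubicVar T b r := by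
  simp only [cubicVar, map_add, map_smul, add_apply, smul_apply]; module

theorem cubicQuad_add_smul (T : E →L[ℝ] E →L[ℝ] E →L[ℝ] E) (b f r : E) (t : ℝ) :
    cubicQuad T b (t • f + r) =
      t ^ 2 • cubicQuad T b f + t • cubicPolar T b f r + cubicQuad T b r := by
  simp only [cubicQuad, cubicPolar, map_add, map_smul, add_apply, smul_apply]; module

theorem cubic_smul_add (T : E →L[ℝ] E →L[ℝ] E →L[ℝ] E) (f r : E) (t : ℝ) :
    T (t • f + r) (t • f + r) (t • f + r) = t ^ 3 • T f f f + t ^ 2 • cubicVar T f r +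
      t • cubicQuad T f r + T r r r := by
  simp only [cubicQuad, cubicVar, map_add, map_smul, add_apply, smul_apply]; module

variable {α : Type*} {l : Filter α}

set_option maxSynthPendingDepth 3 in
theorem Asymptotics.IsBigO.trilinear (T : E →L[ℝ] E →L[ℝ] E →L[ℝ] E) {x y z : α → E} {u v w : α → ℝ}
    (hx : x =O[l] u) (hy : y =O[l] v) (hz : z =O[l] w) :
    (fun a => T (x a) (y a) (z a)) =O[l] fun a => u a * v a * w a := by
  have h : (fun a => T (x a) (y a) (z a)) =O[l] fun a => ‖x a‖ * ‖y a‖ * ‖z a‖ :=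
    IsBigO.of_bound ‖T‖ (Eventually.of_forall fun a => by
      rw [Real.norm_of_nonneg (by positivity)]
      calc _ ≤ ‖T‖ * ‖x a‖ * ‖y a‖ * ‖z a‖ := (T (x a) (y a)).le_of_opNorm_le ((T (x a)).le_of_opNorm_le (T.le_opNorm _) _) _
        _ = _ := by ring)
  exact h.trans ((hx.norm_left.mul hy.norm_left).mul hz.norm_left)

theorem isBigO_cubicVar (T : E →L[ℝ] E →L[ℝ] E →L[ℝ] E) {x y : α → E} {u v : α → ℝ}
    (hx : x =O[l] u) (hy : y =O[l] v) :
    (fun a => cubicVar T (x a) (y a)) =O[l] fun a => u a ^ 2 * v a := by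
  refine ((?_ : _ =O[l] _).add ?_).add ?_
  · exact (hy.trilinear T hx hx).congr_right fun a => by ring
  · exact (hx.trilinear T hy hx).congr_right fun a => by ring
  · exact (hx.trilinear T hx hy).congr_right fun a => by ring

theorem isBigO_cubicQuad (T : E →L[ℝ] E →L[ℝ] E →L[ℝ] E) {x y : α → E} {u v : α → ℝ}
    (hx : x =O[l] u) (hy : y =O[l] v) :
    (fun a => cubicQuad T (x a) (y a)) =O[l] fun a => u a * v a ^ 2 := by
  refine ((?_ : _ =O[l] _).add ?_).add ?_
  · exact (hy.trilinear T hy hx).congr_right fun a => by ring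
  · exact (hy.trilinear T hx hy).congr_right fun a => by ring
  · exact (hx.trilinear T hy hy).congr_right fun a => by ring

theorem isBigO_cubicPolar (T : E →L[ℝ] E →L[ℝ] E →L[ℝ] E) {x y z : α → E} {u v w : α → ℝ}
    (hx : x =O[l] u) (hy : y =O[l] v) (hz : z =O[l] w) :
    (fun a => cubicPolar T (x a) (y a) (z a)) =O[l] fun a => u a * v a * w a := by
  refine (((((?_ : _ =O[l] _).add ?_).add ?_).add ?_).add ?_).add ?_
  · exact (hy.trilinear T hz hx).congr_right fun a => by ring
  · exact (hy.trilinear T hx hz).congr_right fun a => by ring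
  · exact (hz.trilinear T hy hx).congr_right fun a => by ring
  · exact (hz.trilinear T hx hy).congr_right fun a => by ring
  · exact (hx.trilinear T hy hz).congr_right fun a => by ring
  · exact (hx.trilinear T hz hy).congr_right fun a => by ring

end Trilinear

/-- The size of the remainders in the expansion of the bifurcation equations. -/
def remSizeSq (q : ℝ × ℝ × ℝ) : ℝ := q.1 ^ 4 + |q.1 * q.2.1| + q.2.1 ^ 2 + q.2.2 ^ 2

theorem remSizeSq_nonneg (q : ℝ × ℝ × ℝ) : 0 ≤ remSizeSq q := by unfold remSizeSq; positivity

theorem isBigO_remSizeSq_of_le {g : ℝ × ℝ × ℝ → ℝ} (K : ℝ)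
    (h : ∀ q : ℝ × ℝ × ℝ, |q.1| ≤ 1 → |q.2.1| ≤ 1 → |q.2.2| ≤ 1 →
      |g q| ≤ K * (|q.1| ^ 4 + |q.1| * |q.2.1| + |q.2.1| ^ 2 + |q.2.2| ^ 2)) :
    g =O[𝓝 0] remSizeSq := by
  refine IsBigO.of_bound K ?_
  filter_upwards [Metric.ball_mem_nhds 0 one_pos] with q hq
  rw [mem_ball_zero_iff, Prod.norm_def, Prod.norm_def, max_lt_iff, max_lt_iff] at hq
  have := h q hq.1.le hq.2.1.le hq.2.2.le
  rw [Real.norm_of_nonneg (remSizeSq_nonneg q), remSizeSq, abs_mul]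
  rw [Even.pow_abs (by decide), sq_abs, sq_abs] at this
  exact this

/-- The linear size of the parameters. -/
def linSize (q : ℝ × ℝ × ℝ) : ℝ := |q.1| + |q.2.1| + |q.2.2|

theorem scalar_bounds {a s w : ℝ} (ha : 0 ≤ a) (hs : 0 ≤ s) (hw : 0 ≤ w) (ha1 : a ≤ 1)
    (hs1 : s ≤ 1) (hw1 : w ≤ 1) :
    s * (a + s + w) ≤ 40 * (a ^ 4 + a * s + s ^ 2 + w ^ 2) ∧
    a ^ 3 * (a + s + w) ≤ 40 * (a ^ 4 + a * s + s ^ 2 + w ^ 2) ∧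
    a ^ 2 * (a + s + w) ^ 2 ≤ 40 * (a ^ 4 + a * s + s ^ 2 + w ^ 2) ∧
    a * (a + s + w) ^ 3 ≤ 40 * (a ^ 4 + a * s + s ^ 2 + w ^ 2) ∧
    a ^ 2 * (a ^ 2 + s + w) ≤ 40 * (a ^ 4 + a * s + s ^ 2 + w ^ 2) ∧
    (a ^ 2 + s + w) ^ 2 ≤ 40 * (a ^ 4 + a * s + s ^ 2 + w ^ 2) ∧
    w * (a ^ 2 + s + w) ≤ 40 * (a ^ 4 + a * s + s ^ 2 + w ^ 2) := by
  have has : 0 ≤ a * s := by positivity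
  have h4 : 0 ≤ a ^ 4 := by positivity
  have hs2 := sq_nonneg s
  have hw2 := sq_nonneg w
  have e1 : 2 * (s * w) ≤ s ^ 2 + w ^ 2 := by nlinarith [sq_nonneg (s - w)]
  have e2 : 2 * (a ^ 2 * w) ≤ a ^ 4 + w ^ 2 := by nlinarith [sq_nonneg (a ^ 2 - w)]
  have e3 : a ^ 2 * s ≤ a * s := by nlinarith
  have e4 : a ^ 3 * s ≤ a * s := by nlinarith [mul_nonneg has (sub_nonneg.2 ha1)]
  have e5 : a ^ 3 * w ≤ a ^ 2 * w := by
    nlinarith [mul_nonneg (mul_nonneg (sq_nonneg a) hw) (sub_nonneg.2 ha1)]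
  have e6 : a ^ 2 * s ^ 2 ≤ s ^ 2 := by nlinarith [mul_nonneg hs2 (sub_nonneg.2 ha1)]
  have e7 : a ^ 2 * w ^ 2 ≤ w ^ 2 := by nlinarith [mul_nonneg hw2 (sub_nonneg.2 ha1)]
  have e8 : a * s ^ 3 ≤ a * s := by
    have : s ^ 2 ≤ 1 := by nlinarith
    nlinarith [mul_nonneg has (sub_nonneg.2 this)]
  have e9 : a * w ^ 3 ≤ w ^ 2 := by
    have : a * w ≤ 1 := by nlinarith
    nlinarith [mul_nonneg hw2 (sub_nonneg.2 this)]
  have c2 : (a + s + w) ^ 2 ≤ 3 * (a ^ 2 + s ^ 2 + w ^ 2) := by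
    nlinarith [sq_nonneg (a - s), sq_nonneg (a - w), sq_nonneg (s - w)]
  have c3 : (a + s + w) ^ 3 ≤ 9 * (a ^ 3 + s ^ 3 + w ^ 3) := by
    nlinarith [mul_nonneg (add_nonneg ha hs) (sq_nonneg (a - s)),
      mul_nonneg (add_nonneg ha hw) (sq_nonneg (a - w)),
      mul_nonneg (add_nonneg hs hw) (sq_nonneg (s - w)),
      mul_nonneg hw (sq_nonneg (a - s)), mul_nonneg hs (sq_nonneg (a - w)),
      mul_nonneg ha (sq_nonneg (s - w))]
  have d2 := mul_le_mul_of_nonneg_left c2 (sq_nonneg a)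
  have d3 := mul_le_mul_of_nonneg_left c3 ha
  refine ⟨?_, ?_, ?_, ?_, ?_, ?_, ?_⟩ <;> nlinarith

theorem linSize_isBigO_one : linSize =O[𝓝 0] fun _ => (1 : ℝ) := by
  have : Continuous linSize := by unfold linSize; fun_prop
  exact this.continuousAt.isBigO_one ℝ

theorem remSize_isBigO_linSize : remSize =O[𝓝 0] linSize := by
  refine IsBigO.of_bound 1 ?_
  filter_upwards [Metric.ball_mem_nhds 0 one_pos] with q hq
  rw [mem_ball_zero_iff, Prod.norm_def, max_lt_iff] at hq
  have h : |q.1| ≤ 1 := hq.1.le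
  rw [Real.norm_of_nonneg (remSize_nonneg q), Real.norm_of_nonneg (by unfold linSize; positivity),
    remSize, linSize, ← sq_abs q.1]
  nlinarith [abs_nonneg q.1]

theorem fst_isBigO_linSize : (fun q : ℝ × ℝ × ℝ => q.1) =O[𝓝 0] linSize :=
  IsBigO.of_bound' (Eventually.of_forall fun q => by
    rw [Real.norm_eq_abs, Real.norm_of_nonneg (by unfold linSize; positivity), linSize]
    linarith [abs_nonneg q.2.1, abs_nonneg q.2.2])

section ScalarBounds

theorem abs_remSize (q : ℝ × ℝ × ℝ) : |remSize q| = |q.1| ^ 2 + |q.2.1| + |q.2.2| := by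
  rw [abs_of_nonneg (remSize_nonneg q), remSize, sq_abs]

theorem abs_linSize (q : ℝ × ℝ × ℝ) : |linSize q| = |q.1| + |q.2.1| + |q.2.2| := by
  rw [abs_of_nonneg (by unfold linSize; positivity), linSize]

theorem snd_mul_linSize : (fun q => q.2.1 * linSize q) =O[𝓝 0] remSizeSq :=
  isBigO_remSizeSq_of_le 40 fun q h1 h2 h3 => by
    simpa only [abs_mul, abs_pow, abs_linSize] using
      (scalar_bounds (abs_nonneg _) (abs_nonneg _) (abs_nonneg _) h1 h2 h3).1

theorem fst_cube_mul_linSize : (fun q => q.1 ^ 3 * linSize q) =O[𝓝 0] remSizeSq :=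
  isBigO_remSizeSq_of_le 40 fun q h1 h2 h3 => by
    simpa only [abs_mul, abs_pow, abs_linSize] using
      (scalar_bounds (abs_nonneg _) (abs_nonneg _) (abs_nonneg _) h1 h2 h3).2.1

theorem fst_sq_mul_linSize_sq : (fun q => q.1 ^ 2 * linSize q ^ 2) =O[𝓝 0] remSizeSq :=
  isBigO_remSizeSq_of_le 40 fun q h1 h2 h3 => by
    simpa only [abs_mul, abs_pow, abs_linSize] using
      (scalar_bounds (abs_nonneg _) (abs_nonneg _) (abs_nonneg _) h1 h2 h3).2.2.1

theorem fst_mul_linSize_cube : (fun q => q.1 * linSize q ^ 3) =O[𝓝 0] remSizeSq :=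
  isBigO_remSizeSq_of_le 40 fun q h1 h2 h3 => by
    simpa only [abs_mul, abs_pow, abs_linSize] using
      (scalar_bounds (abs_nonneg _) (abs_nonneg _) (abs_nonneg _) h1 h2 h3).2.2.2.1

theorem fst_sq_mul_remSize : (fun q => q.1 ^ 2 * remSize q) =O[𝓝 0] remSizeSq :=
  isBigO_remSizeSq_of_le 40 fun q h1 h2 h3 => by
    simpa only [abs_mul, abs_pow, abs_remSize] using
      (scalar_bounds (abs_nonneg _) (abs_nonneg _) (abs_nonneg _) h1 h2 h3).2.2.2.2.1

theorem remSize_sq : (fun q => remSize q ^ 2) =O[𝓝 0] remSizeSq :=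
  isBigO_remSizeSq_of_le 40 fun q h1 h2 h3 => by
    simpa only [abs_mul, abs_pow, abs_remSize] using
      (scalar_bounds (abs_nonneg _) (abs_nonneg _) (abs_nonneg _) h1 h2 h3).2.2.2.2.2.1

theorem thd_mul_remSize : (fun q => q.2.2 * remSize q) =O[𝓝 0] remSizeSq :=
  isBigO_remSizeSq_of_le 40 fun q h1 h2 h3 => by
    simpa only [abs_mul, abs_pow, abs_remSize] using
      (scalar_bounds (abs_nonneg _) (abs_nonneg _) (abs_nonneg _) h1 h2 h3).2.2.2.2.2.2

end ScalarBounds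

section Expansion

variable {E : Type*} [NormedAddCommGroup E] [NormedSpace ℝ E]

theorem Asymptotics.IsBigO.smul_of_mul {f : ℝ × ℝ × ℝ → ℝ} {x : ℝ × ℝ × ℝ → E}
    {u v : ℝ × ℝ × ℝ → ℝ} (hx : x =O[𝓝 0] u) (hv : (fun q => f q * u q) =O[𝓝 0] v) :
    (fun q => f q • x q) =O[𝓝 0] v :=
  ((isBigO_refl f _).smul hx).trans (by simpa only [smul_eq_mul] using hv)

theorem isBigO_mul_of_isBigO_one {u v w : ℝ × ℝ × ℝ → ℝ} (hu : u =O[𝓝 0] w)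
    (hv : v =O[𝓝 0] fun _ => (1 : ℝ)) : (fun q => u q * v q) =O[𝓝 0] w := by
  simpa using hu.mul hv

variable {R : ℝ × ℝ × ℝ → E}

theorem isBigO_displacement (hR : R =O[𝓝 0] remSize)
    (f : E) : (fun q => q.1 • f + R q) =O[𝓝 0] linSize :=
  ((fst_isBigO_linSize.smul (isBigO_refl (fun _ => f) _)).trans
    (isBigO_of_le' (c := ‖f‖) _ fun q => by rw [norm_smul, mul_comm])).add
    (hR.trans remSize_isBigO_linSize)

theorem cubic_expansion_zero (hR : R =O[𝓝 0] remSize)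
    (T : E →L[ℝ] E →L[ℝ] E →L[ℝ] E) (b f : E) :
    (fun q : ℝ × ℝ × ℝ => T (b + (q.1 • f + R q)) (b + (q.1 • f + R q)) (b + (q.1 • f + R q)) -
      (T b b b + q.1 • cubicVar T b f + q.1 ^ 2 • cubicQuad T b f + q.1 ^ 3 • T f f f +
        cubicVar T b (R q) + q.1 • cubicPolar T b f (R q))) =O[𝓝 0] remSizeSq := by
  have hf : (fun _ => f) =O[𝓝 (0 : ℝ × ℝ × ℝ)] fun _ => (1 : ℝ) := isBigO_const_const _ one_ne_zero _
  have hb : (fun _ => b) =O[𝓝 (0 : ℝ × ℝ × ℝ)] fun _ => (1 : ℝ) := isBigO_const_const _ one_ne_zero _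
  have hρ := remSize_isBigO_linSize.trans linSize_isBigO_one
  have hε := fst_isBigO_linSize.trans linSize_isBigO_one
  have e : ∀ q : ℝ × ℝ × ℝ, T (b + (q.1 • f + R q)) (b + (q.1 • f + R q)) (b + (q.1 • f + R q)) -
      (T b b b + q.1 • cubicVar T b f + q.1 ^ 2 • cubicQuad T b f + q.1 ^ 3 • T f f f +
        cubicVar T b (R q) + q.1 • cubicPolar T b f (R q)) =
      cubicQuad T b (R q) + q.1 ^ 2 • cubicVar T f (R q) + q.1 • cubicQuad T f (R q) +
        T (R q) (R q) (R q) := fun q => by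
    rw [cubic_add, cubicVar_add_smul, cubicQuad_add_smul, cubic_smul_add]; abel
  simp only [e]
  refine IsBigO.add (IsBigO.add (IsBigO.add ?_ ?_) ?_) ?_
  · exact (isBigO_cubicQuad T hb hR).trans (by simpa using remSize_sq)
  · exact (isBigO_cubicVar T hf hR).smul_of_mul (by simpa using fst_sq_mul_remSize)
  · refine (isBigO_cubicQuad T hf hR).smul_of_mul ?_
    exact (isBigO_mul_of_isBigO_one remSize_sq hε).congr_left fun q => by ring
  · exact (hR.trilinear T hR hR).trans
      ((isBigO_mul_of_isBigO_one remSize_sq hρ).congr_left fun q => by ring)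

theorem cubic_expansion_one (hR : R =O[𝓝 0] remSize)
    (T : E →L[ℝ] E →L[ℝ] E →L[ℝ] E) (b f : E) :
    (fun q : ℝ × ℝ × ℝ => q.1 • (T (b + (q.1 • f + R q)) (b + (q.1 • f + R q))
        (b + (q.1 • f + R q)) - (T b b b + q.1 • cubicVar T b f + q.1 ^ 2 • cubicQuad T b f +
        cubicVar T b (R q)))) =O[𝓝 0] remSizeSq := by
  have hf : (fun _ => f) =O[𝓝 (0 : ℝ × ℝ × ℝ)] fun _ => (1 : ℝ) := isBigO_const_const _ one_ne_zero _
  have hb : (fun _ => b) =O[𝓝 (0 : ℝ × ℝ × ℝ)] fun _ => (1 : ℝ) := isBigO_const_const _ one_ne_zero _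
  have hε := fst_isBigO_linSize.trans linSize_isBigO_one
  have hh := isBigO_displacement hR f
  have e : ∀ q : ℝ × ℝ × ℝ, q.1 • (T (b + (q.1 • f + R q)) (b + (q.1 • f + R q))
        (b + (q.1 • f + R q)) - (T b b b + q.1 • cubicVar T b f + q.1 ^ 2 • cubicQuad T b f +
        cubicVar T b (R q))) = q.1 ^ 2 • cubicPolar T b f (R q) + q.1 • cubicQuad T b (R q) +
        q.1 • T (q.1 • f + R q) (q.1 • f + R q) (q.1 • f + R q) := fun q => by
    rw [cubic_add, cubicVar_add_smul, cubicQuad_add_smul]; module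
  simp only [e]
  refine IsBigO.add (IsBigO.add ?_ ?_) ?_
  · exact (isBigO_cubicPolar T hb hf hR).smul_of_mul (by simpa using fst_sq_mul_remSize)
  · refine (isBigO_cubicQuad T hb hR).smul_of_mul ?_
    exact (isBigO_mul_of_isBigO_one remSize_sq hε).congr_left fun q => by ring
  · exact (hh.trilinear T hh hh).smul_of_mul
      (fst_mul_linSize_cube.congr_left fun q => by ring)

theorem cubic_expansion_two (hR : R =O[𝓝 0] remSize)
    (T : E →L[ℝ] E →L[ℝ] E →L[ℝ] E) (b f : E) :
    (fun q : ℝ × ℝ × ℝ => q.1 ^ 2 • (T (b + (q.1 • f + R q)) (b + (q.1 • f + R q))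
        (b + (q.1 • f + R q)) - (T b b b + q.1 • cubicVar T b f))) =O[𝓝 0] remSizeSq := by
  have hb : (fun _ => b) =O[𝓝 (0 : ℝ × ℝ × ℝ)] fun _ => (1 : ℝ) := isBigO_const_const _ one_ne_zero _
  have hh := isBigO_displacement hR f
  have e : ∀ q : ℝ × ℝ × ℝ, q.1 ^ 2 • (T (b + (q.1 • f + R q)) (b + (q.1 • f + R q))
        (b + (q.1 • f + R q)) - (T b b b + q.1 • cubicVar T b f)) =
        q.1 ^ 2 • cubicVar T b (R q) + q.1 ^ 2 • cubicQuad T b (q.1 • f + R q) +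
        q.1 ^ 2 • T (q.1 • f + R q) (q.1 • f + R q) (q.1 • f + R q) := fun q => by
    rw [cubic_add, cubicVar_add_smul]; module
  simp only [e]
  refine IsBigO.add (IsBigO.add ?_ ?_) ?_
  · exact (isBigO_cubicVar T hb hR).smul_of_mul (by simpa using fst_sq_mul_remSize)
  · exact (isBigO_cubicQuad T hb hh).smul_of_mul (by simpa using fst_sq_mul_linSize_sq)
  · refine (hh.trilinear T hh hh).smul_of_mul ?_
    exact (isBigO_mul_of_isBigO_one fst_sq_mul_linSize_sq linSize_isBigO_one).congr_left
      fun q => by ring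

theorem cubic_sub_isBigO (hR : R =O[𝓝 0] remSize)
    (T : E →L[ℝ] E →L[ℝ] E →L[ℝ] E) (b f : E) :
    (fun q : ℝ × ℝ × ℝ => T (b + (q.1 • f + R q)) (b + (q.1 • f + R q))
        (b + (q.1 • f + R q)) - T b b b) =O[𝓝 0] linSize := by
  have hb : (fun _ => b) =O[𝓝 (0 : ℝ × ℝ × ℝ)] fun _ => (1 : ℝ) := isBigO_const_const _ one_ne_zero _
  have hh := isBigO_displacement hR f
  have e : ∀ q : ℝ × ℝ × ℝ, T (b + (q.1 • f + R q)) (b + (q.1 • f + R q))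
        (b + (q.1 • f + R q)) - T b b b = cubicVar T b (q.1 • f + R q) +
        cubicQuad T b (q.1 • f + R q) +
        T (q.1 • f + R q) (q.1 • f + R q) (q.1 • f + R q) := fun q => by
    rw [cubic_add]; abel
  simp only [e]
  have h1 := isBigO_refl linSize (𝓝 0)
  refine IsBigO.add (IsBigO.add ?_ ?_) ?_
  · simpa using isBigO_cubicVar T hb hh
  · refine (isBigO_cubicQuad T hb hh).trans ?_
    exact (isBigO_mul_of_isBigO_one h1 linSize_isBigO_one).congr_left fun q => by ring
  · refine (hh.trilinear T hh hh).trans ?_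
    exact (isBigO_mul_of_isBigO_one (isBigO_mul_of_isBigO_one h1 linSize_isBigO_one)
      linSize_isBigO_one)

theorem cubic_isBigO_one (hR : R =O[𝓝 0] remSize)
    (T : E →L[ℝ] E →L[ℝ] E →L[ℝ] E) (b f : E) :
    (fun q : ℝ × ℝ × ℝ => T (b + (q.1 • f + R q)) (b + (q.1 • f + R q))
        (b + (q.1 • f + R q))) =O[𝓝 0] fun _ => (1 : ℝ) := by
  have h := (cubic_sub_isBigO hR T b f).trans linSize_isBigO_one
  simpa using h.add (isBigO_const_const (T b b b) (one_ne_zero (α := ℝ)) (𝓝 (0 : ℝ × ℝ × ℝ)))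

/-- The expansion of a graded family of cubic forms, modulo terms of order `remSizeSq`. -/
theorem cubicFamily_expansion (hR : R =O[𝓝 0] remSize)
    (T : ℕ → ℕ → E →L[ℝ] E →L[ℝ] E →L[ℝ] E) (b f : E) :
    (fun q : ℝ × ℝ × ℝ => (∑ i ∈ Finset.range 4, ∑ j ∈ Finset.range 2, (q.1 ^ i * q.2.1 ^ j) •
      T i j (b + (q.1 • f + R q)) (b + (q.1 • f + R q)) (b + (q.1 • f + R q))) -
      (T 0 0 b b b + q.1 • (cubicVar (T 0 0) b f + T 1 0 b b b) +
        q.1 ^ 2 • (cubicQuad (T 0 0) b f + cubicVar (T 1 0) b f + T 2 0 b b b) +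
        q.1 ^ 3 • (T 0 0 f f f + cubicQuad (T 1 0) b f + cubicVar (T 2 0) b f + T 3 0 b b b) +
        q.2.1 • T 0 1 b b b + cubicVar (T 0 0) b (R q) +
        q.1 • (cubicPolar (T 0 0) b f (R q) + cubicVar (T 1 0) b (R q)))) =O[𝓝 0] remSizeSq := by
  have h1 : (fun q : ℝ × ℝ × ℝ => q.2.1 * q.1) =O[𝓝 0] remSizeSq :=
    ((isBigO_refl (fun q : ℝ × ℝ × ℝ => q.2.1) (𝓝 0)).mul fst_isBigO_linSize).trans snd_mul_linSize
  have hε := fst_isBigO_linSize.trans linSize_isBigO_one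
  have k : ∀ j, (fun q : ℝ × ℝ × ℝ => (q.1 ^ (j + 1) * q.2.1) •
      T (j + 1) 1 (b + (q.1 • f + R q)) (b + (q.1 • f + R q)) (b + (q.1 • f + R q)))
      =O[𝓝 0] remSizeSq := fun j => by
    refine (cubic_isBigO_one hR (T (j + 1) 1) b f).smul_of_mul ?_
    have h2 : (fun q : ℝ × ℝ × ℝ => q.1 ^ j) =O[𝓝 0] fun _ => (1 : ℝ) := by
      simpa only [one_pow] using hε.pow j
    exact (isBigO_mul_of_isBigO_one h1 h2).congr_left fun q => by ring
  have := (((((((cubic_expansion_zero hR (T 0 0) b f).add (cubic_expansion_one hR (T 1 0) b f)).add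
    (cubic_expansion_two hR (T 2 0) b f)).add
    ((cubic_sub_isBigO hR (T 3 0) b f).smul_of_mul fst_cube_mul_linSize)).add
    ((cubic_sub_isBigO hR (T 0 1) b f).smul_of_mul snd_mul_linSize)).add
    (k 0)).add (k 1)).add (k 2)
  refine this.congr_left fun q => ?_
  simp only [Finset.sum_range_succ, Finset.sum_range_zero]
  module

end Expansion

theorem triOp_apply_eq_zero {χ : ℕ → ℕ → ℕ → Bool} {x y z : RealEll2} {n : ℕ}
    (h : ∀ j k, k ≤ n + j → x j = 0 ∨ y k = 0 ∨ z (n + j - k) = 0) : triOp χ x y z n = 0 := by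
  rw [triOp_apply, triFun_apply]
  refine (tsum_congr fun p => ?_).trans tsum_zero
  unfold triTerm
  split_ifs with h1
  · rcases h p.1 p.2 h1.1 with h | h | h <;> simp [h]
  · rfl

/-- The integer unit sequences. -/
def unitSeq (m n : ℕ) : ℤ := if n = m then 1 else 0

/-- The part of a sequence below the index `16`. -/
def headPart (x : RealEll2) : RealEll2 :=
  ∑ m ∈ Finset.range 16, unweight x m • intVec (unitSeq m)

theorem headPart_apply (x : RealEll2) {n : ℕ} (hn : n < 16) : headPart x n = x n := by
  have hw := (wt_pos n).ne'
  simp only [headPart, lp.coeFn_sum, Finset.sum_apply, ell2_smul_apply, intVec_apply, trunc, hn,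
    if_true, unitSeq]
  rw [Finset.sum_eq_single n]
  · rw [unweight_apply]; field_simp; simp
  · intro m _ h; simp [h.symm]
  · intro h; exact absurd (Finset.mem_range.2 hn) h

theorem intVec_eq_zero {a : ℕ → ℤ} (ha : ∀ m, 8 ≤ m → a m = 0) {m : ℕ} (hm : 8 ≤ m) :
    intVec a m = 0 := by
  rw [intVec_apply, trunc]; split_ifs <;> simp [ha m hm]

theorem ell2_sum_smul_apply {ι : Type*} (s : Finset ι) (r : ι → ℝ) (x : ι → RealEll2) (n : ℕ) :
    (∑ m ∈ s, r m • x m : RealEll2) n = ∑ m ∈ s, r m * x m n := by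
  simp only [lp.coeFn_sum, Finset.sum_apply, ell2_smul_apply]

section Linear

variable (χ : ℕ → ℕ → ℕ → Bool) {a c : ℕ → ℤ}

theorem triOp_left_apply (ha : ∀ m, 8 ≤ m → a m = 0) (hc : ∀ m, 8 ≤ m → c m = 0) (x : RealEll2)
    {n : ℕ} (hn : n < 8) : triOp χ x (intVec a) (intVec c) n =
      ∑ m ∈ Finset.range 16, unweight x m * (triInt χ (unitSeq m) a c n : ℤ) := by
  have h : triOp χ (x - headPart x) (intVec a) (intVec c) n = 0 :=
    triOp_apply_eq_zero fun j k hk => by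
      rw [ell2_sub_apply]
      rcases lt_or_ge j 16 with hj | hj
      · exact Or.inl (by rw [headPart_apply x hj, sub_self])
      · rcases lt_or_ge k 8 with h8 | h8
        · exact Or.inr (Or.inr (intVec_eq_zero hc (by omega)))
        · exact Or.inr (Or.inl (intVec_eq_zero ha h8))
  rw [map_sub, sub_apply, sub_apply, ell2_sub_apply, sub_eq_zero] at h
  rw [h, headPart, map_sum, sum_apply, sum_apply]
  simp only [map_smul, smul_apply, ell2_sum_smul_apply, triOp_intVec]

theorem triOp_mid_apply (ha : ∀ m, 8 ≤ m → a m = 0) (x : RealEll2)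
    {n : ℕ} (hn : n < 8) : triOp χ (intVec a) x (intVec c) n =
      ∑ m ∈ Finset.range 16, unweight x m * (triInt χ a (unitSeq m) c n : ℤ) := by
  have h : triOp χ (intVec a) (x - headPart x) (intVec c) n = 0 :=
    triOp_apply_eq_zero fun j k hk => by
      rw [ell2_sub_apply]
      rcases lt_or_ge k 16 with hj | hj
      · exact Or.inr (Or.inl (by rw [headPart_apply x hj, sub_self]))
      · exact Or.inl (intVec_eq_zero ha (by omega))
  rw [map_sub, sub_apply, ell2_sub_apply, sub_eq_zero] at h
  rw [h, headPart, map_sum, sum_apply]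
  simp only [map_smul, smul_apply, ell2_sum_smul_apply, triOp_intVec]

theorem triOp_right_apply (ha : ∀ m, 8 ≤ m → a m = 0) (x : RealEll2)
    {n : ℕ} (hn : n < 8) : triOp χ (intVec a) (intVec c) x n =
      ∑ m ∈ Finset.range 16, unweight x m * (triInt χ a c (unitSeq m) n : ℤ) := by
  have h : triOp χ (intVec a) (intVec c) (x - headPart x) n = 0 :=
    triOp_apply_eq_zero fun j k hk => by
      rw [ell2_sub_apply]
      rcases lt_or_ge (n + j - k) 16 with hj | hj
      · exact Or.inr (Or.inr (by rw [headPart_apply x hj, sub_self]))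
      · exact Or.inl (intVec_eq_zero ha (by omega))
  rw [map_sub, ell2_sub_apply, sub_eq_zero] at h
  rw [h, headPart, map_sum]
  simp only [map_smul, ell2_sum_smul_apply, triOp_intVec]

end Linear

theorem baseSeq_eq_zero (m : ℕ) (h : 8 ≤ m) : baseSeq m = 0 := by
  unfold baseSeq; split <;> omega

theorem firstSeq_eq_zero (m : ℕ) (h : 8 ≤ m) : firstSeq m = 0 := by
  unfold firstSeq; split <;> omega

/-- The integer first variation. -/
def varInt (χ : ℕ → ℕ → ℕ → Bool) (b h : ℕ → ℤ) (n : ℕ) : ℤ :=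
  triInt χ h b b n + triInt χ b h b n + triInt χ b b h n

/-- The integer quadratic part. -/
def quadInt (χ : ℕ → ℕ → ℕ → Bool) (b h : ℕ → ℤ) (n : ℕ) : ℤ :=
  triInt χ h h b n + triInt χ h b h n + triInt χ b h h n

/-- The integer polarization. -/
def polarInt (χ : ℕ → ℕ → ℕ → Bool) (b h k : ℕ → ℤ) (n : ℕ) : ℤ :=
  triInt χ h k b n + triInt χ h b k n + triInt χ k h b n + triInt χ k b h n +
    triInt χ b h k n + triInt χ b k h n

theorem cubicVar_intVec (χ : ℕ → ℕ → ℕ → Bool) (b h : ℕ → ℤ) (n : ℕ) :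
    cubicVar (triOp χ) (intVec b) (intVec h) n = (varInt χ b h n : ℤ) := by
  simp only [cubicVar, ell2_add_apply, triOp_intVec, varInt]; push_cast; ring

theorem cubicQuad_intVec (χ : ℕ → ℕ → ℕ → Bool) (b h : ℕ → ℤ) (n : ℕ) :
    cubicQuad (triOp χ) (intVec b) (intVec h) n = (quadInt χ b h n : ℤ) := by
  simp only [cubicQuad, ell2_add_apply, triOp_intVec, quadInt]; push_cast; ring

theorem cubicVar_apply (χ : ℕ → ℕ → ℕ → Bool) {b : ℕ → ℤ} (hb : ∀ m, 8 ≤ m → b m = 0)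
    (x : RealEll2) {n : ℕ} (hn : n < 8) : cubicVar (triOp χ) (intVec b) x n =
      ∑ m ∈ Finset.range 16, unweight x m * (varInt χ b (unitSeq m) n : ℤ) := by
  simp only [cubicVar, ell2_add_apply, varInt]
  rw [triOp_left_apply χ hb hb x hn, triOp_mid_apply χ hb x hn, triOp_right_apply χ hb x hn,
    ← Finset.sum_add_distrib, ← Finset.sum_add_distrib]
  refine Finset.sum_congr rfl fun m _ => ?_
  push_cast; ring

theorem cubicPolar_apply (χ : ℕ → ℕ → ℕ → Bool) {b f : ℕ → ℤ} (hb : ∀ m, 8 ≤ m → b m = 0)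
    (hf : ∀ m, 8 ≤ m → f m = 0) (x : RealEll2) {n : ℕ} (hn : n < 8) :
    cubicPolar (triOp χ) (intVec b) (intVec f) x n =
      ∑ m ∈ Finset.range 16, unweight x m * (polarInt χ b f (unitSeq m) n : ℤ) := by
  simp only [cubicPolar, ell2_add_apply, polarInt]
  rw [triOp_left_apply χ hb hf x hn, triOp_mid_apply χ hb x hn, triOp_right_apply χ hb x hn,
    triOp_left_apply χ hf hb x hn, triOp_mid_apply χ hf x hn, triOp_right_apply χ hf x hn]
  simp only [← Finset.sum_add_distrib]
  refine Finset.sum_congr rfl fun m _ => ?_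
  push_cast; ring

/-- The quadratic coefficients in `A₂`. -/
def quadCoeff (n : ℕ) : ℤ := match n with | 0 => 2 | 2 => -3 | 3 => -10 | _ => 0

/-- The cubic coefficients in `A₂`. -/
def cubeCoeff (n : ℕ) : ℤ := match n with | 3 => 102 | 4 => -18 | 6 => -6 | _ => 0

/-- The coefficients of `A₃ ^ 2`. -/
def sndCoeff (n : ℕ) : ℤ := match n with | 0 => 2 | 2 => -10 | 3 => 4 | 4 => -9 | _ => 1

/-- Six times the coefficients of the linearization at `baseSeq`. -/
def derivCoeff (n m : ℕ) : ℤ :=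
  match n, m with
  | 0, 0 => 12 | 2, 0 => 24 | 3, 0 => 24 | 3, 6 => 12 | 4, 4 => 2 | 4, 6 => 12 | 6, 6 => 12
  | _, _ => 0

/-- The coefficients of the first order correction of the linearization. -/
def derivCoeffOne (n m : ℕ) : ℤ :=
  match n, m with
  | 2, 4 => 2 | 2, 6 => -6 | 4, 0 => -11 | 4, 2 => 2
  | _, _ => 0

theorem expansion_coefficients :
    (∀ n ∈ [0, 2, 3, 4, 6], quadInt (gradedSet 0 0) baseSeq firstSeq n +
      varInt (gradedSet 1 0) baseSeq firstSeq n + triInt (gradedSet 2 0) baseSeq baseSeq baseSeq n =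
      quadCoeff n) ∧
    (∀ n ∈ [0, 2, 3, 4, 6], triInt (gradedSet 0 0) firstSeq firstSeq firstSeq n +
      quadInt (gradedSet 1 0) baseSeq firstSeq n + varInt (gradedSet 2 0) baseSeq firstSeq n +
      triInt (gradedSet 3 0) baseSeq baseSeq baseSeq n =
      cubeCoeff n) ∧
    (∀ n ∈ [0, 2, 3, 4, 6], triInt (gradedSet 0 1) baseSeq baseSeq baseSeq n =
      sndCoeff n) := by
  decide +kernel

theorem linear_coefficients : ∀ n ∈ [0, 2, 3, 4, 6], ∀ m < 16,
    6 * varInt (gradedSet 0 0) baseSeq (unitSeq m) n -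
      ((n : ℤ) + 1) * (6 - n) * (if n = m then 1 else 0) = derivCoeff n m := by
  decide +kernel

theorem linear_coefficients_one : ∀ n ∈ [0, 2, 3, 4, 6], ∀ m < 16,
    polarInt (gradedSet 0 0) baseSeq firstSeq (unitSeq m) n +
      varInt (gradedSet 1 0) baseSeq (unitSeq m) n = derivCoeffOne n m := by
  decide +kernel

theorem base_coefficients : ∀ n ∈ [2, 3],
    (6 * triInt (gradedSet 0 0) baseSeq baseSeq baseSeq n =
      ((n : ℤ) + 1) * (6 - n) * trunc baseSeq n) ∧
    (6 * (varInt (gradedSet 0 0) baseSeq firstSeq n +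
      triInt (gradedSet 1 0) baseSeq baseSeq baseSeq n) =
      ((n : ℤ) + 1) * (6 - n) * trunc firstSeq n) := by
  decide +kernel

theorem lamOp_apply' (x : RealEll2) (n : ℕ) :
    lamOp x n = ((n : ℝ) + 1) * (6 - n) / 6 * unweight x n := by
  rw [lamOp, diagOp_apply, unweight_apply]
  have := (wt_pos n).ne'
  field_simp

theorem modeOp_intVec (a : ℕ → ℤ) (n : ℕ) :
    modeOp (intVec a) n = (n : ℝ) * (n + 1) * (trunc a n : ℤ) := by
  rw [modeOp, diagOp_apply, intVec_apply]
  have := (wt_pos n).ne'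
  field_simp

/-- The expansion of the scaled residual around the approximate solution. -/
def residualMain (x : RealEll2) (q : ℝ × ℝ × ℝ) : RealEll2 :=
  (triOp (gradedSet 0 0) (intVec baseSeq) (intVec baseSeq) (intVec baseSeq) -
    lamOp (intVec baseSeq)) +
  q.1 • (cubicVar (triOp (gradedSet 0 0)) (intVec baseSeq) (intVec firstSeq) +
    triOp (gradedSet 1 0) (intVec baseSeq) (intVec baseSeq) (intVec baseSeq) -
    lamOp (intVec firstSeq)) +
  q.1 ^ 2 • (cubicQuad (triOp (gradedSet 0 0)) (intVec baseSeq) (intVec firstSeq) +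
    cubicVar (triOp (gradedSet 1 0)) (intVec baseSeq) (intVec firstSeq) +
    triOp (gradedSet 2 0) (intVec baseSeq) (intVec baseSeq) (intVec baseSeq)) +
  q.1 ^ 3 • (triOp (gradedSet 0 0) (intVec firstSeq) (intVec firstSeq) (intVec firstSeq) +
    cubicQuad (triOp (gradedSet 1 0)) (intVec baseSeq) (intVec firstSeq) +
    cubicVar (triOp (gradedSet 2 0)) (intVec baseSeq) (intVec firstSeq) +
    triOp (gradedSet 3 0) (intVec baseSeq) (intVec baseSeq) (intVec baseSeq)) +
  q.2.1 • triOp (gradedSet 0 1) (intVec baseSeq) (intVec baseSeq) (intVec baseSeq) +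
  (cubicVar (triOp (gradedSet 0 0)) (intVec baseSeq) x - lamOp x) +
  q.1 • (cubicPolar (triOp (gradedSet 0 0)) (intVec baseSeq) (intVec firstSeq) x +
    cubicVar (triOp (gradedSet 1 0)) (intVec baseSeq) x) +
  q.2.2 • (modeOp (intVec baseSeq) + q.1 • modeOp (intVec firstSeq))

theorem scaledResidual_sub_residualMain_isBigO {R : ℝ × ℝ × ℝ → RealEll2}
    (hR : R =O[𝓝 0] remSize) :
    (fun q => scaledResidual q (approxSol q.1 + R q) - residualMain (R q) q) =O[𝓝 0] remSizeSq := by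
  have h1 := cubicFamily_expansion hR (fun i j => triOp (gradedSet i j)) (intVec baseSeq)
    (intVec firstSeq)
  have h2 : (fun q => q.2.2 • modeOp (R q)) =O[𝓝 0] remSizeSq :=
    ((modeOp.isBigO_comp R (𝓝 0)).trans hR).smul_of_mul thd_mul_remSize
  refine (h1.add h2).congr_left fun q => ?_
  have e : approxSol q.1 + R q = intVec baseSeq + (q.1 • intVec firstSeq + R q) := by
    rw [approxSol, add_assoc]
  have el : lamOp (approxSol q.1 + R q) =
      lamOp (intVec baseSeq) + (q.1 • lamOp (intVec firstSeq) + lamOp (R q)) := by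
    rw [e, map_add, map_add, map_smul]
  have em : modeOp (approxSol q.1 + R q) =
      modeOp (intVec baseSeq) + (q.1 • modeOp (intVec firstSeq) + modeOp (R q)) := by
    rw [e, map_add, map_add, map_smul]
  rw [scaledResidual, eqResidual, cubicFamily, el, em, e, residualMain]
  generalize (∑ i ∈ Finset.range 4, ∑ j ∈ Finset.range 2, (q.1 ^ i * q.2.1 ^ j) •
    triOp (gradedSet i j) (intVec baseSeq + (q.1 • intVec firstSeq + R q))
      (intVec baseSeq + (q.1 • intVec firstSeq + R q))
      (intVec baseSeq + (q.1 • intVec firstSeq + R q))) = S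
  module

theorem residualMain_apply (x : RealEll2) (q : ℝ × ℝ × ℝ) {n : ℕ} (hn : n ∈ [0, 2, 3, 4, 6]) :
    residualMain x q n = q.1 ^ 2 * (quadCoeff n : ℝ) +
      q.1 ^ 3 * (cubeCoeff n : ℝ) +
      q.2.1 * (sndCoeff n : ℝ) +
      (∑ m ∈ Finset.range 16, unweight x m * (derivCoeff n m : ℝ)) / 6 +
      q.1 * (∑ m ∈ Finset.range 16, unweight x m * (derivCoeffOne n m : ℝ)) +
      q.2.2 * (n * (n + 1) * (trunc baseSeq n : ℤ) +
        q.1 * (n * (n + 1) * (trunc firstSeq n : ℤ))) := by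
  have h8 : n < 8 := by fin_cases hn <;> norm_num
  obtain ⟨k2, k3, kS⟩ := expansion_coefficients
  have k2 := congrArg (Int.cast : ℤ → ℝ) (k2 n hn)
  have k3 := congrArg (Int.cast : ℤ → ℝ) (k3 n hn)
  have kS := congrArg (Int.cast : ℤ → ℝ) (kS n hn)
  have hbase : (6 * triInt (gradedSet 0 0) baseSeq baseSeq baseSeq n =
      ((n : ℤ) + 1) * (6 - n) * trunc baseSeq n) ∧
      (6 * (varInt (gradedSet 0 0) baseSeq firstSeq n +
        triInt (gradedSet 1 0) baseSeq baseSeq baseSeq n) =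
        ((n : ℤ) + 1) * (6 - n) * trunc firstSeq n) := by
    by_cases h : n = 2 ∨ n = 3
    · exact base_coefficients n (by simpa using h)
    · push Not at h
      exact ⟨baseSeq_equation n (by omega) h.1 h.2, firstSeq_equation n (by omega) h.1 h.2⟩
  have hb0 : (triOp (gradedSet 0 0) (intVec baseSeq) (intVec baseSeq) (intVec baseSeq) -
      lamOp (intVec baseSeq)) n = 0 := by
    rw [ell2_sub_apply, triOp_intVec, lamOp_intVec, ← hbase.1]; push_cast; ring
  have hb1 : (cubicVar (triOp (gradedSet 0 0)) (intVec baseSeq) (intVec firstSeq) +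
      triOp (gradedSet 1 0) (intVec baseSeq) (intVec baseSeq) (intVec baseSeq) -
      lamOp (intVec firstSeq)) n = 0 := by
    rw [ell2_sub_apply, ell2_add_apply, cubicVar_intVec, triOp_intVec, lamOp_intVec, ← hbase.2]
    push_cast; ring
  have hL : (cubicVar (triOp (gradedSet 0 0)) (intVec baseSeq) x - lamOp x) n =
      (∑ m ∈ Finset.range 16, unweight x m * (derivCoeff n m : ℝ)) / 6 := by
    have e : lamOp x n = ∑ m ∈ Finset.range 16, unweight x m *
        ((((n : ℤ) + 1) * (6 - n) * (if n = m then 1 else 0) : ℤ) : ℝ) / 6 := by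
      rw [lamOp_apply', Finset.sum_eq_single n]
      · simp; ring
      · intro m _ h; simp [h.symm]
      · intro h; exact absurd (Finset.mem_range.2 (by omega)) h
    rw [ell2_sub_apply, cubicVar_apply _ baseSeq_eq_zero x h8, e, ← Finset.sum_sub_distrib,
      Finset.sum_div]
    refine Finset.sum_congr rfl fun m hm => ?_
    rw [← linear_coefficients n hn m (Finset.mem_range.1 hm)]
    push_cast; ring
  have hL1 : (cubicPolar (triOp (gradedSet 0 0)) (intVec baseSeq) (intVec firstSeq) x +
      cubicVar (triOp (gradedSet 1 0)) (intVec baseSeq) x) n =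
      ∑ m ∈ Finset.range 16, unweight x m * (derivCoeffOne n m : ℝ) := by
    rw [ell2_add_apply, cubicVar_apply _ baseSeq_eq_zero x h8,
      cubicPolar_apply _ baseSeq_eq_zero firstSeq_eq_zero x h8, ← Finset.sum_add_distrib]
    refine Finset.sum_congr rfl fun m hm => ?_
    rw [← linear_coefficients_one n hn m (Finset.mem_range.1 hm)]
    push_cast; ring
  rw [residualMain, ell2_add_apply, ell2_add_apply, ell2_add_apply, ell2_add_apply, ell2_add_apply,
    ell2_add_apply, ell2_add_apply, hb0, ell2_smul_apply, hb1, hL, ell2_smul_apply q.1, hL1]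
  simp only [ell2_add_apply, ell2_smul_apply, cubicQuad_intVec, cubicVar_intVec, triOp_intVec,
    modeOp_intVec]
  rw [← k2, ← k3, ← kS]
  push_cast
  ring

theorem residualMain_zero (x : RealEll2) (q : ℝ × ℝ × ℝ) :
    residualMain x q 0 = 2 * q.1 ^ 2 + 2 * q.2.1 + 2 * unweight x 0 := by
  rw [residualMain_apply x q (by simp)]
  simp only [quadCoeff, cubeCoeff, sndCoeff, derivCoeff, derivCoeffOne, Finset.sum_range_succ,
    Finset.sum_range_zero, trunc, baseSeq, firstSeq]
  push_cast; ring

theorem residualMain_two (x : RealEll2) (q : ℝ × ℝ × ℝ) :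
    residualMain x q 2 = -3 * q.1 ^ 2 - 10 * q.2.1 + 6 * q.2.2 + 4 * unweight x 0 +
      q.1 * (2 * unweight x 4 - 6 * unweight x 6) := by
  rw [residualMain_apply x q (by simp)]
  simp only [quadCoeff, cubeCoeff, sndCoeff, derivCoeff, derivCoeffOne, Finset.sum_range_succ,
    Finset.sum_range_zero, trunc, baseSeq, firstSeq, Nat.reduceLT, if_true]
  push_cast; ring

theorem residualMain_three (x : RealEll2) (q : ℝ × ℝ × ℝ) :
    residualMain x q 3 = -10 * q.1 ^ 2 + 102 * q.1 ^ 3 + 4 * q.2.1 + 12 * q.2.2 +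
      4 * unweight x 0 + 2 * unweight x 6 := by
  rw [residualMain_apply x q (by simp)]
  simp only [quadCoeff, cubeCoeff, sndCoeff, derivCoeff, derivCoeffOne, Finset.sum_range_succ,
    Finset.sum_range_zero, trunc, baseSeq, firstSeq, Nat.reduceLT, if_true]
  push_cast; ring

theorem residualMain_four (x : RealEll2) (q : ℝ × ℝ × ℝ) :
    residualMain x q 4 = -18 * q.1 ^ 3 - 9 * q.2.1 - 60 * q.1 * q.2.2 + unweight x 4 / 3 +
      2 * unweight x 6 + q.1 * (-11 * unweight x 0 + 2 * unweight x 2) := by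
  rw [residualMain_apply x q (by simp)]
  simp only [quadCoeff, cubeCoeff, sndCoeff, derivCoeff, derivCoeffOne, Finset.sum_range_succ,
    Finset.sum_range_zero, trunc, baseSeq, firstSeq, Nat.reduceLT, if_true]
  push_cast; ring

theorem residualMain_six (x : RealEll2) (q : ℝ × ℝ × ℝ) :
    residualMain x q 6 = -6 * q.1 ^ 3 + q.2.1 + 2 * unweight x 6 := by
  rw [residualMain_apply x q (by simp)]
  simp only [quadCoeff, cubeCoeff, sndCoeff, derivCoeff, derivCoeffOne, Finset.sum_range_succ,
    Finset.sum_range_zero, trunc, baseSeq, firstSeq, Nat.reduceLT, if_true]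
  push_cast; ring

theorem Asymptotics.IsBigO.apply_ell2 {α : Type*} {l : Filter α} {x : α → RealEll2} {u : α → ℝ}
    (h : x =O[l] u) (n : ℕ) : (fun a => x a n) =O[l] u :=
  (isBigO_of_le _ fun a => lp.norm_apply_le_norm (by norm_num) (x a) n).trans h

theorem approxSol_apply_two (ε : ℝ) : approxSol ε 2 = 9 := by
  simp only [approxSol, ell2_add_apply, ell2_smul_apply, intVec_apply]
  norm_num [trunc, baseSeq, firstSeq, wt]

/-- The expansions of the two bifurcation equations. -/
theorem bifurcation_expansions {c : ℝ × ℝ × ℝ → RealEll2}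
    (hsol : ∀ᶠ q in 𝓝 0, c q 2 = 9 ∧ c q 3 = 16 ∧
      ∀ n, n ≠ 2 → n ≠ 3 → scaledResidual q (c q) n = 0)
    (hc : (fun q => c q - approxSol q.1) =O[𝓝 0] remSize) :
    (fun q => scaledResidual q (c q) 2 - (6 * q.2.2 - 7 * q.1 ^ 2 - 14 * q.2.1))
      =O[𝓝 0] remSizeSq ∧
    (fun q => scaledResidual q (c q) 3 -
      (12 * q.2.2 - 14 * q.1 ^ 2 - q.2.1 + 108 * q.1 ^ 3)) =O[𝓝 0] remSizeSq := by
  set R : ℝ × ℝ × ℝ → RealEll2 := fun q => c q - approxSol q.1 with hRdef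
  have hcR : ∀ q, c q = approxSol q.1 + R q := fun q => by simp [hRdef]
  have hE : ∀ n, (fun q => scaledResidual q (c q) n - residualMain (R q) q n) =O[𝓝 0] remSizeSq :=
    fun n => by
      have := (scaledResidual_sub_residualMain_isBigO hc).apply_ell2 n
      simpa only [ell2_sub_apply, hcR] using this
  have hA : ∀ n, (fun q => unweight (R q) n) =O[𝓝 0] remSize := fun n =>
    ((unweight.isBigO_comp R (𝓝 0)).trans hc).apply_ell2 n
  have hε := fst_isBigO_linSize.trans linSize_isBigO_one
  have h0 : (fun q : ℝ × ℝ × ℝ => unweight (R q) 0 + q.1 ^ 2 + q.2.1) =O[𝓝 0] remSizeSq := by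
    refine ((hE 0).const_mul_left (-1 / 2)).congr' ?_ EventuallyEq.rfl
    filter_upwards [hsol] with q hq
    rw [hq.2.2 0 (by norm_num) (by norm_num), residualMain_zero]; ring
  have h6 : (fun q : ℝ × ℝ × ℝ => unweight (R q) 6 - 3 * q.1 ^ 3 + q.2.1 / 2)
      =O[𝓝 0] remSizeSq := by
    refine ((hE 6).const_mul_left (-1 / 2)).congr' ?_ EventuallyEq.rfl
    filter_upwards [hsol] with q hq
    rw [hq.2.2 6 (by norm_num) (by norm_num), residualMain_six]; ring
  have hs : (fun q : ℝ × ℝ × ℝ => q.2.1 * q.1) =O[𝓝 0] remSizeSq :=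
    ((isBigO_refl (fun q : ℝ × ℝ × ℝ => q.2.1) (𝓝 0)).mul fst_isBigO_linSize).trans snd_mul_linSize
  have hε4 : (fun q : ℝ × ℝ × ℝ => q.1 ^ 3 * q.1) =O[𝓝 0] remSizeSq :=
    ((isBigO_refl (fun q : ℝ × ℝ × ℝ => q.1 ^ 3) (𝓝 0)).mul fst_isBigO_linSize).trans
      fst_cube_mul_linSize
  have hεΩ : (fun q : ℝ × ℝ × ℝ => q.1 ^ 2 * q.2.2) =O[𝓝 0] remSizeSq :=
    ((isBigO_refl (fun q : ℝ × ℝ × ℝ => q.1 ^ 2) (𝓝 0)).mul thd_isBigO_remSize).trans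
      fst_sq_mul_remSize
  have hεa : (fun q : ℝ × ℝ × ℝ => q.1 ^ 2 * unweight (R q) 0) =O[𝓝 0] remSizeSq :=
    ((isBigO_refl (fun q : ℝ × ℝ × ℝ => q.1 ^ 2) (𝓝 0)).mul (hA 0)).trans fst_sq_mul_remSize
  have h6' : (fun q : ℝ × ℝ × ℝ => q.1 * unweight (R q) 6) =O[𝓝 0] remSizeSq := by
    refine (((isBigO_mul_of_isBigO_one h6 hε).add (hε4.const_mul_left 3)).add
      (hs.const_mul_left (-1 / 2))).congr_left fun q => by ring
  have h4' : (fun q : ℝ × ℝ × ℝ => q.1 * unweight (R q) 4) =O[𝓝 0] remSizeSq := by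
    refine ((((((isBigO_mul_of_isBigO_one (hE 4) hε).const_mul_left (-3)).add
      (hε4.const_mul_left 54)).add (hs.const_mul_left 27)).add (hεΩ.const_mul_left 180)).add
      ((hεa.const_mul_left 33).sub (h6'.const_mul_left 6))).congr' ?_ EventuallyEq.rfl
    filter_upwards [hsol] with q hq
    have h2 : unweight (R q) 2 = 0 := by
      rw [unweight_apply, hRdef]
      simp only [ell2_sub_apply, hq.1, approxSol_apply_two, sub_self, mul_zero]
    rw [hq.2.2 4 (by norm_num) (by norm_num), residualMain_four, h2]; ring
  constructor
  · refine ((((hE 2).add (h0.const_mul_left 4)).add (h4'.const_mul_left 2)).sub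
      (h6'.const_mul_left 6)).congr_left fun q => ?_
    rw [residualMain_two]; ring
  · refine (((hE 3).add (h0.const_mul_left 4)).add (h6.const_mul_left 2)).congr_left fun q => ?_
    rw [residualMain_three]; ring

theorem exists_implicit_function {E F : Type*} [NormedAddCommGroup E] [NormedSpace ℝ E]
    [CompleteSpace E] [NormedAddCommGroup F] [NormedSpace ℝ F] [CompleteSpace F] {f : E × F → F}
    (hf : ContDiffAt ℝ ω f 0) (h0 : f 0 = 0) {L : E × F →L[ℝ] F} (hL : HasFDerivAt f L 0)
    (hid : L ∘L .inr ℝ E F = .id ℝ F) : ∃ ψ : E → F, ContDiffAt ℝ ω ψ 0 ∧ ψ 0 = 0 ∧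
      ∀ᶠ v in 𝓝 (0 : E × F), f v = 0 ↔ ψ v.1 = v.2 := by
  have hi : (fderiv ℝ f (0 : E × F) ∘L .inr ℝ E F).IsInvertible := by
    rw [hL.fderiv, hid]; exact ⟨ContinuousLinearEquiv.refl ℝ _, rfl⟩
  refine ⟨hf.implicitFunction (by simp) hi, hf.contDiffAt_implicitFunction (by simp) hi,
    hf.implicitFunction_apply_self (by simp) hi, ?_⟩
  have := hf.eventually_apply_eq_iff_implicitFunction (by simp) hi
  rwa [h0] at this

theorem hasFDerivAt_zero_of_isBigO {E F : Type*} [NormedAddCommGroup E] [NormedSpace ℝ E]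
    [NormedAddCommGroup F] [NormedSpace ℝ F] {f : E → F} {L : E →L[ℝ] F} (h0 : f 0 = 0)
    (h : (fun v => f v - L v) =O[𝓝 0] fun v => ‖v‖ ^ 2) : HasFDerivAt f L 0 := by
  rw [hasFDerivAt_iff_isLittleO_nhds_zero]
  simp only [zero_add, h0, sub_zero]
  refine h.trans_isLittleO ?_
  simpa using isLittleO_norm_pow_id (E' := E) one_lt_two

theorem remSizeSq_isBigO_norm_sq : remSizeSq =O[𝓝 0] fun q => ‖q‖ ^ 2 := by
  refine IsBigO.of_bound 4 ?_
  filter_upwards [Metric.ball_mem_nhds 0 one_pos] with q hq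
  rw [mem_ball_zero_iff] at hq
  rw [Real.norm_of_nonneg (remSizeSq_nonneg q), Real.norm_of_nonneg (by positivity), remSizeSq,
    abs_mul, ← sq_abs q.2.1, ← sq_abs q.2.2, ← Even.pow_abs (by decide : Even 4) q.1]
  have h1 : |q.1| ≤ ‖q‖ := norm_fst_le q
  have h2 : |q.2.1| ≤ ‖q‖ := (norm_fst_le q.2).trans (norm_snd_le q)
  have h3 : |q.2.2| ≤ ‖q‖ := (norm_snd_le q.2).trans (norm_snd_le q)
  have h4 : |q.1| ^ 4 ≤ ‖q‖ ^ 2 := by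
    calc |q.1| ^ 4 ≤ ‖q‖ ^ 4 := by gcongr
      _ ≤ ‖q‖ ^ 2 := pow_le_pow_of_le_one (norm_nonneg _) hq.le (by norm_num)
  have h5 : |q.1| * |q.2.1| ≤ ‖q‖ * ‖q‖ := by gcongr
  have h6 : |q.2.1| ^ 2 ≤ ‖q‖ ^ 2 := by gcongr
  have h7 : |q.2.2| ^ 2 ≤ ‖q‖ ^ 2 := by gcongr
  nlinarith

theorem fst_sq_isBigO_norm_sq : (fun q : ℝ × ℝ × ℝ => q.1 ^ 2) =O[𝓝 0] fun q => ‖q‖ ^ 2 :=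
  IsBigO.of_bound' (Eventually.of_forall fun q => by
    rw [norm_pow, norm_pow, norm_norm]; gcongr; exact norm_fst_le q)

theorem fst_cube_isBigO_norm_sq : (fun q : ℝ × ℝ × ℝ => q.1 ^ 3) =O[𝓝 0] fun q => ‖q‖ ^ 2 :=
  (isBigO_mul_of_isBigO_one fst_sq_isBigO_norm_sq
    (fst_isBigO_linSize.trans linSize_isBigO_one)).congr_left fun q => by ring

theorem ContDiffAt.isBigO_id_of_eq_zero {F : Type*} [NormedAddCommGroup F] [NormedSpace ℝ F]
    {ψ : ℝ → F} (h : ContDiffAt ℝ ω ψ 0) (h0 : ψ 0 = 0) : ψ =O[𝓝 0] fun t : ℝ => t := by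
  simpa [h0] using (h.differentiableAt (by simp)).isBigO_sub

theorem isBigO_pow_of_le {i j : ℕ} (h : i ≤ j) :
    (fun t : ℝ => t ^ j) =O[𝓝 0] fun t : ℝ => t ^ i := by
  obtain ⟨k, rfl⟩ := Nat.exists_eq_add_of_le h
  have h1 : (fun t : ℝ => t ^ k) =O[𝓝 0] fun _ => (1 : ℝ) :=
    (continuous_pow k).continuousAt.isBigO_one ℝ
  simpa [pow_add] using (isBigO_refl (fun t : ℝ => t ^ i) (𝓝 0)).mul h1

/-- The expansions of the bifurcation equations, as hypotheses on two functions. -/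
structure BifurcationExpansion (g₂ g₃ : ℝ × ℝ × ℝ → ℝ) : Prop where
  contDiff_two : ContDiffAt ℝ ω g₂ 0
  contDiff_three : ContDiffAt ℝ ω g₃ 0
  two : (fun q => g₂ q - (6 * q.2.2 - 7 * q.1 ^ 2 - 14 * q.2.1)) =O[𝓝 0] remSizeSq
  three : (fun q => g₃ q - (12 * q.2.2 - 14 * q.1 ^ 2 - q.2.1 + 108 * q.1 ^ 3))
    =O[𝓝 0] remSizeSq

namespace BifurcationExpansion

variable {g₂ g₃ : ℝ × ℝ × ℝ → ℝ}

theorem remSizeSq_zero : remSizeSq 0 = 0 := by simp [remSizeSq]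

theorem two_zero (h : BifurcationExpansion g₂ g₃) : g₂ 0 = 0 := by
  obtain ⟨K, hK⟩ := h.two.bound
  simpa [remSizeSq_zero] using hK.self_of_nhds

theorem three_zero (h : BifurcationExpansion g₂ g₃) : g₃ 0 = 0 := by
  obtain ⟨K, hK⟩ := h.three.bound
  simpa [remSizeSq_zero] using hK.self_of_nhds

/-- The branch with vanishing second mode. -/
theorem exists_first (h : BifurcationExpansion g₂ g₃) : ∃ Ω₁ : ℝ → ℝ, ContDiffAt ℝ ω Ω₁ 0 ∧
    Ω₁ 0 = 0 ∧ Ω₁ =O[𝓝 0] (fun s : ℝ => s) ∧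
    ∀ᶠ v : ℝ × ℝ in 𝓝 0, g₃ (0, v.1, v.2) = 0 ↔ Ω₁ v.1 = v.2 := by
  have hι : Tendsto (fun v : ℝ × ℝ => ((0 : ℝ), v)) (𝓝 0) (𝓝 0) :=
    (by fun_prop : Continuous fun v : ℝ × ℝ => ((0 : ℝ), v)).tendsto' _ _ rfl
  have hd : HasFDerivAt (fun v : ℝ × ℝ => g₃ (0, v.1, v.2) / 12)
      (.snd ℝ ℝ ℝ - (1 / 12 : ℝ) • .fst ℝ ℝ ℝ) 0 := by
    refine hasFDerivAt_zero_of_isBigO (by change g₃ 0 / 12 = 0; rw [h.three_zero, zero_div]) ?_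
    have := ((h.three.trans remSizeSq_isBigO_norm_sq).comp_tendsto hι).const_mul_left (1 / 12)
    refine (this.congr_left fun v => ?_).trans (isBigO_of_le _ fun v => ?_)
    · simp; ring
    · simp [Prod.norm_def]
  have hc : ContDiffAt ℝ ω (fun v : ℝ × ℝ => g₃ (0, v.1, v.2) / 12) 0 := by
    refine ContDiffAt.div_const ?_ 12
    exact ContDiffAt.comp (0 : ℝ × ℝ) (g := g₃) (f := fun v : ℝ × ℝ => ((0 : ℝ), v.1, v.2))
      h.contDiff_three (by fun_prop)
  obtain ⟨ψ, h1, h2, h3⟩ := exists_implicit_function hc (by change g₃ 0 / 12 = 0; rw [h.three_zero, zero_div]) hd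
    (by ext; simp)
  exact ⟨ψ, h1, h2, h1.isBigO_id_of_eq_zero h2, by simpa using h3⟩

/-- The branch with vanishing third mode. -/
theorem exists_second (h : BifurcationExpansion g₂ g₃) : ∃ Ω₂ : ℝ → ℝ, ContDiffAt ℝ ω Ω₂ 0 ∧
    Ω₂ 0 = 0 ∧ Ω₂ =O[𝓝 0] (fun ε : ℝ => ε ^ 2) ∧
    ∀ᶠ v : ℝ × ℝ in 𝓝 0, g₂ (v.1, 0, v.2) = 0 ↔ Ω₂ v.1 = v.2 := by
  have hι : Tendsto (fun v : ℝ × ℝ => (v.1, (0 : ℝ), v.2)) (𝓝 0) (𝓝 0) :=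
    (by fun_prop : Continuous fun v : ℝ × ℝ => (v.1, (0 : ℝ), v.2)).tendsto' _ _ rfl
  have hd : HasFDerivAt (fun v : ℝ × ℝ => g₂ (v.1, 0, v.2) / 6) (.snd ℝ ℝ ℝ) 0 := by
    refine hasFDerivAt_zero_of_isBigO (by change g₂ 0 / 6 = 0; rw [h.two_zero, zero_div]) ?_
    have := (((h.two.trans remSizeSq_isBigO_norm_sq).sub
      (fst_sq_isBigO_norm_sq.const_mul_left 7)).comp_tendsto hι).const_mul_left (1 / 6)
    refine (this.congr_left fun v => ?_).trans (isBigO_of_le _ fun v => ?_)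
    · simp; ring
    · simp [Prod.norm_def]
  have hc : ContDiffAt ℝ ω (fun v : ℝ × ℝ => g₂ (v.1, 0, v.2) / 6) 0 := by
    refine ContDiffAt.div_const ?_ 6
    exact ContDiffAt.comp (0 : ℝ × ℝ) (g := g₂) (f := fun v : ℝ × ℝ => (v.1, (0 : ℝ), v.2))
      h.contDiff_two (by fun_prop)
  obtain ⟨ψ, h1, h2, h3⟩ := exists_implicit_function hc (by change g₂ 0 / 6 = 0; rw [h.two_zero, zero_div]) hd
    (by ext; simp)
  have h4 := h1.isBigO_id_of_eq_zero h2
  have hψ : Tendsto (fun ε : ℝ => (ε, ψ ε)) (𝓝 0) (𝓝 0) := by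
    have := (continuousAt_id (x := (0 : ℝ))).prodMk h1.continuousAt
    simpa only [ContinuousAt, h2, id, Prod.mk_zero_zero] using this
  have h5 := h.two.comp_tendsto (hι.comp hψ)
  have h6 : (remSizeSq ∘ (fun v : ℝ × ℝ => (v.1, (0 : ℝ), v.2)) ∘ fun ε => (ε, ψ ε)) =O[𝓝 0]
      fun ε : ℝ => ε ^ 2 := by
    have e1 : (fun ε : ℝ => ψ ε ^ 2) =O[𝓝 0] fun ε : ℝ => ε ^ 2 := h4.pow 2
    have e2 : (fun ε : ℝ => ε ^ 4) =O[𝓝 0] fun ε : ℝ => ε ^ 2 := isBigO_pow_of_le (by norm_num)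
    refine (e2.add e1).congr_left fun ε => ?_
    simp [remSizeSq]
  refine ⟨ψ, h1, h2, ?_, by simpa using h3⟩
  refine (((h5.trans h6).const_mul_left (-1 / 6)).add
    ((isBigO_refl (fun ε : ℝ => ε ^ 2) _).const_mul_left (7 / 6))).congr' ?_ EventuallyEq.rfl
  filter_upwards [hψ.eventually h3] with ε hε
  have : g₂ (ε, 0, ψ ε) = 0 := by simpa using hε.2 rfl
  simp [this]; ring

/-- The branch with both modes present. -/
theorem exists_third (h : BifurcationExpansion g₂ g₃) : ∃ σ Ω₃ : ℝ → ℝ, ContDiffAt ℝ ω σ 0 ∧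
    ContDiffAt ℝ ω Ω₃ 0 ∧ σ 0 = 0 ∧ Ω₃ 0 = 0 ∧ Ω₃ =O[𝓝 0] (fun ε : ℝ => ε ^ 2) ∧
    (fun ε => σ ε + 4 * ε ^ 3) =O[𝓝 0] (fun ε : ℝ => ε ^ 4) ∧
    ∀ᶠ q : ℝ × ℝ × ℝ in 𝓝 0, (g₂ q = 0 ∧ g₃ q = 0) ↔ σ q.1 = q.2.1 ∧ Ω₃ q.1 = q.2.2 := by
  set f : ℝ × ℝ × ℝ → ℝ × ℝ := fun q => ((g₃ q - 2 * g₂ q) / 27, (14 * g₃ q - g₂ q) / 162) with hf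
  have f1 : (fun q => (f q).1 - (q.2.1 + 4 * q.1 ^ 3)) =O[𝓝 0] remSizeSq :=
    ((h.three.sub (h.two.const_mul_left 2)).const_mul_left (1 / 27)).congr_left fun q => by
      simp only [hf]; ring
  have f2 : (fun q => (f q).2 - (q.2.2 - 7 / 6 * q.1 ^ 2 + 28 / 3 * q.1 ^ 3)) =O[𝓝 0] remSizeSq :=
    (((h.three.const_mul_left 14).sub h.two).const_mul_left (1 / 162)).congr_left fun q => by
      simp only [hf]; ring
  have f0 : f 0 = 0 := by simp [hf, h.two_zero, h.three_zero]
  have hd : HasFDerivAt f (.snd ℝ ℝ (ℝ × ℝ)) 0 := by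
    refine hasFDerivAt_zero_of_isBigO f0 ?_
    have k1 := (f1.trans remSizeSq_isBigO_norm_sq).add (fst_cube_isBigO_norm_sq.const_mul_left 4)
    have k2 := ((f2.trans remSizeSq_isBigO_norm_sq).sub
      (fst_sq_isBigO_norm_sq.const_mul_left (7 / 6))).add
      (fst_cube_isBigO_norm_sq.const_mul_left (28 / 3))
    refine (k1.prod_left k2).congr_left fun q => ?_
    ext
    · simp; ring
    · simp; ring
  have hc : ContDiffAt ℝ ω f 0 := by
    have := h.contDiff_two
    have := h.contDiff_three
    simp only [hf]
    fun_prop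
  obtain ⟨ψ, h1, h2, h3⟩ := exists_implicit_function hc f0 hd (by ext <;> simp)
  have hψ : Tendsto (fun ε : ℝ => (ε, ψ ε)) (𝓝 0) (𝓝 0) := by
    have := (continuousAt_id (x := (0 : ℝ))).prodMk h1.continuousAt
    simpa only [ContinuousAt, h2, id, Prod.mk_zero_zero] using this
  have h4 := h1.isBigO_id_of_eq_zero h2
  have hev : ∀ᶠ ε in 𝓝 (0 : ℝ), f (ε, ψ ε) = 0 := by
    filter_upwards [hψ.eventually h3] with ε hε using hε.2 rfl
  set N : ℝ → ℝ := remSizeSq ∘ fun ε => (ε, ψ ε) with hN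
  have n1 : (fun ε => (ψ ε).1 + 4 * ε ^ 3) =O[𝓝 0] N := by
    refine ((f1.comp_tendsto hψ).const_mul_left (-1)).congr' ?_ EventuallyEq.rfl
    filter_upwards [hev] with ε hε
    simp [hε]
  have n2 : (fun ε => (ψ ε).2 - 7 / 6 * ε ^ 2 + 28 / 3 * ε ^ 3) =O[𝓝 0] N := by
    refine ((f2.comp_tendsto hψ).const_mul_left (-1)).congr' ?_ EventuallyEq.rfl
    filter_upwards [hev] with ε hε
    simp [hε]
  have hpow : ∀ {i j : ℕ}, i ≤ j → (fun ε : ℝ => ε ^ j) =O[𝓝 0] fun ε : ℝ => ε ^ i :=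
    fun hij => isBigO_pow_of_le hij
  have hNO : ∀ {i j k : ℕ}, (fun ε => (ψ ε).1) =O[𝓝 0] (fun ε : ℝ => ε ^ i) →
      (fun ε => (ψ ε).2) =O[𝓝 0] (fun ε : ℝ => ε ^ j) → k ≤ 4 → k ≤ i + 1 → k ≤ 2 * i →
      k ≤ 2 * j → N =O[𝓝 0] fun ε : ℝ => ε ^ k := by
    intro i j k hi hj k1 k2 k3 k4
    have e1 : (fun ε : ℝ => |ε * (ψ ε).1|) =O[𝓝 0] fun ε : ℝ => ε ^ k := by
      refine ((((isBigO_refl (fun ε : ℝ => ε) (𝓝 0)).mul hi).congr_right fun ε => ?_).trans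
        (hpow k2)).abs_left
      ring
    have e2 := ((hi.pow 2).congr_right fun ε => by rw [← pow_mul, mul_comm]).trans (hpow k3)
    have e3 := ((hj.pow 2).congr_right fun ε => by rw [← pow_mul, mul_comm]).trans (hpow k4)
    exact (((hpow k1).add e1).add e2).add e3
  have a1 : (fun ε => (ψ ε).1) =O[𝓝 0] (fun ε : ℝ => ε ^ 1) := by
    simpa using (isBigO_of_le _ fun ε => norm_fst_le (ψ ε)).trans h4
  have a2 : (fun ε => (ψ ε).2) =O[𝓝 0] (fun ε : ℝ => ε ^ 1) := by
    simpa using (isBigO_of_le _ fun ε => norm_snd_le (ψ ε)).trans h4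
  have hσ : ∀ {k : ℕ}, k ≤ 3 → N =O[𝓝 0] (fun ε : ℝ => ε ^ k) →
      (fun ε => (ψ ε).1) =O[𝓝 0] (fun ε : ℝ => ε ^ k) := fun hk hNk =>
    ((n1.trans hNk).sub ((hpow hk).const_mul_left 4)).congr_left fun ε => by ring
  have b0 := hNO (k := 2) a1 a2 (by norm_num) (by norm_num) (by norm_num) (by norm_num)
  have b1 := hσ (by norm_num) b0
  have b2 : (fun ε => (ψ ε).2) =O[𝓝 0] (fun ε : ℝ => ε ^ 2) :=
    (((n2.trans b0).add ((hpow le_rfl).const_mul_left (7 / 6))).sub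
      ((hpow (by norm_num : 2 ≤ 3)).const_mul_left (28 / 3))).congr_left fun ε => by ring
  have c1 := hσ le_rfl (hNO (k := 3) b1 b2 (by norm_num) (by norm_num) (by norm_num) (by norm_num))
  have d0 := hNO (k := 4) c1 b2 (by norm_num) (by norm_num) (by norm_num) (by norm_num)
  refine ⟨fun ε => (ψ ε).1, fun ε => (ψ ε).2, h1.fst, h1.snd, by simp [h2], by simp [h2], b2,
    n1.trans d0, ?_⟩
  filter_upwards [h3] with q hq
  rw [Prod.ext_iff] at hq
  rw [← Prod.ext_iff] at hq
  have e : f q = 0 ↔ g₂ q = 0 ∧ g₃ q = 0 := by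
    simp only [hf, Prod.mk_eq_zero]
    constructor
    · rintro ⟨k1, k2⟩; constructor <;> linarith
    · rintro ⟨k1, k2⟩; simp [k1, k2]
  rw [← e, hq, Prod.ext_iff]

end BifurcationExpansion

theorem abs_wt_mul_le {w : ℝ} (hw : |w - 1 / 6| < 1 / 12) (n : ℕ) :
    wt n ≤ 48 * |((n : ℝ) + 1) * (1 - n * w)| + 625 := by
  rw [abs_lt] at hw
  rcases lt_or_ge n 24 with h | h
  · have h1 : (n : ℝ) ≤ 24 := by exact_mod_cast h.le
    have h0 : (0 : ℝ) ≤ n := n.cast_nonneg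
    have : wt n ≤ 625 := by unfold wt; nlinarith
    linarith [abs_nonneg (((n : ℝ) + 1) * (1 - n * w))]
  · have h1 : (24 : ℝ) ≤ n := by exact_mod_cast h
    have h2 : (n : ℝ) * (1 / 12) ≤ n * w := by gcongr; linarith [hw.1]
    have h3 : (n : ℝ) / 24 ≤ n * w - 1 := by linarith
    have h4 : ((n : ℝ) + 1) * (n / 24) ≤ |((n : ℝ) + 1) * (1 - n * w)| := by
      rw [abs_mul, abs_of_pos (by positivity : (0 : ℝ) < (n : ℝ) + 1), abs_sub_comm]
      gcongr
      exact h3.trans (le_abs_self _)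
    unfold wt
    nlinarith

theorem exists_unweight_eq {w : ℝ} {A : RealEll2} (h : IsRealStationaryState 1 w A)
    (hw : |w - 1 / 6| < 1 / 12) : ∃ y : RealEll2, unweight y = A := by
  have h1 : Memℓp (fun n => wt n * A n) 2 := by
    have h2 : Memℓp (fun n : ℕ => 48 * ‖((n : ℝ) + 1) * (1 - n * w) * A n‖ + 625 * ‖A n‖) 2 :=
      (h.square_summable.norm.const_mul 48).add ((lp.memℓp A).norm.const_mul 625)
    refine h2.mono' fun n => ?_
    rw [norm_mul, norm_mul, Real.norm_of_nonneg (wt_pos n).le, Real.norm_eq_abs, ← mul_assoc,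
      ← add_mul, Real.norm_of_nonneg (by positivity)]
    exact mul_le_mul_of_nonneg_right (abs_wt_mul_le hw n) (abs_nonneg _)
  refine ⟨⟨_, h1⟩, ?_⟩
  ext n
  exact inv_mul_cancel_left₀ (wt_pos n).ne' (A n)

theorem norm_kernelProj_le (v : RealEll2) : ‖kernelProj v‖ ≤ 16 * ‖unweight v‖ := by
  have hb : ∀ n, |if n = 2 ∨ n = 3 then wt n else 0| ≤ 16 := fun n => by
    split_ifs with h
    · rcases h with rfl | rfl <;> norm_num [wt]
    · norm_num
  have : kernelProj v = diagOp (fun n => if n = 2 ∨ n = 3 then wt n else 0) 16 hb (unweight v) := by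
    ext n
    have := (wt_pos n).ne'
    simp only [kernelProj, diagOp_apply, unweight_apply]
    split_ifs
    · field_simp
    · simp
  rw [this]
  exact norm_diagOp_le _ _ _ _

theorem norm_single_zero : ‖(lp.single 2 0 (1 : ℝ) : RealEll2)‖ = 1 := by
  rw [lp.norm_single (by norm_num), norm_one]

theorem norm_cubicQuad_single_zero_le (v : RealEll2) :
    ‖cubicQuad (triOp fullSet) (lp.single 2 0 (1 : ℝ)) v‖ ≤ 36 * ‖unweight v‖ * ‖v‖ := by
  have h0 := norm_single_zero
  have hJ := norm_unweight_le (lp.single 2 0 (1 : ℝ))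
  rw [h0] at hJ
  have hd := norm_unweight_le v
  have hd0 := norm_nonneg (unweight v)
  have hJ0 := norm_nonneg (unweight (lp.single 2 0 (1 : ℝ)))
  have t1 := norm_triFun_le fullSet v v (lp.single 2 0 (1 : ℝ))
  have t2 := norm_triFun_le fullSet v (lp.single 2 0 (1 : ℝ)) v
  have t3 := norm_triFun_le fullSet (lp.single 2 0 (1 : ℝ)) v v
  rw [h0] at t1 t2 t3
  have k1 : ‖v‖ * ‖unweight v‖ * ‖unweight (lp.single 2 0 (1 : ℝ))‖ ≤ ‖v‖ * ‖unweight v‖ :=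
    mul_le_of_le_one_right (by positivity) hJ
  have k2 : ‖unweight v‖ * ‖unweight v‖ ≤ ‖v‖ * ‖unweight v‖ := by gcongr
  rw [cubicQuad]
  refine (norm_add₃_le).trans ?_
  rw [triOp_apply, triOp_apply, triOp_apply]
  nlinarith

theorem pseudoInv_eq_zero {x : RealEll2} (h : ∀ n, n ≠ 2 → n ≠ 3 → x n = 0) : pseudoInv x = 0 := by
  ext n
  by_cases hn : n = 2 ∨ n = 3
  · simp [pseudoInv, pseudoInvCoeff, hn]
  · push Not at hn
    simp [pseudoInv, h n hn.1 hn.2]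

theorem modeOp_single_zero : modeOp (lp.single 2 0 (1 : ℝ)) = 0 := by
  ext n
  rw [modeOp, diagOp_apply, lp.single_apply]
  by_cases h : n = 0
  · simp [h]
  · simp [h]

theorem norm_modeOp_le (v : RealEll2) : ‖modeOp v‖ ≤ ‖v‖ := by
  simpa only [one_mul, modeOp] using norm_diagOp_le _ 1 abs_mul_succ_div_wt_le v

theorem norm_pseudoInv_le (v : RealEll2) : ‖pseudoInv v‖ ≤ 75 * ‖v‖ := norm_diagOp_le _ _ _ v

theorem norm_sub_single_zero_le {Ω : ℝ} {y : RealEll2} (hy : ∀ n, fullResidual Ω y n = 0)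
    (hΩ : |Ω| < 1 / 10000) (hd : ‖unweight (y - lp.single 2 0 (1 : ℝ))‖ < 1 / 10000) :
    ‖y - lp.single 2 0 (1 : ℝ)‖ ≤ 32 * ‖unweight (y - lp.single 2 0 (1 : ℝ))‖ := by
  obtain ⟨v, rfl⟩ : ∃ v, y = lp.single 2 0 (1 : ℝ) + v := ⟨y - lp.single 2 0 (1 : ℝ), by abel⟩
  rw [add_sub_cancel_left] at hd ⊢
  have h1 := pseudoInv_eq_zero fun n _ _ => hy n
  have hχ : ContainsTrivial fullSet := fun n => ⟨rfl, rfl⟩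
  have h2 := pseudoInv_linear_part hχ v
  have h3 : v = kernelProj v - pseudoInv (cubicQuad (triOp fullSet) (lp.single 2 0 (1 : ℝ)) v +
      triOp fullSet v v v + Ω • modeOp v) := by
    have e : fullResidual Ω (lp.single 2 0 (1 : ℝ) + v) =
        (cubicVar (triOp fullSet) (lp.single 2 0 (1 : ℝ)) v - lamOp v) +
        (cubicQuad (triOp fullSet) (lp.single 2 0 (1 : ℝ)) v + triOp fullSet v v v +
          Ω • modeOp v) := by
      rw [fullResidual_eq, cubic_add, triOp_single_zero hχ, map_add lamOp, map_add modeOp,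
        modeOp_single_zero, zero_add]
      abel
    rw [e, map_add] at h1
    rw [← cubicVar] at h2
    rw [← eq_neg_iff_add_eq_zero] at h1
    rw [h1] at h2
    nth_rw 1 [← h2]
    abel
  have k1 := norm_kernelProj_le v
  have k2 := norm_cubicQuad_single_zero_le v
  have k3 := norm_triFun_le fullSet v v v
  rw [← triOp_apply] at k3
  have k4 := norm_modeOp_le v
  have hd0 := norm_nonneg (unweight v)
  have hv0 := norm_nonneg v
  have k5 : ‖pseudoInv (cubicQuad (triOp fullSet) (lp.single 2 0 (1 : ℝ)) v +
      triOp fullSet v v v + Ω • modeOp v)‖ ≤ 75 * (36 * ‖unweight v‖ * ‖v‖ +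
      ‖triOp fullSet v v v‖ + |Ω| * ‖v‖) := by
    refine (norm_pseudoInv_le _).trans ?_
    gcongr
    refine norm_add₃_le.trans ?_
    rw [norm_smul, Real.norm_eq_abs]
    gcongr
  have k6 : ‖triOp fullSet v v v‖ ≤ 12 * (1 / 10000) * ‖v‖ := by
    refine k3.trans ?_
    have : ‖unweight v‖ * ‖unweight v‖ * ‖v‖ ≤ 1 / 10000 * 1 * ‖v‖ := by
      gcongr; linarith
    nlinarith
  have k7 : 36 * ‖unweight v‖ * ‖v‖ ≤ 36 * (1 / 10000) * ‖v‖ := by gcongr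
  have k8 : |Ω| * ‖v‖ ≤ 1 / 10000 * ‖v‖ := by gcongr
  have k9 : ‖v‖ ≤ ‖kernelProj v‖ + _ := (congrArg norm h3).le.trans (norm_sub_le _ _)
  linarith

/-- Stationary states near the lowest mode are regular, with a quantitative bound. -/
theorem exists_regular_of_isRealStationaryState {w : ℝ} {A : RealEll2}
    (h : IsRealStationaryState 1 w A) (hw : |w - 1 / 6| < 1 / 10000)
    (hA : ‖A - mode 0‖ < 1 / 10000) : ∃ y : RealEll2, unweight y = A ∧
      (∀ n, fullResidual (w - 1 / 6) y n = 0) ∧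
      ‖y - lp.single 2 0 (1 : ℝ)‖ ≤ 32 * ‖A - mode 0‖ := by
  obtain ⟨y, rfl⟩ := exists_unweight_eq h (hw.trans (by norm_num))
  have h1 : ∀ n, fullResidual (w - 1 / 6) y n = 0 := by
    rw [← isRealStationaryState_unweight_iff]; simpa using h
  have h2 : unweight (lp.single 2 0 (1 : ℝ)) = mode 0 := by
    ext n
    rw [unweight_single_zero_apply, mode, lp.single_apply]
    by_cases hn : n = 0
    · simp [hn]
    · simp [hn]
  have h3 : unweight y - mode 0 = unweight (y - lp.single 2 0 (1 : ℝ)) := by rw [map_sub, h2]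
  rw [h3] at hA ⊢
  exact ⟨y, rfl, h1, norm_sub_single_zero_le h1 hw hA⟩

theorem mode_apply (k n : ℕ) : mode k n = if n = k then 1 else 0 := by
  rw [mode, lp.single_apply]
  by_cases h : n = k
  · subst h; simp
  · simp [h]

theorem unweight_scaleOp_approxSol_sub_le {ε μ : ℝ} (hε : |ε| ≤ 1) (n : ℕ) :
    |unweight (scaleOp ε μ (approxSol ε)) n - mode 0 n - ε * mode 2 n - μ * mode 3 n| ≤
      60 * (ε ^ 2 + μ ^ 2) := by
  have e : unweight (scaleOp ε μ (approxSol ε)) n = ε ^ degTwo n * μ ^ degThree n *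
      ((trunc baseSeq n : ℤ) + ε * (trunc firstSeq n : ℤ)) := by
    have := (wt_pos n).ne'
    rw [unweight_apply, scaleOp_apply, approxSol, ell2_add_apply, ell2_smul_apply, intVec_apply,
      intVec_apply]
    field_simp
  rw [e]
  simp only [mode_apply]
  have h1 : |ε * μ| ≤ (ε ^ 2 + μ ^ 2) / 2 := by
    rw [abs_le]; constructor <;> nlinarith [sq_nonneg (ε - μ), sq_nonneg (ε + μ)]
  have h2 : |ε * μ * ε| ≤ (ε ^ 2 + μ ^ 2) / 2 := by
    rw [abs_mul]
    exact (mul_le_of_le_one_right (abs_nonneg _) hε).trans h1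
  have h3 := sq_nonneg μ
  have h4 := sq_nonneg ε
  rw [abs_le] at h1 h2
  rcases lt_or_ge n 16 with hn | hn
  · interval_cases n <;> simp [trunc, baseSeq, firstSeq, degTwo, degThree, -abs_mul] <;>
      first | positivity | (rw [abs_le]; constructor <;> nlinarith)
  · have : n ≠ 0 ∧ n ≠ 2 ∧ n ≠ 3 ∧ ¬ n < 16 := by omega
    simp [trunc, this]
    positivity

theorem abs_unweight_scaleOp_le {ε μ : ℝ} (hε : |ε| ≤ 1) (hμ : |μ| ≤ 1) (x : RealEll2) (n : ℕ) :
    |unweight (scaleOp ε μ x) n| ≤ ‖x‖ := by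
  rw [unweight_apply, scaleOp_apply, abs_mul, abs_mul, abs_mul, abs_pow, abs_pow,
    abs_of_pos (inv_pos.2 (wt_pos n))]
  have h1 : (wt n)⁻¹ ≤ 1 := inv_le_one_of_one_le₀ (one_le_wt n)
  have h2 : |ε| ^ degTwo n ≤ 1 := pow_le_one₀ (abs_nonneg _) hε
  have h3 : |μ| ^ degThree n ≤ 1 := pow_le_one₀ (abs_nonneg _) hμ
  have h4 : |x n| ≤ ‖x‖ := lp.norm_apply_le_norm (by norm_num) x n
  have h5 := (inv_pos.2 (wt_pos n)).le
  calc (wt n)⁻¹ * (|ε| ^ degTwo n * |μ| ^ degThree n * |x n|) ≤ 1 * (1 * 1 * ‖x‖) := by gcongr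
    _ = ‖x‖ := by ring

theorem unweight_scaleOp_sub_le {ε μ : ℝ} (hε : |ε| ≤ 1) (hμ : |μ| ≤ 1) (x : RealEll2) (n : ℕ) :
    |unweight (scaleOp ε μ x) n - mode 0 n - ε * mode 2 n - μ * mode 3 n| ≤
      60 * (ε ^ 2 + μ ^ 2) + ‖x - approxSol ε‖ := by
  have h1 := unweight_scaleOp_approxSol_sub_le (μ := μ) hε n
  have h2 := abs_unweight_scaleOp_le hε hμ (x - approxSol ε) n
  rw [map_sub, map_sub, ell2_sub_apply] at h2
  have e : unweight (scaleOp ε μ x) n - mode 0 n - ε * mode 2 n - μ * mode 3 n =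
      (unweight (scaleOp ε μ (approxSol ε)) n - mode 0 n - ε * mode 2 n - μ * mode 3 n) +
      (unweight (scaleOp ε μ x) n - unweight (scaleOp ε μ (approxSol ε)) n) := by ring
  rw [e]
  exact (abs_add_le _ _).trans (add_le_add h1 h2)

/-- The branch of states given by the scaled solution `c` along the parameters `Q`. -/
def branchMap (c : ℝ × ℝ × ℝ → RealEll2) (a b : ℝ × ℝ → ℝ) (Q : ℝ × ℝ → ℝ × ℝ × ℝ) (p : ℝ × ℝ) :
    ℝ × RealEll2 :=
  (1 / 6 + (Q p).2.2, unweight (scaleOp (a p) (b p) (c (Q p))) +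
    ((p.1 - a p) • mode 2 + (p.2 - b p) • mode 3))

theorem contDiffAt_branch_of_contDiff {E F : Type*} [NormedAddCommGroup E] [NormedSpace ℝ E]
    [NormedAddCommGroup F] [NormedSpace ℝ F] {S : ℝ → ℝ → E →L[ℝ] E} {c : F → E}
    {a b w : ℝ × ℝ → ℝ} {Q : ℝ × ℝ → F} (hS : ContDiff ℝ ω fun v : ℝ × ℝ => S v.1 v.2)
    (hc : ContDiffAt ℝ ω c 0) (ha : ContDiffAt ℝ ω a 0) (hb : ContDiffAt ℝ ω b 0)
    (hw : ContDiffAt ℝ ω w 0) (hQ : ContDiffAt ℝ ω Q 0) (hQ0 : Q 0 = 0) (U : E →L[ℝ] E)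
    (u v : E) : ContDiffAt ℝ ω (fun p => (1 / 6 + w p, U (S (a p) (b p) (c (Q p))) +
      ((p.1 - a p) • u + (p.2 - b p) • v))) 0 := by
  have h1 : ContDiffAt ℝ ω (fun p => S (a p) (b p)) 0 :=
    hS.contDiffAt.comp (0 : ℝ × ℝ) (ha.prodMk hb)
  have h2 : ContDiffAt ℝ ω (fun p => c (Q p)) 0 :=
    ContDiffAt.comp (0 : ℝ × ℝ) (by rwa [hQ0]) hQ
  have h3 : ContDiffAt ℝ ω (fun p => U (S (a p) (b p) (c (Q p)))) 0 :=
    U.contDiff.contDiffAt.comp (0 : ℝ × ℝ) (h1.clm_apply h2)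
  exact (contDiffAt_const.add hw).prodMk (h3.add (by fun_prop))

theorem contDiffAt_branchMap {c : ℝ × ℝ × ℝ → RealEll2} {a b : ℝ × ℝ → ℝ}
    {Q : ℝ × ℝ → ℝ × ℝ × ℝ} (hc : ContDiffAt ℝ ω c 0) (ha : ContDiffAt ℝ ω a 0)
    (hb : ContDiffAt ℝ ω b 0) (hQ : ContDiffAt ℝ ω Q 0) (hQ0 : Q 0 = 0) :
    ContDiffAt ℝ ω (branchMap c a b Q) 0 :=
  contDiffAt_branch_of_contDiff contDiff_scaleOp hc ha hb hQ.snd.snd hQ hQ0 _ _ _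

theorem branchMap_eventually {c : ℝ × ℝ × ℝ → RealEll2} {a b : ℝ × ℝ → ℝ}
    {Q : ℝ × ℝ → ℝ × ℝ × ℝ} (hc : ContDiffAt ℝ ω c 0)
    (hc2 : ∀ᶠ q in 𝓝 0, c q 2 = 9 ∧ c q 3 = 16 ∧
      ∀ n, n ≠ 2 → n ≠ 3 → scaledResidual q (c q) n = 0)
    (hcO : (fun q => c q - approxSol q.1) =O[𝓝 0] remSize) (ha : ContDiffAt ℝ ω a 0)
    (hb : ContDiffAt ℝ ω b 0) (hQ : ContDiffAt ℝ ω Q 0) (hQ0 : Q 0 = 0)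
    (hQ1 : ∀ p, (Q p).1 = a p) (ha1 : ∀ p, a p = p.1 ∨ a p = 0) (hb1 : ∀ p, b p = p.2 ∨ b p = 0)
    (h21 : (fun p => (Q p).2.1) =O[𝓝 0] fun p : ℝ × ℝ => p.1 ^ 2 + p.2 ^ 2)
    (h22 : (fun p => (Q p).2.2) =O[𝓝 0] fun p : ℝ × ℝ => p.1 ^ 2 + p.2 ^ 2) :
    ∃ C > (0 : ℝ), ∀ᶠ p in 𝓝 (0 : ℝ × ℝ), ContDiffAt ℝ ω (branchMap c a b Q) p ∧
      (branchMap c a b Q p).2 2 = p.1 ∧ (branchMap c a b Q p).2 3 = p.2 ∧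
      |(branchMap c a b Q p).1 - 1 / 6| + (⨆ n : ℕ, |(branchMap c a b Q p).2 n - mode 0 n -
        p.1 * mode 2 n - p.2 * mode 3 n|) ≤ C * (p.1 ^ 2 + p.2 ^ 2) := by
  have hQt : Tendsto Q (𝓝 0) (𝓝 0) := by
    simpa only [ContinuousAt, hQ0] using hQ.continuousAt
  have ha2 : ∀ p, a p ^ 2 ≤ p.1 ^ 2 := fun p => by
    rcases ha1 p with h | h <;> rw [h]
    simpa using sq_nonneg p.1
  have hb2 : ∀ p, b p ^ 2 ≤ p.2 ^ 2 := fun p => by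
    rcases hb1 p with h | h <;> rw [h]
    simpa using sq_nonneg p.2
  have hR : (fun p => c (Q p) - approxSol (a p)) =O[𝓝 0]
      fun p : ℝ × ℝ => p.1 ^ 2 + p.2 ^ 2 := by
    have h1 := hcO.comp_tendsto hQt
    have h2 : (fun p => (Q p).1 ^ 2) =O[𝓝 0] fun p : ℝ × ℝ => p.1 ^ 2 + p.2 ^ 2 :=
      isBigO_of_le _ fun p => by
        rw [hQ1, Real.norm_of_nonneg (by positivity), Real.norm_of_nonneg (by positivity)]
        linarith [ha2 p, sq_nonneg p.2]
    refine (h1.trans ((h2.add h21.abs_left).add h22.abs_left)).congr_left fun p => ?_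
    simp only [Function.comp_apply, hQ1]
  obtain ⟨K₁, hK₁, hR⟩ := hR.exists_pos
  obtain ⟨K₂, hK₂, hΩ⟩ := h22.exists_pos
  refine ⟨60 + K₁ + K₂, by positivity, ?_⟩
  filter_upwards [(contDiffAt_branchMap hc ha hb hQ hQ0).eventually (by simp),
    hQt.eventually hc2, hR.bound, hΩ.bound, Metric.ball_mem_nhds (0 : ℝ × ℝ) one_pos]
    with p h1 h2 h3 h4 h5
  have hN : 0 ≤ p.1 ^ 2 + p.2 ^ 2 := by positivity
  rw [mem_ball_zero_iff, Prod.norm_def, max_lt_iff] at h5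
  have ha3 : |a p| ≤ 1 := by
    rcases ha1 p with h | h <;> rw [h]
    · exact h5.1.le
    · simp
  have hb3 : |b p| ≤ 1 := by
    rcases hb1 p with h | h <;> rw [h]
    · exact h5.2.le
    · simp
  have hA : ∀ n, (branchMap c a b Q p).2 n = unweight (scaleOp (a p) (b p) (c (Q p))) n +
      ((p.1 - a p) * mode 2 n + (p.2 - b p) * mode 3 n) := fun n => by
    simp only [branchMap, ell2_add_apply, ell2_smul_apply]
  refine ⟨h1, ?_, ?_, ?_⟩
  · rw [hA, unweight_apply, scaleOp_apply, h2.1]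
    norm_num [mode_apply, degTwo, degThree, wt]
    ring
  · rw [hA, unweight_apply, scaleOp_apply, h2.2.1]
    norm_num [mode_apply, degTwo, degThree, wt]
    ring
  · rw [Real.norm_of_nonneg hN] at h3 h4
    have k1 : |(branchMap c a b Q p).1 - 1 / 6| ≤ K₂ * (p.1 ^ 2 + p.2 ^ 2) := by
      simpa [branchMap] using h4
    have k2 : (⨆ n : ℕ, |(branchMap c a b Q p).2 n - mode 0 n - p.1 * mode 2 n -
        p.2 * mode 3 n|) ≤ (60 + K₁) * (p.1 ^ 2 + p.2 ^ 2) := by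
      refine ciSup_le fun n => ?_
      have k3 := unweight_scaleOp_sub_le ha3 hb3 (c (Q p)) n
      rw [hA]
      have e : unweight (scaleOp (a p) (b p) (c (Q p))) n + ((p.1 - a p) * mode 2 n +
          (p.2 - b p) * mode 3 n) - mode 0 n - p.1 * mode 2 n - p.2 * mode 3 n =
          unweight (scaleOp (a p) (b p) (c (Q p))) n - mode 0 n - a p * mode 2 n -
            b p * mode 3 n := by ring
      rw [e]
      linarith [ha2 p, hb2 p]
    linarith

theorem isRealStationaryState_of_scaledResidual {ε μ Ω : ℝ} {y : RealEll2}
    (h : ∀ n, n ≠ 2 → n ≠ 3 → scaledResidual (ε, μ ^ 2, Ω) y n = 0)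
    (h2 : ε = 0 ∨ scaledResidual (ε, μ ^ 2, Ω) y 2 = 0)
    (h3 : μ = 0 ∨ scaledResidual (ε, μ ^ 2, Ω) y 3 = 0) :
    IsRealStationaryState 1 (1 / 6 + Ω) (unweight (scaleOp ε μ y)) := by
  rw [isRealStationaryState_unweight_iff]
  intro n
  rw [fullResidual_scaleOp, scaleOp_apply]
  by_cases hn2 : n = 2
  · subst hn2; rcases h2 with h | h <;> simp [h, degTwo]
  by_cases hn3 : n = 3
  · subst hn3; rcases h3 with h | h <;> simp [h, degThree]
  rw [h n hn2 hn3, mul_zero]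

theorem reflection_unweight_scaleOp (ε μ : ℝ) (y : RealEll2) :
    reflection (unweight (scaleOp ε μ y)) = unweight (scaleOp ε (-μ) y) := by
  ext n
  change (-1 : ℝ) ^ n * unweight (scaleOp ε μ y) n = _
  rw [unweight_apply, unweight_apply, scaleOp_apply, scaleOp_apply, degThree]
  rcases Nat.mod_two_eq_zero_or_one n with h | h
  · rw [h, (Nat.even_iff.2 h).neg_one_pow]; simp
  · rw [h, (Nat.odd_iff.2 h).neg_one_pow]; ring

theorem abs_sqrt_sub_sqrt_le {a b : ℝ} (ha : 0 ≤ a) (hb : 0 ≤ b) :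
    |√a - √b| ≤ √|a - b| := by
  refine Real.le_sqrt_of_sq_le ?_
  rw [sq_abs]
  have h1 := Real.sq_sqrt ha
  have h2 := Real.sq_sqrt hb
  have h3 := Real.sqrt_nonneg a
  have h4 := Real.sqrt_nonneg b
  rcases le_total (√a) (√b) with h | h
  · refine le_trans ?_ (neg_le_abs _)
    nlinarith
  · refine le_trans ?_ (le_abs_self _)
    nlinarith

theorem sqrt_four_mul_cube {t : ℝ} (ht : 0 ≤ t) : √(4 * t ^ 3) = 2 * t ^ (3 / 2 : ℝ) := by
  rw [Real.sqrt_eq_iff_mul_self_eq (by positivity) (by positivity)]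
  have : t ^ (3 / 2 : ℝ) * t ^ (3 / 2 : ℝ) = t ^ 3 := by
    rw [← Real.rpow_add_of_nonneg ht (by norm_num) (by norm_num)]
    norm_num
  linear_combination (-4) * this

theorem abs_apply_le_norm_sub_mode (A : RealEll2) {n : ℕ} (hn : n ≠ 0) :
    |A n| ≤ ‖A - mode 0‖ := by
  have := lp.norm_apply_le_norm (by norm_num) (A - mode 0) n
  rwa [ell2_sub_apply, mode_apply, if_neg hn, sub_zero] at this

theorem unweight_eq_apply {y A : RealEll2} (h : unweight y = A) (n : ℕ) : y n = wt n * A n := by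
  rw [← h, unweight_apply, mul_inv_cancel_left₀ (wt_pos n).ne']

theorem fullResidual_single_zero (Ω : ℝ) (n : ℕ) :
    fullResidual Ω (lp.single 2 0 (1 : ℝ)) n = 0 := by
  rw [fullResidual_eq, triOp_single_zero fun n => ⟨rfl, rfl⟩, modeOp_single_zero]
  simp

theorem unweight_single_zero : unweight (lp.single 2 0 (1 : ℝ)) = mode 0 := by
  ext n
  rw [unweight_single_zero_apply, mode_apply]

theorem tendsto_scaleOp_solution {c : ℝ × ℝ × ℝ → RealEll2} (hc : ContDiffAt ℝ ω c 0)
    (hcO : (fun q => c q - approxSol q.1) =O[𝓝 0] remSize) :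
    Tendsto (fun t : ℝ × ℝ × ℝ => scaleOp t.1 t.2.1 (c (t.1, t.2.1 ^ 2, t.2.2))) (𝓝 0)
      (𝓝 (lp.single 2 0 (1 : ℝ))) := by
  have h0 : c 0 = approxSol 0 := by
    obtain ⟨K, hK⟩ := hcO.bound
    have := hK.self_of_nhds
    simp only [remSize] at this
    simpa [sub_eq_zero] using this
  have h1 : Tendsto (fun t : ℝ × ℝ × ℝ => (t.1, t.2.1 ^ 2, t.2.2)) (𝓝 0) (𝓝 0) :=
    (by fun_prop : Continuous fun t : ℝ × ℝ × ℝ => (t.1, t.2.1 ^ 2, t.2.2)).tendsto' _ _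
      (by simp)
  have h2 : Tendsto (fun t : ℝ × ℝ × ℝ => scaleOp t.1 t.2.1) (𝓝 0) (𝓝 (scaleOp 0 0)) :=
    (contDiff_scaleOp.continuous.comp
      (by fun_prop : Continuous fun t : ℝ × ℝ × ℝ => (t.1, t.2.1))).tendsto' _ _ rfl
  have h3 : Tendsto (fun t : ℝ × ℝ × ℝ => c (t.1, t.2.1 ^ 2, t.2.2)) (𝓝 0) (𝓝 (approxSol 0)) := by
    rw [← h0]
    exact hc.continuousAt.tendsto.comp h1
  rw [← scaleOp_zero_approxSol]
  have h4 : Continuous fun v : (RealEll2 →L[ℝ] RealEll2) × RealEll2 => v.1 v.2 :=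
    isBoundedBilinearMap_apply.continuous
  exact (h4.tendsto (scaleOp 0 0, approxSol 0)).comp (h2.prodMk_nhds h3)

theorem exists_uniqueness_radius {c : ℝ × ℝ × ℝ → RealEll2} (hc : ContDiffAt ℝ ω c 0)
    (hc2 : ∀ᶠ q in 𝓝 0, c q 2 = 9 ∧ c q 3 = 16 ∧
      ∀ n, n ≠ 2 → n ≠ 3 → scaledResidual q (c q) n = 0)
    (hcO : (fun q => c q - approxSol q.1) =O[𝓝 0] remSize) {P : ℝ × ℝ × ℝ → Prop}
    (hP : ∀ᶠ t in 𝓝 0, P t) :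
    ∃ η > (0 : ℝ), ∀ (w : ℝ) (A : RealEll2), IsRealStationaryState 1 w A → |w - 1 / 6| < η →
      ‖A - mode 0‖ < η → P (A 2, A 3, w - 1 / 6) ∧
      A = unweight (scaleOp (A 2) (A 3) (c (A 2, A 3 ^ 2, w - 1 / 6))) ∧
      (A 2 = 0 ∨ scaledResidual (A 2, A 3 ^ 2, w - 1 / 6) (c (A 2, A 3 ^ 2, w - 1 / 6)) 2 = 0) ∧
      (A 3 = 0 ∨ scaledResidual (A 2, A 3 ^ 2, w - 1 / 6) (c (A 2, A 3 ^ 2, w - 1 / 6)) 3 = 0) ∧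
      (A 2 = 0 → A 3 = 0 → A = mode 0) := by
  obtain ⟨r, hr, huniq⟩ := eq_of_fullResidual_eq_zero
  have h1 : Tendsto (fun t : ℝ × ℝ × ℝ => (t.1, t.2.1 ^ 2, t.2.2)) (𝓝 0) (𝓝 0) :=
    (by fun_prop : Continuous fun t : ℝ × ℝ × ℝ => (t.1, t.2.1 ^ 2, t.2.2)).tendsto' _ _
      (by simp)
  have h2 := (tendsto_scaleOp_solution hc hcO).eventually (Metric.ball_mem_nhds _ hr)
  obtain ⟨ρ, hρ, hball⟩ := Metric.eventually_nhds_iff.1 ((hP.and h2).and (h1.eventually hc2))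
  refine ⟨min (min ρ (1 / 10000)) (r / 32), by positivity, fun w A hs hw hA => ?_⟩
  have hA2 := (abs_apply_le_norm_sub_mode A two_ne_zero).trans_lt hA
  have hA3 := (abs_apply_le_norm_sub_mode A three_ne_zero).trans_lt hA
  rw [lt_min_iff, lt_min_iff] at hw hA hA2 hA3
  have hrw : |w - 1 / 6| < r := by linarith [hw.2]
  obtain ⟨y, hyA, hy, hyn⟩ := exists_regular_of_isRealStationaryState hs hw.1.2 hA.1.2
  have hyr : ‖y - lp.single 2 0 (1 : ℝ)‖ < r := by linarith [hA.2]
  obtain ⟨⟨hPt, hclose⟩, hc2', hc3', hce⟩ := @hball (A 2, A 3, w - 1 / 6) (by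
    rw [dist_zero_right, Prod.norm_def, Prod.norm_def]
    exact max_lt hA2.1.1 (max_lt hA3.1.1 hw.1.1))
  dsimp only at hclose hc2' hc3' hce
  rw [dist_eq_norm] at hclose
  set ε := A 2
  set μ := A 3
  set Ω := w - 1 / 6
  set x := c (ε, μ ^ 2, Ω)
  have hfull : ∀ n, fullResidual Ω (scaleOp ε μ x) n =
      ε ^ degTwo n * μ ^ degThree n * scaledResidual (ε, μ ^ 2, Ω) x n := fun n => by
    rw [fullResidual_scaleOp, scaleOp_apply]
  have hy2 : y 2 = 9 * ε := by rw [unweight_eq_apply hyA]; norm_num [wt, ε]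
  have hy3 : y 3 = 16 * μ := by rw [unweight_eq_apply hyA]; norm_num [wt, μ]
  have hyx : y = scaleOp ε μ x := by
    refine huniq Ω y _ hrw hyr hclose ?_ ?_ (fun n _ _ => hy n) fun n hn2 hn3 => ?_
    · rw [hy2, scaleOp_apply, hc2']; norm_num [degTwo, degThree]; ring
    · rw [hy3, scaleOp_apply, hc3']; norm_num [degTwo, degThree]; ring
    · rw [hfull, hce n hn2 hn3, mul_zero]
  refine ⟨hPt, by rw [← hyx, hyA], ?_, ?_, fun h2 h3 => ?_⟩
  · have := hfull 2
    rw [← hyx, hy 2] at this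
    simpa [degTwo, degThree] using this.symm
  · have := hfull 3
    rw [← hyx, hy 3] at this
    simpa [degTwo, degThree] using this.symm
  · have : y = lp.single 2 0 (1 : ℝ) := by
      refine huniq Ω y _ hrw hyr (by simpa using hr) ?_ ?_ (fun n _ _ => hy n)
        fun n _ _ => fullResidual_single_zero Ω n
      · rw [hy2, h2, lp.single_apply]; simp
      · rw [hy3, h3, lp.single_apply]; simp
    rw [← hyA, this, unweight_single_zero]

/-- The regularity, parametrization and approximation properties of a branch at a parameter. -/
def IsBranchAt (C : ℝ) (Φ : ℝ × ℝ → ℝ × RealEll2) (p : ℝ × ℝ) : Prop :=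
  ContDiffAt ℝ (⊤ : ℕ∞) Φ p ∧ (Φ p).2 2 = p.1 ∧ (Φ p).2 3 = p.2 ∧
    |(Φ p).1 - 1 / 6| + (⨆ n : ℕ, |(Φ p).2 n - mode 0 n - p.1 * mode 2 n - p.2 * mode 3 n|) ≤
      C * (p.1 ^ 2 + p.2 ^ 2)

theorem IsBranchAt.mono {C C' : ℝ} {Φ : ℝ × ℝ → ℝ × RealEll2} {p : ℝ × ℝ} (h : IsBranchAt C Φ p)
    (hC : C ≤ C') : IsBranchAt C' Φ p :=
  ⟨h.1, h.2.1, h.2.2.1, h.2.2.2.trans (by gcongr)⟩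

theorem ContDiffAt.clm_comp_graph {E F G : Type*} [NormedAddCommGroup E] [NormedSpace ℝ E]
    [NormedAddCommGroup F] [NormedSpace ℝ F] [NormedAddCommGroup G] [NormedSpace ℝ G]
    {f : G × E → F} {c : G → E} {x : G} (hc : ContDiffAt ℝ ω c x) (hf : ContDiff ℝ ω f)
    (L : F →L[ℝ] ℝ) : ContDiffAt ℝ ω (fun q => L (f (q, c q))) x :=
  L.contDiff.contDiffAt.comp x (hf.contDiffAt.comp x (contDiffAt_id.prodMk hc))

theorem contDiffAt_coord {c : ℝ × ℝ × ℝ → RealEll2} (hc : ContDiffAt ℝ ω c 0) (n : ℕ) :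
    ContDiffAt ℝ ω (fun q => scaledResidual q (c q) n) 0 :=
  hc.clm_comp_graph (contDiff_eqResidual gradedSet) (lp.evalCLM ℝ (fun _ : ℕ => ℝ) 2 n)

/-- The local description of the stationary states near the lowest mode. -/
theorem exists_local_branches : ∃ C > (0 : ℝ), ∃ Φ₁ Φ₂ Φ₃ : ℝ × ℝ → ℝ × RealEll2, ∃ σ : ℝ → ℝ,
    (∀ᶠ p in 𝓝 (0 : ℝ × ℝ), (IsBranchAt C Φ₁ p ∧
      (p.1 = 0 → IsRealStationaryState 1 (Φ₁ p).1 (Φ₁ p).2)) ∧ (IsBranchAt C Φ₂ p ∧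
      (p.2 = 0 → IsRealStationaryState 1 (Φ₂ p).1 (Φ₂ p).2)) ∧ (IsBranchAt C Φ₃ p ∧
      (p.2 ^ 2 = σ p.1 → IsRealStationaryState 1 (Φ₃ p).1 (Φ₃ p).2))) ∧
    (∀ ε μ, Φ₃ (ε, -μ) = ((Φ₃ (ε, μ)).1, reflection (Φ₃ (ε, μ)).2)) ∧
    (∀ᶠ ε in 𝓝 (0 : ℝ), ContDiffAt ℝ (⊤ : ℕ∞) σ ε) ∧
    (fun ε => σ ε + 4 * ε ^ 3) =O[𝓝 0] (fun ε : ℝ => ε ^ 4) ∧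
    ∃ η > (0 : ℝ), ∀ (w : ℝ) (A : RealEll2), IsRealStationaryState 1 w A → |w - 1 / 6| < η →
      ‖A - mode 0‖ < η → A = mode 0 ∨ (A 3 ≠ 0 ∧ (w, A) = Φ₁ (0, A 3)) ∨
        (A 2 ≠ 0 ∧ (w, A) = Φ₂ (A 2, 0)) ∨
        (A 3 ≠ 0 ∧ A 3 ^ 2 = σ (A 2) ∧ (w, A) = Φ₃ (A 2, A 3)) := by
  obtain ⟨c, hc, hc2, hcO⟩ := exists_scaled_solution
  obtain ⟨hg2, hg3⟩ := bifurcation_expansions hc2 hcO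
  have hB : BifurcationExpansion (fun q => scaledResidual q (c q) 2)
      (fun q => scaledResidual q (c q) 3) :=
    ⟨contDiffAt_coord hc 2, contDiffAt_coord hc 3, hg2, hg3⟩
  obtain ⟨Ω₁, d1, z1, o1, i1⟩ := hB.exists_first
  obtain ⟨Ω₂, d2, z2, o2, i2⟩ := hB.exists_second
  obtain ⟨σ, Ω₃, dσ, d3, zσ, z3, o3, oσ, i3⟩ := hB.exists_third
  set Q₁ : ℝ × ℝ → ℝ × ℝ × ℝ := fun p => (0, p.2 ^ 2, Ω₁ (p.2 ^ 2)) with hQ₁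
  set Q₂ : ℝ × ℝ → ℝ × ℝ × ℝ := fun p => (p.1, 0, Ω₂ p.1) with hQ₂
  set Q₃ : ℝ × ℝ → ℝ × ℝ × ℝ := fun p => (p.1, σ p.1, Ω₃ p.1) with hQ₃
  have hfst : Tendsto (fun p : ℝ × ℝ => p.1) (𝓝 0) (𝓝 0) := continuous_fst.tendsto' _ _ rfl
  have hsq : Tendsto (fun p : ℝ × ℝ => p.2 ^ 2) (𝓝 0) (𝓝 0) :=
    (by fun_prop : Continuous fun p : ℝ × ℝ => p.2 ^ 2).tendsto' _ _ (by simp)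
  have s1 : (fun p : ℝ × ℝ => p.1 ^ 2) =O[𝓝 0] fun p : ℝ × ℝ => p.1 ^ 2 + p.2 ^ 2 :=
    isBigO_of_le _ fun p => by
      rw [Real.norm_of_nonneg (by positivity), Real.norm_of_nonneg (by positivity)]
      linarith [sq_nonneg p.2]
  have s2 : (fun p : ℝ × ℝ => p.2 ^ 2) =O[𝓝 0] fun p : ℝ × ℝ => p.1 ^ 2 + p.2 ^ 2 :=
    isBigO_of_le _ fun p => by
      rw [Real.norm_of_nonneg (by positivity), Real.norm_of_nonneg (by positivity)]
      linarith [sq_nonneg p.1]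
  have oσ2 : σ =O[𝓝 0] fun ε : ℝ => ε ^ 2 :=
    ((oσ.trans (isBigO_pow_of_le (by norm_num : 2 ≤ 4))).sub
      ((isBigO_pow_of_le (by norm_num : 2 ≤ 3)).const_mul_left 4)).congr_left fun ε => by ring
  have e1 : ContDiffAt ℝ ω (fun p : ℝ × ℝ => Ω₁ (p.2 ^ 2)) 0 :=
    ContDiffAt.comp (0 : ℝ × ℝ) (f := fun p : ℝ × ℝ => p.2 ^ 2) (by simpa using d1) (by fun_prop)
  have e2 : ContDiffAt ℝ ω (fun p : ℝ × ℝ => Ω₂ p.1) 0 := d2.comp (0 : ℝ × ℝ) contDiffAt_fst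
  have e3 : ContDiffAt ℝ ω (fun p : ℝ × ℝ => Ω₃ p.1) 0 := d3.comp (0 : ℝ × ℝ) contDiffAt_fst
  have eσ : ContDiffAt ℝ ω (fun p : ℝ × ℝ => σ p.1) 0 := dσ.comp (0 : ℝ × ℝ) contDiffAt_fst
  have q1 : ContDiffAt ℝ ω Q₁ 0 := contDiffAt_const.prodMk ((by fun_prop : ContDiffAt ℝ ω
    (fun p : ℝ × ℝ => p.2 ^ 2) 0).prodMk e1)
  have q2 : ContDiffAt ℝ ω Q₂ 0 := contDiffAt_fst.prodMk (contDiffAt_const.prodMk e2)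
  have q3 : ContDiffAt ℝ ω Q₃ 0 := contDiffAt_fst.prodMk (eσ.prodMk e3)
  have w1 : Q₁ 0 = 0 := by simp [hQ₁, z1]
  have w2 : Q₂ 0 = 0 := by simp [hQ₂, z2]
  have w3 : Q₃ 0 = 0 := by simp [hQ₃, zσ, z3]
  obtain ⟨C₁, hC₁, b1⟩ := branchMap_eventually (a := fun _ => 0) (b := fun p => p.2) hc hc2 hcO
    contDiffAt_const contDiffAt_snd q1 w1 (fun _ => rfl) (fun _ => Or.inr rfl) (fun _ => Or.inl rfl)
    s2 ((o1.comp_tendsto hsq).trans s2)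
  obtain ⟨C₂, hC₂, b2⟩ := branchMap_eventually (a := fun p => p.1) (b := fun _ => 0) hc hc2 hcO
    contDiffAt_fst contDiffAt_const q2 w2 (fun _ => rfl) (fun _ => Or.inl rfl) (fun _ => Or.inr rfl)
    (isBigO_zero _ _) ((o2.comp_tendsto hfst).trans s1)
  obtain ⟨C₃, hC₃, b3⟩ := branchMap_eventually (a := fun p => p.1) (b := fun p => p.2) hc hc2 hcO
    contDiffAt_fst contDiffAt_snd q3 w3 (fun _ => rfl) (fun _ => Or.inl rfl) (fun _ => Or.inl rfl)
    ((oσ2.comp_tendsto hfst).trans s1) ((o3.comp_tendsto hfst).trans s1)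
  have t1 : Tendsto Q₁ (𝓝 0) (𝓝 0) := by simpa only [ContinuousAt, w1] using q1.continuousAt
  have t2 : Tendsto Q₂ (𝓝 0) (𝓝 0) := by simpa only [ContinuousAt, w2] using q2.continuousAt
  have t3 : Tendsto Q₃ (𝓝 0) (𝓝 0) := by simpa only [ContinuousAt, w3] using q3.continuousAt
  have j1 : ∀ᶠ p in 𝓝 (0 : ℝ × ℝ), scaledResidual (Q₁ p) (c (Q₁ p)) 3 = 0 := by
    have : Tendsto (fun p => (Q₁ p).2) (𝓝 0) (𝓝 0) := (continuous_snd.tendsto' _ _ rfl).comp t1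
    filter_upwards [this.eventually i1] with p hp using hp.2 rfl
  have j2 : ∀ᶠ p in 𝓝 (0 : ℝ × ℝ), scaledResidual (Q₂ p) (c (Q₂ p)) 2 = 0 := by
    have : Tendsto (fun p => ((Q₂ p).1, (Q₂ p).2.2)) (𝓝 0) (𝓝 0) :=
      ((by fun_prop : Continuous fun q : ℝ × ℝ × ℝ => (q.1, q.2.2)).tendsto' _ _ rfl).comp t2
    filter_upwards [this.eventually i2] with p hp using hp.2 rfl
  have j3 : ∀ᶠ p in 𝓝 (0 : ℝ × ℝ), scaledResidual (Q₃ p) (c (Q₃ p)) 2 = 0 ∧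
      scaledResidual (Q₃ p) (c (Q₃ p)) 3 = 0 := by
    filter_upwards [t3.eventually i3] with p hp using hp.2 ⟨rfl, rfl⟩
  have hP : ∀ᶠ t : ℝ × ℝ × ℝ in 𝓝 0,
      (scaledResidual (0, t.2.1 ^ 2, t.2.2) (c (0, t.2.1 ^ 2, t.2.2)) 3 = 0 →
        Ω₁ (t.2.1 ^ 2) = t.2.2) ∧
      (scaledResidual (t.1, 0, t.2.2) (c (t.1, 0, t.2.2)) 2 = 0 → Ω₂ t.1 = t.2.2) ∧
      (scaledResidual (t.1, t.2.1 ^ 2, t.2.2) (c (t.1, t.2.1 ^ 2, t.2.2)) 2 = 0 →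
        scaledResidual (t.1, t.2.1 ^ 2, t.2.2) (c (t.1, t.2.1 ^ 2, t.2.2)) 3 = 0 →
        σ t.1 = t.2.1 ^ 2 ∧ Ω₃ t.1 = t.2.2) := by
    have k1 : Tendsto (fun t : ℝ × ℝ × ℝ => (t.2.1 ^ 2, t.2.2)) (𝓝 0) (𝓝 0) :=
      (by fun_prop : Continuous fun t : ℝ × ℝ × ℝ => (t.2.1 ^ 2, t.2.2)).tendsto' _ _ (by simp)
    have k2 : Tendsto (fun t : ℝ × ℝ × ℝ => (t.1, t.2.2)) (𝓝 0) (𝓝 0) :=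
      (by fun_prop : Continuous fun t : ℝ × ℝ × ℝ => (t.1, t.2.2)).tendsto' _ _ rfl
    have k3 : Tendsto (fun t : ℝ × ℝ × ℝ => (t.1, t.2.1 ^ 2, t.2.2)) (𝓝 0) (𝓝 0) :=
      (by fun_prop : Continuous fun t : ℝ × ℝ × ℝ => (t.1, t.2.1 ^ 2, t.2.2)).tendsto' _ _
        (by simp)
    filter_upwards [k1.eventually i1, k2.eventually i2, k3.eventually i3] with t h1 h2 h3
    exact ⟨h1.1, h2.1, fun ha hb => h3.1 ⟨ha, hb⟩⟩
  obtain ⟨η, hη, huniq⟩ := exists_uniqueness_radius hc hc2 hcO hP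
  refine ⟨C₁ + C₂ + C₃, by positivity, branchMap c (fun _ => 0) (fun p => p.2) Q₁,
    branchMap c (fun p => p.1) (fun _ => 0) Q₂, branchMap c (fun p => p.1) (fun p => p.2) Q₃, σ,
    ?_, ?_, ?_, oσ, η, hη, ?_⟩
  · filter_upwards [b1, b2, b3, j1, j2, j3, t1.eventually hc2, t2.eventually hc2,
      t3.eventually hc2] with p b1 b2 b3 j1 j2 j3 k1 k2 k3
    refine ⟨⟨IsBranchAt.mono ⟨b1.1.of_le le_top, b1.2⟩ (by linarith), fun h => ?_⟩,
      ⟨IsBranchAt.mono ⟨b2.1.of_le le_top, b2.2⟩ (by linarith), fun h => ?_⟩,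
      ⟨IsBranchAt.mono ⟨b3.1.of_le le_top, b3.2⟩ (by linarith), fun h => ?_⟩⟩
    · have := isRealStationaryState_of_scaledResidual (ε := 0) (μ := p.2) (Ω := Ω₁ (p.2 ^ 2))
        k1.2.2 (Or.inl rfl) (Or.inr j1)
      simpa [branchMap, h] using this
    · have := isRealStationaryState_of_scaledResidual (ε := p.1) (μ := 0) (Ω := Ω₂ p.1)
        (y := c (Q₂ p)) (by simpa using k2.2.2) (Or.inr (by simpa using j2)) (Or.inl rfl)
      simpa [branchMap, h] using this
    · have := isRealStationaryState_of_scaledResidual (ε := p.1) (μ := p.2) (Ω := Ω₃ p.1)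
        (y := c (Q₃ p)) (by rw [h]; exact k3.2.2) (Or.inr (by rw [h]; exact j3.1))
        (Or.inr (by rw [h]; exact j3.2))
      simpa [branchMap] using this
  · intro ε μ
    simp only [branchMap, sub_self, zero_smul, add_zero, reflection_unweight_scaleOp, hQ₃]
  · filter_upwards [dσ.eventually (by simp)] with ε h using h.of_le le_top
  · intro w A hs hw hA
    obtain ⟨⟨u1, u2, u3⟩, hAeq, r2, r3, h0⟩ := huniq w A hs hw hA
    dsimp only at u1 u2 u3
    by_cases a2 : A 2 = 0
    · by_cases a3 : A 3 = 0
      · exact Or.inl (h0 a2 a3)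
      · refine Or.inr (Or.inl ⟨a3, ?_⟩)
        have r3 := r3.resolve_left a3
        rw [a2] at r3 hAeq
        have := u1 r3
        refine Prod.ext ?_ ?_
        · simp only [branchMap, hQ₁, this]; ring
        · simp only [branchMap, hQ₁, this, sub_self, zero_smul, add_zero]; exact hAeq
    · have r2 := r2.resolve_left a2
      by_cases a3 : A 3 = 0
      · refine Or.inr (Or.inr (Or.inl ⟨a2, ?_⟩))
        rw [a3, zero_pow two_ne_zero] at r2 hAeq
        have := u2 r2
        refine Prod.ext ?_ ?_
        · simp only [branchMap, hQ₂, this]; ring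
        · simp only [branchMap, hQ₂, this, sub_self, zero_smul, add_zero]; exact hAeq
      · obtain ⟨u4, u5⟩ := u3 r2 (r3.resolve_left a3)
        refine Or.inr (Or.inr (Or.inr ⟨a3, u4.symm, ?_⟩))
        refine Prod.ext ?_ ?_
        · simp only [branchMap, hQ₃, u5]; ring
        · simp only [branchMap, hQ₃, u4, u5, sub_self, zero_smul, add_zero]; exact hAeq

theorem IsSmoothBranch.of_isBranchAt {δ C : ℝ} {Γ : Set (ℝ × ℝ)} {Φ : ℝ × ℝ → ℝ × RealEll2}
    (h : ∀ p ∈ parameterSquare δ, IsBranchAt C Φ p)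
    (hs : ∀ p ∈ Γ ∩ parameterSquare δ, IsRealStationaryState 1 (Φ p).1 (Φ p).2) :
    IsSmoothBranch δ C Γ Φ where
  smooth p hp := (h p hp).1.contDiffWithinAt
  parameters _ _ hp := ⟨(h _ hp).2.1, (h _ hp).2.2.1⟩
  bound _ _ hp := (h _ hp).2.2.2
  stationary := hs

theorem exists_pos_forall_abs_lt {P : ℝ → Prop} (h : ∀ᶠ x in 𝓝 0, P x) :
    ∃ δ > 0, ∀ x, |x| < δ → P x := by
  obtain ⟨δ, hδ, h⟩ := Metric.eventually_nhds_iff.1 h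
  exact ⟨δ, hδ, fun x hx => h (by simpa using hx)⟩

theorem exists_pos_forall_parameterSquare {P : ℝ × ℝ → Prop} (h : ∀ᶠ p in 𝓝 0, P p) :
    ∃ δ > 0, ∀ p ∈ parameterSquare δ, P p := by
  obtain ⟨δ, hδ, h⟩ := Metric.eventually_nhds_iff.1 h
  exact ⟨δ, hδ, fun p hp => h (by
    rw [dist_zero_right, Prod.norm_def]; exact max_lt hp.1 hp.2)⟩

theorem parameterSquare_mono {δ δ' : ℝ} (h : δ ≤ δ') : parameterSquare δ ⊆ parameterSquare δ' :=
  fun _ hp => ⟨hp.1.trans_le h, hp.2.trans_le h⟩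

theorem bounds_of_abs_add_four_mul_cube_le {K ε s : ℝ} (h : |s + 4 * ε ^ 3| ≤ K * ε ^ 4)
    (hε : |ε| < 1 / 5) (hKε : K * |ε| ≤ 1) :
    (ε < 0 → 0 < s ∧ s < ε ^ 2) ∧ (0 ≤ ε → s ≤ 0) := by
  have h4 : K * ε ^ 4 ≤ |ε| ^ 3 := by
    have : K * ε ^ 4 = K * |ε| * |ε| ^ 3 := by
      rw [← Even.pow_abs (by decide : Even 4) ε]; ring
    rw [this]
    exact mul_le_of_le_one_left (by positivity) hKε
  have h5 := abs_le.1 (h.trans h4)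
  constructor
  · intro hneg
    rw [abs_of_neg hneg] at h5 hε
    have h6 : 0 < (-ε) ^ 3 := by have : 0 < -ε := by linarith
                                 positivity
    have h7 : (-ε) ^ 3 * 5 < ε ^ 2 := by
      have : 0 < ε ^ 2 := sq_pos_of_neg hneg
      nlinarith
    have h8 : ε ^ 3 = -(-ε) ^ 3 := by ring
    rw [h8] at h5
    constructor <;> linarith [h5.1, h5.2]
  · intro hpos
    rw [abs_of_nonneg hpos] at h5
    have : 0 ≤ ε ^ 3 := by positivity
    linarith [h5.2]

theorem abs_sqrt_sub_le {K ε s : ℝ} (hK : 0 < K) (h : |s + 4 * ε ^ 3| ≤ K * ε ^ 4) (hε : ε < 0)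
    (hs : 0 < s) : |√s - 2 * |ε| ^ (3 / 2 : ℝ)| ≤ √K * ε ^ 2 := by
  rw [← sqrt_four_mul_cube (abs_nonneg ε)]
  refine (abs_sqrt_sub_sqrt_le hs.le (by positivity)).trans ?_
  have e : s - 4 * |ε| ^ 3 = s + 4 * ε ^ 3 := by rw [abs_of_neg hε]; ring
  rw [e]
  refine (Real.sqrt_le_sqrt h).trans_eq ?_
  rw [Real.sqrt_mul hK.le, show ε ^ 4 = (ε ^ 2) ^ 2 by ring, Real.sqrt_sq (sq_nonneg ε)]

end

theorem mainTheorem1 :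
    ∃ δ > (0 : ℝ), ∃ C > (0 : ℝ), ∃ Φ₁ Φ₂ Φ₃ : ℝ × ℝ → ℝ × RealEll2, ∃ m : ℝ → ℝ,
      IsSmoothBranch δ C {p | p.1 = 0 ∧ p.2 ≠ 0} Φ₁ ∧
      IsSmoothBranch δ C {p | p.1 ≠ 0 ∧ p.2 = 0} Φ₂ ∧
      IsSmoothBranch δ C {p | p.1 < 0 ∧ p.2 = m p.1} Φ₃ ∧
      ContDiffOn ℝ (⊤ : ℕ∞) m (Set.Ioo (-δ) 0) ∧
      (∀ ε ∈ Set.Ioo (-δ) 0,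
        0 < m ε ∧ m ε < δ ∧ |m ε - 2 * |ε| ^ (3 / 2 : ℝ)| ≤ C * ε ^ 2) ∧
      (∀ ε ∈ Set.Ioo (-δ) 0,
        IsRealStationaryState 1 (Φ₃ (ε, m ε)).1 (reflection (Φ₃ (ε, m ε)).2)) ∧
      ∃ η > (0 : ℝ), ∀ (ω : ℝ) (A : RealEll2),
        IsRealStationaryState 1 ω A → |ω - 1 / 6| < η → ‖A - mode 0‖ < η →
          A = mode 0 ∨
          (∃ μ : ℝ, μ ≠ 0 ∧ |μ| < δ ∧ (ω, A) = Φ₁ (0, μ)) ∨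
          (∃ ε : ℝ, ε ≠ 0 ∧ |ε| < δ ∧ (ω, A) = Φ₂ (ε, 0)) ∨
          (∃ ε ∈ Set.Ioo (-δ) 0,
            (ω, A) = Φ₃ (ε, m ε) ∨
            (ω, A) = ((Φ₃ (ε, m ε)).1, reflection (Φ₃ (ε, m ε)).2)) := by
  obtain ⟨C, hC, Φ₁, Φ₂, Φ₃, σ, hev, hrefl, hσ, hσO, η, hη, huniq⟩ := exists_local_branches
  obtain ⟨K, hK, hσK⟩ := hσO.exists_pos
  obtain ⟨δ₁, hδ₁, hb⟩ := exists_pos_forall_parameterSquare hev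
  obtain ⟨δ₂, hδ₂, hσ⟩ := exists_pos_forall_abs_lt (hσ.and hσK.bound)
  set δ := min (min δ₁ δ₂) (min (1 / 5) (1 / K)) with hδdef
  have hδ : 0 < δ := by positivity
  have hle1 : δ ≤ δ₁ := (min_le_left _ _).trans (min_le_left _ _)
  have hle2 : δ ≤ δ₂ := (min_le_left _ _).trans (min_le_right _ _)
  have hle3 : δ ≤ 1 / 5 := (min_le_right _ _).trans (min_le_left _ _)
  have hle4 : δ ≤ 1 / K := (min_le_right _ _).trans (min_le_right _ _)
  have hbnd : ∀ ε, |ε| < δ → |σ ε + 4 * ε ^ 3| ≤ K * ε ^ 4 := fun ε hε => by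
    have := (hσ ε (hε.trans_le hle2)).2
    rwa [Real.norm_eq_abs, Real.norm_of_nonneg (by positivity)] at this
  have hsign : ∀ ε, |ε| < δ → (ε < 0 → 0 < σ ε ∧ σ ε < ε ^ 2) ∧ (0 ≤ ε → σ ε ≤ 0) :=
    fun ε hε => bounds_of_abs_add_four_mul_cube_le (hbnd ε hε) (hε.trans_le hle3) (by
      have := (hε.trans_le hle4).le
      rw [le_div_iff₀ hK] at this
      linarith)
  have habs : ∀ ε ∈ Set.Ioo (-δ) 0, |ε| < δ := fun ε hε => by
    rw [abs_of_neg hε.2]; linarith [hε.1]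
  have hm : ∀ ε ∈ Set.Ioo (-δ) 0, √(σ ε) < δ := fun ε hε => by
    obtain ⟨h1, h2⟩ := (hsign ε (habs ε hε)).1 hε.2
    have : √(σ ε) < |ε| := by
      rw [← Real.sqrt_sq_eq_abs]; exact Real.sqrt_lt_sqrt h1.le h2
    exact this.trans (habs ε hε)
  have hsq : ∀ ε ∈ Set.Ioo (-δ) 0, √(σ ε) ^ 2 = σ ε := fun ε hε =>
    Real.sq_sqrt ((hsign ε (habs ε hε)).1 hε.2).1.le
  have hb' : ∀ p ∈ parameterSquare δ, _ := fun p hp => hb p (parameterSquare_mono hle1 hp)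
  refine ⟨δ, hδ, C + √K, by positivity, Φ₁, Φ₂, Φ₃, fun ε => √(σ ε),
    .of_isBranchAt (fun p hp => (hb' p hp).1.1.mono (by simp)) fun p hp => (hb' p hp.2).1.2 hp.1.1,
    .of_isBranchAt (fun p hp => (hb' p hp).2.1.1.mono (by simp)) fun p hp =>
      (hb' p hp.2).2.1.2 hp.1.2,
    .of_isBranchAt (fun p hp => (hb' p hp).2.2.1.mono (by simp)) fun p hp => ?_, ?_, ?_, ?_,
    min η δ, by positivity, ?_⟩
  · refine (hb' p hp.2).2.2.2 ?_
    rw [hp.1.2]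
    exact hsq p.1 ⟨(abs_lt.1 hp.2.1).1, hp.1.1⟩
  · intro ε hε
    refine ContDiffAt.contDiffWithinAt ?_
    exact (hσ ε ((habs ε hε).trans_le hle2)).1.sqrt ((hsign ε (habs ε hε)).1 hε.2).1.ne'
  · intro ε hε
    have hpos := ((hsign ε (habs ε hε)).1 hε.2).1
    refine ⟨Real.sqrt_pos.2 hpos, hm ε hε, (abs_sqrt_sub_le hK (hbnd ε (habs ε hε)) hε.2 hpos).trans ?_⟩
    gcongr
    linarith
  · intro ε hε
    have := (hb' (ε, -√(σ ε)) ⟨habs ε hε, by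
      rw [abs_neg, abs_of_nonneg (Real.sqrt_nonneg _)]; exact hm ε hε⟩).2.2.2
      (by rw [neg_sq]; exact hsq ε hε)
    rwa [hrefl] at this
  · intro ω A hs hω hA
    rw [lt_min_iff] at hω hA
    have hA2 := (abs_apply_le_norm_sub_mode A two_ne_zero).trans_lt hA.2
    have hA3 := (abs_apply_le_norm_sub_mode A three_ne_zero).trans_lt hA.2
    rcases huniq ω A hs hω.1 hA.1 with h | ⟨h, e⟩ | ⟨h, e⟩ | ⟨h, hq, e⟩
    · exact Or.inl h
    · exact Or.inr (Or.inl ⟨A 3, h, hA3, e⟩)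
    · exact Or.inr (Or.inr (Or.inl ⟨A 2, h, hA2, e⟩))
    · have hneg : A 2 < 0 := by
        by_contra! hpos
        have := (hsign _ hA2).2 hpos
        have := pow_pos (abs_pos.2 h) 2
        rw [sq_abs] at this
        linarith
      refine Or.inr (Or.inr (Or.inr ⟨A 2, ⟨(abs_lt.1 hA2).1, hneg⟩, ?_⟩))
      have hroot : √(σ (A 2)) = |A 3| := by rw [← hq, Real.sqrt_sq_eq_abs]
      beta_reduce
      rw [hroot]
      rcases abs_choice (A 3) with h3 | h3
      · rw [h3]; exact Or.inl e
      · rw [h3]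
        refine Or.inr ?_
        rw [← hrefl, neg_neg]; exact e
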